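/- **Theorem (noise-robust self-testing for the Magic Square game).** *Setting.* In the Magic Square game the referee picks $x\in\{r_1,r_2,r_3,c_1,c_2,c_3\}$ (a row or a column of a $3\times 3$ array of variables $s_{i,j}$) uniformly at random and sends it to Alice, then picks one of the three variables $y$ of $x$ uniformly at random and sends it to Bob. Alice answers $a=(a_1,a_2,a_3)\in\{-1,1\}^3$, an assignment to the three variables of $x$ in order; Bob answers $b\in\{-1,1\}$. They win iff $a_1a_2a_3=1$ (respectively $-1$ if $x=c_3$) and Alice's and Bob's values for $y$ agree. Let $\Phi$ be the density matrix of $(|00\rangle+|11\rangle)/\sqrt2$, and for $\rho\in(0,1)$ let $\Delta_\rho(\Phi^{\otimes 2})=\rho\,\Phi^{\otimes 2}+(1-\rho)\frac{I}{16}$, a state on $\mathbb C^4\otimes\mathbb C^4$. In the noisy game the players share $n\ge 1$ copies of this state; on question $x$ Alice measures a POVM $\{E^x_a\}$ on her $(\mathbb C^4)^{\otimes n}$, and on question $s_{i,j}$ Bob measures a POVM $\{F^{i,j}_b\}$ on his. Put $$P^{\mathrm{row}}_{i,j}=\sum_a a_jE^{r_i}_a,\qquad P^{\mathrm{column}}_{i,j}=\sum_a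 a_iE^{c_j}_a,\qquad Q_{i,j}=\sum_b b\,F^{i,j}_b .$$ *Trace test with parameters $t\ge1$ and $\delta$.* The game is repeated in independent rounds, with the same strategy and fresh copies of the state in each round, until each question has been asked at least $t$ times. The players pass iff for all $i,j\in\{1,2,3\}$ each of the following three frequencies differs from $1/2$ by at most $\delta$: the frequency with which Alice assigns $1$ to $s_{i,j}$ in the first $t$ rounds with question $r_i$; the same in the first $t$ rounds with question $c_j$; the frequency with which Bob answers $1$ in the first $t$ rounds with question $s_{i,j}$. *Claim.* For every $\rho_0>0$ there is a constant $C>0$, depending only on $\rho_0$, such that the following holds for all $\rho\in[\rho_0,1)$, all $n\ge1$ and all strategies as above. Let $t\ge 1$, $p\in(0,1]$, $\delta=\left(\frac{2\ln(2/p)}{t}\right)^{1/2}$ and $\epsilon_{\mathrm{win}}\ge0$. Suppose that the players pass the trace test with parameters $t,\delta$ with probability at least $p$, and that they win a single round of the noisy game with probability at least $\frac{1+\rho}2-\epsilon_{\mathrm{win}}$. Put $\gamma=\frac1{1-\rho}$ and $\epsilon=\epsilon_{\mathrm{win}}+9\delta^2$, and for $d\times d$ matrices write $A\approx_{\eta}B$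 if $\frac1{\sqrt d}\|A-B\|_F\le C\eta$. Then there is $\ell\in\{1,\dots,n\}$ such that: 1. For all $i,j$, the three matrices $P^{\mathrm{row}}_{i,j}$, $P^{\mathrm{column}}_{i,j}$, $Q_{i,j}^T$ satisfy $P^{\mathrm{row}}_{i,j}\approx_{\sqrt\epsilon}P^{\mathrm{column}}_{i,j}$, $P^{\mathrm{row}}_{i,j}\approx_{\sqrt\epsilon}Q_{i,j}^T$ and $P^{\mathrm{column}}_{i,j}\approx_{\sqrt\epsilon}Q_{i,j}^T$. 2. For all $i,j$ there are traceless Hermitian $4\times4$ matrices $\tilde P_{i,j},\tilde Q_{i,j}$ with $\tilde P_{i,j}^2=\tilde Q_{i,j}^2=I$ such that, with $M^{(\ell)}$ denoting the operator on $(\mathbb C^4)^{\otimes n}$ that acts as $M$ on the $\ell$-th factor and as the identity on the others, $P_{i,j}\approx_{\gamma\sqrt\epsilon}\tilde P_{i,j}^{(\ell)}$ for both $P_{i,j}=P^{\mathrm{row}}_{i,j}$ and $P_{i,j}=P^{\mathrm{column}}_{i,j}$, and $Q_{i,j}\approx_{\gamma\sqrt\epsilon}\tilde Q_{i,j}^{(\ell)}$.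 3. There is a $4\times4$ unitary $U$ such that for all $i,j$, for both $P_{i,j}=P^{\mathrm{row}}_{i,j}$ and $P_{i,j}=P^{\mathrm{column}}_{i,j}$, $$U^{(\ell)}P_{i,j}(U^*)^{(\ell)}\approx_{\gamma\sqrt\epsilon}(P^\star_{i,j})^{(\ell)},\qquad \bar U^{(\ell)}Q_{i,j}(U^T)^{(\ell)}\approx_{\gamma\sqrt\epsilon}\big((P^\star_{i,j})^T\big)^{(\ell)},$$ where $P^\star$ is the table of two-qubit Pauli operators $$\begin{pmatrix}X\otimes I&I\otimes X&X\otimes X\\ I\otimes Z&Z\otimes I&Z\otimes Z\\ X\otimes Z&Z\otimes X&Y\otimes Y\end{pmatrix}.$$ -/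

import Mathlib

open MeasureTheory
open scoped Matrix Kronecker ComplexOrder

namespace NoisyMS

noncomputable section

/-! ### Games, POVMs and strategies -/

/-- A two-player one-round game: a question distribution `μ` and a decision predicate `V`. -/
structure NonlocalGame (X Y A B : Type) [Fintype X] [Fintype Y] where
  μ : X → Y → ℝ
  μ_nonneg : ∀ x y, 0 ≤ μ x y
  μ_sum : ∑ x, ∑ y, μ x y = 1
  V : X → Y → A → B → Bool

/-- A POVM with outcomes in `O`. -/
structure POVM (O H : Type) [Fintype O] [Fintype H] [DecidableEq H] where
  elem : O → Matrix H H ℂ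
  posSemidef : ∀ o, (elem o).PosSemidef
  sum_eq_one : ∑ o, elem o = 1

/-- A quantum strategy: a shared density matrix on `ℂ^H ⊗ ℂ^K` and one POVM per question. -/
structure QuantumStrategy (X Y A B H K : Type) [Fintype A] [Fintype B]
    [Fintype H] [DecidableEq H] [Fintype K] [DecidableEq K] where
  state : Matrix (H × K) (H × K) ℂ
  state_posSemidef : state.PosSemidef
  state_trace : state.trace = 1
  alice : X → POVM A H
  bob : Y → POVM B K

section Game

variable {X Y A B H K : Type} [Fintype X] [Fintype Y] [Fintype A] [Fintype B]
  [Fintype H] [DecidableEq H] [Fintype K] [DecidableEq K]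

/-- The Born probability of the answers `a, b` on the questions `x, y`. -/
def QuantumStrategy.answerProb (S : QuantumStrategy X Y A B H K) (x : X) (y : Y) (a : A) (b : B) :
    ℝ :=
  (((S.alice x).elem a ⊗ₖ (S.bob y).elem b) * S.state).trace.re

/-- The probability that the strategy `S` wins one round of the game `G`. -/
def winProb (G : NonlocalGame X Y A B) (S : QuantumStrategy X Y A B H K) : ℝ :=
  ∑ x, ∑ y, ∑ a, ∑ b, G.μ x y * (if G.V x y a b then 1 else 0) * S.answerProb x y a b

open scoped MatrixOrder in
theorem trace_mul_re_nonneg {ι : Type} [Fintype ι] [DecidableEq ι] {M N : Matrix ι ι ℂ}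
    (hM : M.PosSemidef) (hN : N.PosSemidef) : 0 ≤ (M * N).trace.re := by
  obtain ⟨D, hD⟩ : ∃ D : Matrix ι ι ℂ, N = Dᴴ * D :=
    CStarAlgebra.nonneg_iff_eq_star_mul_self.mp hN.nonneg
  have h1 : (M * N).trace = (D * M * Dᴴ).trace := by
    rw [hD, ← Matrix.mul_assoc, Matrix.trace_mul_comm, ← Matrix.mul_assoc]
  rw [h1]
  exact (Complex.nonneg_iff.1 (hM.mul_mul_conjTranspose_same D).trace_nonneg).1

theorem QuantumStrategy.answerProb_nonneg {X Y A B H K : Type} [Fintype A] [Fintype B]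
    [Fintype H] [DecidableEq H] [Fintype K] [DecidableEq K]
    (S : QuantumStrategy X Y A B H K) (x : X) (y : Y) (a : A) (b : B) : 0 ≤ S.answerProb x y a b :=
  trace_mul_re_nonneg (((S.alice x).posSemidef a).kronecker ((S.bob y).posSemidef b))
    S.state_posSemidef

theorem QuantumStrategy.answerProb_sum {X Y A B H K : Type} [Fintype A] [Fintype B]
    [Fintype H] [DecidableEq H] [Fintype K] [DecidableEq K]
    (S : QuantumStrategy X Y A B H K) (x : X) (y : Y) :
    ∑ a, ∑ b, S.answerProb x y a b = 1 := by
  have h : ∑ a, ∑ b, ((S.alice x).elem a ⊗ₖ (S.bob y).elem b) =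
      (1 : Matrix (H × K) (H × K) ℂ) := by
    ext ⟨i, k⟩ ⟨j, l⟩
    have hA := congrFun (congrFun (S.alice x).sum_eq_one i) j
    have hB := congrFun (congrFun (S.bob y).sum_eq_one k) l
    simp only [Matrix.sum_apply] at hA hB
    simp only [Matrix.sum_apply, Matrix.kroneckerMap_apply]
    rw [← Finset.sum_mul_sum, hA, hB]
    by_cases h1 : i = j <;> by_cases h2 : k = l <;> simp [Matrix.one_apply, h1, h2]
  have h2 : ∑ a, ∑ b, S.answerProb x y a b =
      ((∑ a, ∑ b, ((S.alice x).elem a ⊗ₖ (S.bob y).elem b)) * S.state).trace.re := by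
    simp only [QuantumStrategy.answerProb, Finset.sum_mul, Matrix.trace_sum, Complex.re_sum]
  rw [h2, h, one_mul, S.state_trace, Complex.one_re]

/-! ### Independent repetitions -/

/-- The transcript of one round: the two questions and the two answers. -/
structure Transcript (X Y A B : Type) where
  x : X
  y : Y
  a : A
  b : B

instance : MeasurableSpace (Transcript X Y A B) := ⊤

def Transcript.equivProd : Transcript X Y A B ≃ X × Y × A × B where
  toFun r := (r.x, r.y, r.a, r.b)
  invFun q := ⟨q.1, q.2.1, q.2.2.1, q.2.2.2⟩
  left_inv _ := rfl
  right_inv _ := rfl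

instance : Fintype (Transcript X Y A B) := Fintype.ofEquiv _ Transcript.equivProd.symm

/-- The law of the transcript of one round of `G` played with `S`. -/
def roundPMF (G : NonlocalGame X Y A B) (S : QuantumStrategy X Y A B H K) :
    PMF (Transcript X Y A B) :=
  PMF.ofFintype (fun r => ENNReal.ofReal (G.μ r.x r.y * S.answerProb r.x r.y r.a r.b)) (by
    rw [← ENNReal.ofReal_sum_of_nonneg
      (fun r _ => mul_nonneg (G.μ_nonneg _ _) (S.answerProb_nonneg _ _ _ _))]
    rw [← Equiv.sum_comp Transcript.equivProd.symm]
    simp only [Fintype.sum_prod_type, Transcript.equivProd, Equiv.coe_fn_symm_mk,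
      ← Finset.mul_sum, S.answerProb_sum, mul_one, G.μ_sum, ENNReal.ofReal_one])

/-- The law of an infinite sequence of i.i.d. rounds of `G` played with `S`. -/
def repeatedMeasure (G : NonlocalGame X Y A B) (S : QuantumStrategy X Y A B H K) :
    Measure (ℕ → Transcript X Y A B) :=
  Measure.infinitePi fun _ : ℕ => (roundPMF G S).toMeasure

end Game

/-- For a sequence `q` of questions to one player and the sequence `c` of the values that this
player assigns to a fixed variable, the frequency of the value `1` among the first `t` rounds in
which the question is `u`. -/
def empFreq {Q : Type} [DecidableEq Q] (t : ℕ) (q : ℕ → Q) (u : Q) (c : ℕ → ℤˣ) : ℝ :=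
  ({k : ℕ | q k = u ∧ Nat.count (fun m => q m = u) k < t ∧ c k = 1}.ncard : ℝ) / t

/-! ### The Magic Square game -/

/-- Alice's questions: `Sum.inl i` is the `i`-th row, `Sum.inr j` the `j`-th column. -/
abbrev Line : Type := Fin 3 ⊕ Fin 3

/-- Bob's questions: the variable in row `i` and column `j` is `(i, j)`. -/
abbrev Cell : Type := Fin 3 × Fin 3

/-- The variable `y` belongs to the row or column `x`. -/
def onLine : Line → Cell → Bool
  | Sum.inl i, y => decide (y.1 = i)
  | Sum.inr j, y => decide (y.2 = j)

/-- The value that the answer `a = (a₁, a₂, a₃)` to the question `x` assigns to the variable `y`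
of the row or column `x`. -/
def assigned (x : Line) (y : Cell) (a : Fin 3 → ℤˣ) : ℤˣ :=
  match x with
  | Sum.inl _ => a y.2
  | Sum.inr _ => a y.1

/-- The required product of Alice's three answers: `-1` for the third column, `1` otherwise. -/
def lineParity (x : Line) : ℤˣ := if x = Sum.inr 2 then -1 else 1

def magicSquare : NonlocalGame Line Cell (Fin 3 → ℤˣ) ℤˣ where
  μ x y := 1 / 6 * (if onLine x y then 1 / 3 else 0)
  μ_nonneg x y := by split_ifs <;> norm_num
  μ_sum := by
    simp [Fintype.sum_prod_type, Fin.sum_univ_three, onLine]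
    norm_num
  V x y a b := decide (a 0 * a 1 * a 2 = lineParity x ∧ assigned x y a = b)

/-- The event that the players pass the trace test: every question is asked at least `t` times,
and for Bob on each variable, and for Alice on each variable in its row and in its column, the
frequency of the value `1` over the first `t` trials of that question is within `δ` of `1/2`. -/
def tracePass (t : ℕ) (δ : ℝ) : Set (ℕ → Transcript Line Cell (Fin 3 → ℤˣ) ℤˣ) :=
  {ω | (∀ u : Line, ∃ N : ℕ, t ≤ Nat.count (fun m => (ω m).x = u) N) ∧
    (∀ v : Cell, ∃ N : ℕ, t ≤ Nat.count (fun m => (ω m).y = v) N) ∧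
    ∀ i j : Fin 3,
      |empFreq t (fun k => (ω k).x) (Sum.inl i) (fun k => (ω k).a j) - 1 / 2| ≤ δ ∧
      |empFreq t (fun k => (ω k).x) (Sum.inr j) (fun k => (ω k).a i) - 1 / 2| ≤ δ ∧
      |empFreq t (fun k => (ω k).y) (i, j) (fun k => (ω k).b) - 1 / 2| ≤ δ}

/-- The probability of passing the trace-test protocol with parameters `t` and `δ`. -/
def tracePassProb {H K : Type} [Fintype H] [DecidableEq H] [Fintype K] [DecidableEq K]
    (S : QuantumStrategy Line Cell (Fin 3 → ℤˣ) ℤˣ H K) (t : ℕ) (δ : ℝ) : ℝ :=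
  (repeatedMeasure magicSquare S).real (tracePass t δ)

/-! ### The shared state -/

/-- The index set of the standard basis of `ℂ⁴ = ℂ² ⊗ ℂ²`. -/
abbrev TwoQubit : Type := Fin 2 × Fin 2

/-- The density matrix of the EPR pair, on (Alice's qubit, Bob's qubit). -/
def epr : Matrix (Fin 2 × Fin 2) (Fin 2 × Fin 2) ℂ :=
  let ψ : Fin 2 × Fin 2 → ℂ := fun q => if q.1 = q.2 then ((1 / Real.sqrt 2 : ℝ) : ℂ) else 0
  Matrix.vecMulVec ψ (star ψ)

/-- Two EPR pairs, on (Alice's two qubits, Bob's two qubits). -/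
def epr2 : Matrix (TwoQubit × TwoQubit) (TwoQubit × TwoQubit) ℂ :=
  Matrix.of fun p q =>
    epr (p.1.1, p.2.1) (q.1.1, q.2.1) * epr (p.1.2, p.2.2) (q.1.2, q.2.2)

/-- The depolarizing channel with fidelity parameter `ρ`. -/
def depolarize {ι : Type} [Fintype ι] [DecidableEq ι] (ρ : ℝ) (M : Matrix ι ι ℂ) : Matrix ι ι ℂ :=
  (ρ : ℂ) • M + ((1 - ρ : ℂ) * M.trace / (Fintype.card ι : ℂ)) • (1 : Matrix ι ι ℂ)

/-- The index set of the standard basis of `(ℂ⁴)^{⊗ n}`. -/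
abbrev Reg (n : ℕ) : Type := Fin n → TwoQubit

/-- `n` copies of a bipartite state, on (all of Alice's registers, all of Bob's registers). -/
def copies (n : ℕ) (σ : Matrix (TwoQubit × TwoQubit) (TwoQubit × TwoQubit) ℂ) :
    Matrix (Reg n × Reg n) (Reg n × Reg n) ℂ :=
  Matrix.of fun p q => ∏ k, σ (p.1 k, p.2 k) (q.1 k, q.2 k)

/-- `n` copies of two depolarized EPR pairs. -/
def noisyState (n : ℕ) (ρ : ℝ) : Matrix (Reg n × Reg n) (Reg n × Reg n) ℂ :=
  copies n (depolarize ρ epr2)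

/-! ### Observables -/

section Observables

variable {H K : Type} [Fintype H] [DecidableEq H] [Fintype K] [DecidableEq K]

/-- Alice's observable for the variable `(i, j)` when she is asked the `i`-th row. -/
def rowObs (S : QuantumStrategy Line Cell (Fin 3 → ℤˣ) ℤˣ H K) (i j : Fin 3) : Matrix H H ℂ :=
  ∑ a : Fin 3 → ℤˣ, (((a j : ℤˣ) : ℤ) : ℂ) • (S.alice (Sum.inl i)).elem a

/-- Alice's observable for the variable `(i, j)` when she is asked the `j`-th column. -/
def colObs (S : QuantumStrategy Line Cell (Fin 3 → ℤˣ) ℤˣ H K) (i j : Fin 3) : Matrix H H ℂ :=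
  ∑ a : Fin 3 → ℤˣ, (((a i : ℤˣ) : ℤ) : ℂ) • (S.alice (Sum.inr j)).elem a

/-- Bob's observable for the variable `(i, j)`. -/
def bobObs (S : QuantumStrategy Line Cell (Fin 3 → ℤˣ) ℤˣ H K) (i j : Fin 3) : Matrix K K ℂ :=
  ∑ b : ℤˣ, ((b : ℤ) : ℂ) • (S.bob (i, j)).elem b

/-- The normalized Frobenius norm `d^{-1/2} ‖M‖_F` of a `d × d` matrix. -/
def normF (M : Matrix H H ℂ) : ℝ :=
  Real.sqrt ((M * Mᴴ).trace.re / Fintype.card H)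

/-- A binary observable: a Hermitian matrix with square `1`. -/
def IsBinaryObservable (M : Matrix H H ℂ) : Prop := M.IsHermitian ∧ M * M = 1

/-- The operator on `(ℂ⁴)^{⊗ n}` that acts as `M` on the `ℓ`-th factor and as the identity on the
others. -/
def onRegister {n : ℕ} (ℓ : Fin n) (M : Matrix TwoQubit TwoQubit ℂ) : Matrix (Reg n) (Reg n) ℂ :=
  Matrix.of fun p q => if ∀ k, k ≠ ℓ → p k = q k then M (p ℓ) (q ℓ) else 0

end Observables

def pauliX : Matrix (Fin 2) (Fin 2) ℂ := !![0, 1; 1, 0]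

def pauliY : Matrix (Fin 2) (Fin 2) ℂ := !![0, -Complex.I; Complex.I, 0]

def pauliZ : Matrix (Fin 2) (Fin 2) ℂ := !![1, 0; 0, -1]

/-- The canonical measurement table `P⋆`. -/
def pauliTable : Fin 3 → Fin 3 → Matrix TwoQubit TwoQubit ℂ :=
  ![![pauliX ⊗ₖ 1, 1 ⊗ₖ pauliX, pauliX ⊗ₖ pauliX],
    ![1 ⊗ₖ pauliZ, pauliZ ⊗ₖ 1, pauliZ ⊗ₖ pauliZ],
    ![pauliX ⊗ₖ pauliZ, pauliZ ⊗ₖ pauliX, pauliY ⊗ₖ pauliY]]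

end

end NoisyMS

open NoisyMS

/-! The noisy state is diagonal in the Pauli basis: the expectation of `A ⊗ B` is the sum over Pauli
strings of `ρ ^ weight σ` times the coefficients of `A` and of `Bᵀ` at `σ`
(`trace_kronecker_mul_noisyState`). Only the identity coefficient, the normalized trace, escapes the
damping. The trace test makes it small: an exponential supermartingale argument
(`lintegral_exp_stoppedSum_le_one`, `abs_mean_le`) bounds all normalized traces by `6 * δ`.
Observables of norm at most one then have correlation at most about `ρ`, so a winning probability
near `(1 + ρ) / 2` forces near equality on every question pair. Near equality has three
consequences: Alice's observable is close to the transpose of Bob's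
(`normF_sub_sq_le_of_noiseCorr`), its norm is close to one, and it has little mass on strings of
weight at least two (`weights_le_of_noiseCorr`). The last one exploits the gap between `ρ` and `ρ ^
2`, which is where `γ = 1 / (1 - ρ)` enters.

Hence each observable is almost an involution and almost a sum of traceless single-register
operators. Squaring such a sum creates cross terms between registers, which an approximate
involution cannot have; so one register carries nearly everything, a noncommutative
Friedgut–Kalai–Naor theorem (`exists_register_of_close_to_regSum`). There the operator is rounded to
a traceless binary observable (`exists_binaryObservable_onRegister`).

Wrong parities are also rare (`ntr_bad_parity_le`). In a dilation of Alice's POVM her three answers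
are commuting diagonal unitaries, so the parity constraint passes to the rounded observables in any
order of multiplication (`normF_mul_mul_sub_le`). A product of traceless observables, one of which
is alone on its register, has trace zero and cannot be near a sign; so the observables of a line
share a register, and overlapping lines make it common to all (`relations_of_parity`).

What remains is a four-dimensional approximate solution of the magic square relations. These imply
approximate anticommutation, and summing over the group generated by two of the observables gives an
approximate intertwiner with the Pauli table, whose polar part is the required unitary
(`exists_unitary_of_magicSquare_relations`). When the claimed error exceeds a constant, the
conclusions hold trivially because all observables have norm at most one
(`registerSelfTest_of_two_le`). -/

namespace NoisyMS

set_option linter.unusedSectionVars false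

/-! ### Normalized Frobenius norm and normalized trace. -/

section Norms
open scoped Matrix.Norms.Frobenius

theorem frobenius_norm_sq {m n : Type*} [Fintype m] [Fintype n] (M : Matrix m n ℂ) :
    ‖M‖ ^ 2 = (Mᴴ * M).trace.re := by
  rw [Matrix.frobenius_norm_def, ← Real.rpow_natCast, ← Real.rpow_mul (by positivity)]
  norm_num
  rw [Matrix.trace, Complex.re_sum, Finset.sum_comm]
  refine Finset.sum_congr rfl fun i _ => ?_
  rw [Matrix.diag_apply, Matrix.mul_apply, Complex.re_sum]
  refine Finset.sum_congr rfl fun j _ => ?_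
  rw [Matrix.conjTranspose_apply, ← starRingEnd_apply, ← Complex.normSq_eq_conj_mul_self, Complex.ofReal_re,
    Complex.normSq_eq_norm_sq]

theorem norm_entry_le_frobenius {m n : Type*} [Fintype m] [Fintype n] (M : Matrix m n ℂ)
    (i : m) (j : n) : ‖M i j‖ ≤ ‖M‖ := by
  refine abs_le_of_sq_le_sq' ?_ (norm_nonneg _) |>.2
  have h : ‖M‖ ^ 2 = ∑ i, ∑ j, ‖M i j‖ ^ 2 := by
    rw [Matrix.frobenius_norm_def, ← Real.rpow_natCast, ← Real.rpow_mul (by positivity)]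
    norm_num
  rw [h]
  calc ‖M i j‖ ^ 2 ≤ ∑ j, ‖M i j‖ ^ 2 :=
        Finset.single_le_sum (f := fun j => ‖M i j‖ ^ 2) (fun _ _ => by positivity)
          (Finset.mem_univ j)
    _ ≤ _ := Finset.single_le_sum (f := fun i => ∑ j, ‖M i j‖ ^ 2)
          (fun _ _ => by positivity) (Finset.mem_univ i)

theorem frobenius_mul_of_isometry {m n k : Type*} [Fintype m] [Fintype n] [DecidableEq n]
    [Fintype k] {D : Matrix m n ℂ} (hD : Dᴴ * D = 1) (M : Matrix n k ℂ) : ‖D * M‖ = ‖M‖ := by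
  rw [← sq_eq_sq₀ (norm_nonneg _) (norm_nonneg _), frobenius_norm_sq, frobenius_norm_sq,
    Matrix.conjTranspose_mul, Matrix.mul_assoc, ← Matrix.mul_assoc Dᴴ, hD, Matrix.one_mul]

theorem frobenius_mul_of_coisometry {m n k : Type*} [Fintype m] [Fintype n] [DecidableEq n]
    [Fintype k] {D : Matrix n m ℂ} (hD : D * Dᴴ = 1) (M : Matrix k n ℂ) : ‖M * D‖ = ‖M‖ := by
  have := frobenius_mul_of_isometry (D := Dᴴ) (by simpa using hD) Mᴴ
  rwa [← Matrix.conjTranspose_mul, Matrix.frobenius_norm_conjTranspose,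
    Matrix.frobenius_norm_conjTranspose] at this

/-- Cauchy–Schwarz for the Hilbert–Schmidt inner product. -/
theorem norm_trace_mul_le {m n : Type*} [Fintype m] [Fintype n] (M : Matrix m n ℂ)
    (N : Matrix n m ℂ) : ‖(M * N).trace‖ ≤ ‖M‖ * ‖N‖ := by
  have h1 : ‖(M * N).trace‖ ≤ ∑ p : m × n, ‖M p.1 p.2‖ * ‖N p.2 p.1‖ := by
    rw [Matrix.trace, Fintype.sum_prod_type]
    refine (norm_sum_le _ _).trans (Finset.sum_le_sum fun i _ => ?_)
    rw [Matrix.diag_apply, Matrix.mul_apply]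
    exact (norm_sum_le _ _).trans (Finset.sum_le_sum fun j _ => (norm_mul_le _ _))
  refine h1.trans ((Real.sum_mul_le_sqrt_mul_sqrt _ _ _).trans (le_of_eq ?_))
  congr 1
  · rw [Matrix.frobenius_norm_def, Real.sqrt_eq_rpow, Fintype.sum_prod_type]
    simp
  · rw [Matrix.frobenius_norm_def, Real.sqrt_eq_rpow, Fintype.sum_prod_type_right]
    simp

variable {H : Type} [Fintype H] [DecidableEq H]

/-- The normalized trace. -/
noncomputable def ntr (M : Matrix H H ℂ) : ℂ := M.trace / Fintype.card H

theorem normF_eq (M : Matrix H H ℂ) : normF M = ‖M‖ / Real.sqrt (Fintype.card H) := by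
  have : (M * Mᴴ).trace.re = ‖M‖ ^ 2 := by rw [Matrix.trace_mul_comm, frobenius_norm_sq]
  rw [normF, this, Real.sqrt_div (by positivity), Real.sqrt_sq (norm_nonneg _)]

theorem normF_nonneg (M : Matrix H H ℂ) : 0 ≤ normF M := Real.sqrt_nonneg _

theorem normF_add_le (M N : Matrix H H ℂ) : normF (M + N) ≤ normF M + normF N := by
  rw [normF_eq, normF_eq, normF_eq, ← add_div]
  gcongr
  exact norm_add_le _ _

theorem normF_neg (M : Matrix H H ℂ) : normF (-M) = normF M := by
  rw [normF_eq, normF_eq, norm_neg]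

theorem normF_zero : normF (0 : Matrix H H ℂ) = 0 := by
  rw [normF_eq, norm_zero, zero_div]

theorem normF_sub_comm (M N : Matrix H H ℂ) : normF (M - N) = normF (N - M) := by
  rw [← normF_neg, neg_sub]

theorem normF_sub_le (M N : Matrix H H ℂ) : normF (M - N) ≤ normF M + normF N := by
  rw [sub_eq_add_neg, ← normF_neg N]
  exact normF_add_le _ _

theorem normF_triangle (M N L : Matrix H H ℂ) :
    normF (M - L) ≤ normF (M - N) + normF (N - L) := by
  simpa using normF_add_le (M - N) (N - L)

theorem normF_smul (c : ℂ) (M : Matrix H H ℂ) : normF (c • M) = ‖c‖ * normF M := by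
  rw [normF_eq, normF_eq, norm_smul, mul_div_assoc]

theorem normF_transpose (M : Matrix H H ℂ) : normF Mᵀ = normF M := by
  rw [normF_eq, normF_eq, Matrix.frobenius_norm_transpose]

theorem normF_conjTranspose (M : Matrix H H ℂ) : normF Mᴴ = normF M := by
  rw [normF_eq, normF_eq, Matrix.frobenius_norm_conjTranspose]

theorem normF_unitary_mul {U : Matrix H H ℂ} (hU : Uᴴ * U = 1) (M : Matrix H H ℂ) :
    normF (U * M) = normF M := by
  rw [normF_eq, normF_eq, frobenius_mul_of_isometry hU]

theorem normF_mul_unitary {U : Matrix H H ℂ} (hU : U * Uᴴ = 1) (M : Matrix H H ℂ) :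
    normF (M * U) = normF M := by
  rw [normF_eq, normF_eq, frobenius_mul_of_coisometry hU]

theorem norm_ntr_mul_le (M N : Matrix H H ℂ) : ‖ntr (M * N)‖ ≤ normF M * normF N := by
  rw [ntr, normF_eq, normF_eq, div_mul_div_comm, Real.mul_self_sqrt (by positivity), norm_div,
    Complex.norm_natCast]
  gcongr
  exact norm_trace_mul_le M N

theorem normF_sq (M : Matrix H H ℂ) : normF M ^ 2 = (ntr (Mᴴ * M)).re := by
  rw [normF_eq, div_pow, Real.sq_sqrt (by positivity), frobenius_norm_sq, ntr,
    Complex.div_natCast_re]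

theorem ntr_add (M N : Matrix H H ℂ) : ntr (M + N) = ntr M + ntr N := by
  simp [ntr, Matrix.trace_add, add_div]

theorem ntr_sub (M N : Matrix H H ℂ) : ntr (M - N) = ntr M - ntr N := by
  simp [ntr, Matrix.trace_sub, sub_div]

theorem ntr_neg (M : Matrix H H ℂ) : ntr (-M) = -ntr M := by
  simp [ntr, Matrix.trace_neg, neg_div]

theorem ntr_smul (c : ℂ) (M : Matrix H H ℂ) : ntr (c • M) = c * ntr M := by
  simp [ntr, Matrix.trace_smul, mul_div_assoc]

theorem ntr_sum {ι : Type*} (s : Finset ι) (f : ι → Matrix H H ℂ) :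
    ntr (∑ i ∈ s, f i) = ∑ i ∈ s, ntr (f i) := by
  simp [ntr, Matrix.trace_sum, Finset.sum_div]

theorem ntr_mul_comm (M N : Matrix H H ℂ) : ntr (M * N) = ntr (N * M) := by
  rw [ntr, ntr, Matrix.trace_mul_comm]

theorem ntr_one [Nonempty H] : ntr (1 : Matrix H H ℂ) = 1 := by
  simp [ntr]

theorem ntr_conjTranspose (M : Matrix H H ℂ) : ntr Mᴴ = star (ntr M) := by
  simp [ntr, Matrix.trace_conjTranspose]

theorem ntr_transpose (M : Matrix H H ℂ) : ntr Mᵀ = ntr M := by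
  simp [ntr, Matrix.trace_transpose]

theorem normF_one [Nonempty H] : normF (1 : Matrix H H ℂ) = 1 := by
  have := normF_sq (1 : Matrix H H ℂ)
  rw [Matrix.conjTranspose_one, Matrix.one_mul, ntr_one, Complex.one_re] at this
  nlinarith [normF_nonneg (1 : Matrix H H ℂ)]

theorem norm_ntr_le [Nonempty H] (M : Matrix H H ℂ) : ‖ntr M‖ ≤ normF M := by
  simpa [normF_one] using norm_ntr_mul_le M 1

theorem ntr_re_nonneg_of_posSemidef {M : Matrix H H ℂ} (hM : M.PosSemidef) : 0 ≤ (ntr M).re := by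
  rw [ntr, Complex.div_natCast_re]
  exact div_nonneg (Complex.nonneg_iff.1 hM.trace_nonneg).1 (by positivity)

/-- A Hermitian matrix whose square is at most the identity does not increase the norm. -/
theorem normF_mul_le_of_contraction {P : Matrix H H ℂ} (hP : P.IsHermitian)
    (h1 : (1 - P * P).PosSemidef) (M : Matrix H H ℂ) : normF (M * P) ≤ normF M := by
  refine abs_le_of_sq_le_sq' ?_ (normF_nonneg _) |>.2
  have h := ntr_re_nonneg_of_posSemidef (h1.mul_mul_conjTranspose_same M)
  rw [← normF_conjTranspose M, ← normF_conjTranspose (M * P), normF_sq, normF_sq]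
  rw [Matrix.mul_sub, Matrix.sub_mul, ntr_sub, Complex.sub_re] at h
  simp only [Matrix.conjTranspose_conjTranspose, Matrix.conjTranspose_mul, hP.eq]
  simp only [Matrix.mul_one, Matrix.mul_assoc] at h ⊢
  linarith

theorem normF_contraction_mul_le {P : Matrix H H ℂ} (hP : P.IsHermitian)
    (h1 : (1 - P * P).PosSemidef) (M : Matrix H H ℂ) : normF (P * M) ≤ normF M := by
  have := normF_mul_le_of_contraction hP h1 Mᴴ
  rwa [← normF_conjTranspose, Matrix.conjTranspose_mul, Matrix.conjTranspose_conjTranspose, hP.eq,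
    normF_conjTranspose] at this

theorem normF_le_one_of_contraction [Nonempty H] {P : Matrix H H ℂ} (hP : P.IsHermitian)
    (h1 : (1 - P * P).PosSemidef) : normF P ≤ 1 := by
  simpa [normF_one] using normF_mul_le_of_contraction hP h1 1

/-- On eigenvalues this is `(1 - x ^ 2) ^ 2 ≤ 1 - x ^ 2` for `|x| ≤ 1`, averaged. It converts a norm
close to one into a square close to the identity. -/
theorem normF_one_sub_sq_le {P : Matrix H H ℂ} [Nonempty H] (hP : P.IsHermitian)
    (h1 : (1 - P * P).PosSemidef) : normF (1 - P * P) ^ 2 ≤ 1 - normF P ^ 2 := by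
  have h := ntr_re_nonneg_of_posSemidef (h1.mul_mul_conjTranspose_same P)
  rw [normF_sq, normF_sq, h1.1.eq, hP.eq]
  rw [hP.eq, ntr_mul_comm, ← Matrix.mul_assoc] at h
  have e : (1 - P * P) * (1 - P * P) = 1 - P * P - P * P * (1 - P * P) := by
    noncomm_ring
  rw [e, ntr_sub, ntr_sub, ntr_one]
  simp only [Complex.sub_re, Complex.one_re]
  linarith

end Norms

/-! ### Polar decomposition near the unitaries -/

section Polar
variable {H : Type} [Fintype H] [DecidableEq H]

/-- For an eigenvalue `s ≥ 0`, `|s ^ 2 - 1| = |s - 1| * (s + 1) ≥ |s - 1|`. -/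
theorem normF_sub_one_le_of_posSemidef {S : Matrix H H ℂ} (hS : S.PosSemidef) :
    normF (S - 1) ≤ normF (S * S - 1) := by
  refine abs_le_of_sq_le_sq' ?_ (normF_nonneg _) |>.2
  have hH : (S - 1).IsHermitian := hS.1.sub Matrix.isHermitian_one
  have h2 : (S * S - 1).IsHermitian := by
    have : (S * S).IsHermitian := by
      rw [Matrix.IsHermitian, Matrix.conjTranspose_mul, hS.1.eq]
    exact this.sub Matrix.isHermitian_one
  have a := ntr_re_nonneg_of_posSemidef (hS.mul_mul_conjTranspose_same (S - 1))
  have hSS : (S * S).PosSemidef := by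
    simpa [hS.1.eq] using Matrix.posSemidef_conjTranspose_mul_self S
  have b := ntr_re_nonneg_of_posSemidef (hSS.mul_mul_conjTranspose_same (S - 1))
  rw [hH.eq] at a b
  rw [normF_sq, normF_sq, hH.eq, h2.eq]
  -- The middle factor `(S + 1) ^ 2` is expanded as `1 + S * S + S + S`; all summands but the first
  -- contribute nonnegative traces.
  have e : (S * S - 1) * (S * S - 1) = (S - 1) * (S - 1) + (S - 1) * (S * S) * (S - 1)
      + (S - 1) * S * (S - 1) + (S - 1) * S * (S - 1) := by noncomm_ring
  rw [e]
  simp only [ntr_add, Complex.add_re]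
  linarith

-- Neumann series in the Frobenius norm; the square root of the dimension undoes the normalization
-- of `normF`.
open scoped Matrix.Norms.Frobenius in
theorem isUnit_of_normF_sub_one_lt {M : Matrix H H ℂ}
    (h : normF (M - 1) * Real.sqrt (Fintype.card H) < 1) : IsUnit M := by
  rcases isEmpty_or_nonempty H with hH | hH
  · exact isUnit_of_subsingleton M
  rw [normF_eq, div_mul_cancel₀ _ (by positivity)] at h
  have : ‖1 - M‖ < 1 := by rwa [norm_sub_rev]
  simpa using (Units.oneSub (1 - M) this).isUnit

open scoped MatrixOrder in
/-- A matrix `T` with `Tᴴ * T` close to the identity is close to a unitary matrix `T * R`, where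
`R` is Hermitian and commutes with everything that commutes with `Tᴴ * T`. -/
theorem exists_polar {T : Matrix H H ℂ}
    (h : normF (Tᴴ * T - 1) * Real.sqrt (Fintype.card H) < 1) :
    ∃ R : Matrix H H ℂ, R.IsHermitian ∧ (∀ N, Commute (Tᴴ * T) N → Commute R N) ∧
      (T * R)ᴴ * (T * R) = 1 ∧ normF (T - T * R) ≤ normF (Tᴴ * T - 1) := by
  have h0 : 0 ≤ Tᴴ * T := (Matrix.posSemidef_conjTranspose_mul_self T).nonneg
  set S := CFC.sqrt (Tᴴ * T) with hSd
  have hSS : S * S = Tᴴ * T := CFC.sqrt_mul_sqrt_self _ h0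
  have hS : S.PosSemidef := Matrix.nonneg_iff_posSemidef.1 (CFC.sqrt_nonneg _)
  have hu : IsUnit (S * S) := by rw [hSS]; exact isUnit_of_normF_sub_one_lt h
  have huS : IsUnit S := by
    rw [Matrix.isUnit_iff_isUnit_det] at hu ⊢
    rw [Matrix.det_mul] at hu
    exact isUnit_of_mul_isUnit_left hu
  have hd : IsUnit S.det := (Matrix.isUnit_iff_isUnit_det S).1 huS
  have hinv : (S⁻¹).IsHermitian := hS.1.inv
  have hU : (T * S⁻¹)ᴴ * (T * S⁻¹) = 1 := by
    rw [Matrix.conjTranspose_mul, hinv.eq, Matrix.mul_assoc, ← Matrix.mul_assoc Tᴴ, ← hSS,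
      Matrix.mul_assoc, Matrix.mul_nonsing_inv _ hd, Matrix.mul_one, Matrix.nonsing_inv_mul _ hd]
  refine ⟨S⁻¹, hinv, fun N hN => ?_, hU, ?_⟩
  -- The square root is obtained by functional calculus, so it inherits every commutation relation
  -- of `Tᴴ * T`, and the inverse inherits it in turn.
  · have hc : Commute S N := by
      rw [hSd, CFC.sqrt_eq_cfc]
      exact hN.cfc_nnreal _ 
    have := hc.eq
    rw [Commute, SemiconjBy]
    calc S⁻¹ * N = S⁻¹ * (N * S) * S⁻¹ := by
          rw [Matrix.mul_assoc, Matrix.mul_assoc, Matrix.mul_nonsing_inv _ hd, Matrix.mul_one]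
      _ = N * S⁻¹ := by
          rw [← this, ← Matrix.mul_assoc, Matrix.nonsing_inv_mul _ hd, Matrix.one_mul]
  · have e : T - T * S⁻¹ = (T * S⁻¹) * (S - 1) := by
      rw [Matrix.mul_sub, Matrix.mul_assoc, Matrix.nonsing_inv_mul _ hd, Matrix.mul_one,
        Matrix.mul_one]
    rw [e, normF_unitary_mul hU, ← hSS]
    exact normF_sub_one_le_of_posSemidef hS

end Polar

/-! ### POVMs as compressions of diagonal observables -/

section Dilation
variable {O H : Type} [Fintype O] [DecidableEq O] [Fintype H] [DecidableEq H]

-- Naimark dilation: `D` stacks factors `D o` with `E.elem o = (D o)ᴴ * D o`. The case `f = 1` says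
-- that `D` is an isometry, and sign-valued `f` give commuting unitaries upstairs.
open scoped MatrixOrder in
theorem POVM.exists_dilation (E : POVM O H) :
    ∃ D : Matrix (O × H) H ℂ, ∀ f : O → ℂ,
      Dᴴ * Matrix.diagonal (fun q : O × H => f q.1) * D = ∑ o, f o • E.elem o := by
  have h : ∀ o, ∃ D : Matrix H H ℂ, E.elem o = Dᴴ * D := fun o =>
    CStarAlgebra.nonneg_iff_eq_star_mul_self.mp (E.posSemidef o).nonneg
  choose D hD using h
  refine ⟨Matrix.of fun q i => D q.1 q.2 i, fun f => ?_⟩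
  ext i j
  rw [Matrix.mul_apply]
  simp only [Matrix.mul_diagonal]
  simp only [Matrix.mul_apply, Matrix.conjTranspose_apply, Matrix.of_apply,
    Matrix.sum_apply, Matrix.smul_apply, hD, smul_eq_mul, Finset.mul_sum, Fintype.sum_prod_type]
  refine Finset.sum_congr rfl fun o _ => Finset.sum_congr rfl fun k _ => ?_
  ring

end Dilation

/-! ### Product operators and single-register operators -/

section Registers
variable {n : ℕ}

/-- The tensor product of the operators `M k` on the registers `k`. -/
noncomputable def prodMat (M : Fin n → Matrix TwoQubit TwoQubit ℂ) : Matrix (Reg n) (Reg n) ℂ :=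
  Matrix.of fun p q => ∏ k, M k (p k) (q k)

theorem prodMat_mul (M N : Fin n → Matrix TwoQubit TwoQubit ℂ) :
    prodMat M * prodMat N = prodMat fun k => M k * N k := by
  ext p q
  simp only [prodMat, Matrix.mul_apply, Matrix.of_apply, ← Finset.prod_mul_distrib]
  rw [Finset.prod_univ_sum, Fintype.piFinset_univ]

theorem trace_prodMat (M : Fin n → Matrix TwoQubit TwoQubit ℂ) :
    (prodMat M).trace = ∏ k, (M k).trace := by
  simp only [prodMat, Matrix.trace, Matrix.diag_apply, Matrix.of_apply]
  rw [Finset.prod_univ_sum, Fintype.piFinset_univ]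

theorem ntr_prodMat (M : Fin n → Matrix TwoQubit TwoQubit ℂ) :
    ntr (prodMat M) = ∏ k, ntr (M k) := by
  simp only [ntr, trace_prodMat, Finset.prod_div_distrib]
  simp

theorem prodMat_conjTranspose (M : Fin n → Matrix TwoQubit TwoQubit ℂ) :
    (prodMat M)ᴴ = prodMat fun k => (M k)ᴴ := by
  ext p q
  simp [prodMat, Matrix.conjTranspose_apply]

theorem prodMat_one : prodMat (fun _ : Fin n => 1) = 1 := by
  ext p q
  simp only [prodMat, Matrix.of_apply, Matrix.one_apply, funext_iff]
  rw [Finset.prod_ite_zero]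
  simp

/-- Reduces the algebra of single-register operators to computations register by register. -/
theorem onRegister_eq_prodMat (ℓ : Fin n) (M : Matrix TwoQubit TwoQubit ℂ) :
    onRegister ℓ M = prodMat (Function.update (fun _ => 1) ℓ M) := by
  ext p q
  simp only [onRegister, prodMat, Matrix.of_apply]
  rw [← Finset.mul_prod_erase _ _ (Finset.mem_univ ℓ), Function.update_self]
  have : ∏ k ∈ Finset.univ.erase ℓ, Function.update (fun _ : Fin n => (1 : Matrix TwoQubit TwoQubit ℂ)) ℓ M k (p k) (q k) =
      if ∀ k, k ≠ ℓ → p k = q k then (1 : ℂ) else 0 := by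
    rw [Finset.prod_congr rfl (g := fun k => if p k = q k then (1 : ℂ) else 0)]
    · rw [Finset.prod_ite_zero]
      simp
    · intro k hk
      rw [Function.update_of_ne (Finset.ne_of_mem_erase hk), Matrix.one_apply]
  rw [this]
  split_ifs <;> simp

theorem onRegister_mul (ℓ : Fin n) (M N : Matrix TwoQubit TwoQubit ℂ) :
    onRegister ℓ (M * N) = onRegister ℓ M * onRegister ℓ N := by
  simp only [onRegister_eq_prodMat, prodMat_mul]
  congr 1
  ext1 k
  by_cases hk : k = ℓ
  · subst hk; simp
  · simp [Function.update_of_ne hk]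

theorem onRegister_one (ℓ : Fin n) : onRegister ℓ 1 = 1 := by
  rw [onRegister_eq_prodMat, ← prodMat_one]
  congr 1
  ext1 k
  by_cases hk : k = ℓ
  · subst hk; simp
  · simp [Function.update_of_ne hk]

theorem onRegister_add (ℓ : Fin n) (M N : Matrix TwoQubit TwoQubit ℂ) :
    onRegister ℓ (M + N) = onRegister ℓ M + onRegister ℓ N := by
  ext p q
  simp only [onRegister, Matrix.of_apply, Matrix.add_apply]
  split_ifs <;> simp

theorem onRegister_sub (ℓ : Fin n) (M N : Matrix TwoQubit TwoQubit ℂ) :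
    onRegister ℓ (M - N) = onRegister ℓ M - onRegister ℓ N := by
  ext p q
  simp only [onRegister, Matrix.of_apply, Matrix.sub_apply]
  split_ifs <;> simp

theorem onRegister_smul (ℓ : Fin n) (c : ℂ) (M : Matrix TwoQubit TwoQubit ℂ) :
    onRegister ℓ (c • M) = c • onRegister ℓ M := by
  ext p q
  simp only [onRegister, Matrix.of_apply, Matrix.smul_apply]
  split_ifs <;> simp

theorem onRegister_sum {ι : Type*} (s : Finset ι) (ℓ : Fin n)
    (f : ι → Matrix TwoQubit TwoQubit ℂ) :
    onRegister ℓ (∑ i ∈ s, f i) = ∑ i ∈ s, onRegister ℓ (f i) := by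
  ext p q
  simp only [onRegister, Matrix.of_apply, Matrix.sum_apply]
  split_ifs <;> simp

theorem onRegister_conjTranspose (ℓ : Fin n) (M : Matrix TwoQubit TwoQubit ℂ) :
    onRegister ℓ Mᴴ = (onRegister ℓ M)ᴴ := by
  ext p q
  simp only [onRegister, Matrix.of_apply, Matrix.conjTranspose_apply, eq_comm (a := p _)]
  split_ifs <;> simp

theorem onRegister_transpose (ℓ : Fin n) (M : Matrix TwoQubit TwoQubit ℂ) :
    onRegister ℓ Mᵀ = (onRegister ℓ M)ᵀ := by
  ext p q
  simp only [onRegister, Matrix.of_apply, Matrix.transpose_apply, eq_comm (a := p _)]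

theorem ntr_onRegister (ℓ : Fin n) (M : Matrix TwoQubit TwoQubit ℂ) :
    ntr (onRegister ℓ M) = ntr M := by
  rw [onRegister_eq_prodMat, ntr_prodMat, ← Finset.mul_prod_erase _ _ (Finset.mem_univ ℓ),
    Function.update_self, Finset.prod_congr rfl (g := fun _ => 1), Finset.prod_const_one, mul_one]
  intro k hk
  rw [Function.update_of_ne (Finset.ne_of_mem_erase hk), ntr_one]

theorem normF_onRegister (ℓ : Fin n) (M : Matrix TwoQubit TwoQubit ℂ) :
    normF (onRegister ℓ M) = normF M := by
  rw [← sq_eq_sq₀ (normF_nonneg _) (normF_nonneg _), normF_sq, normF_sq,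
    ← onRegister_conjTranspose, ← onRegister_mul, ntr_onRegister]

theorem onRegister_commute {ℓ m : Fin n} (h : ℓ ≠ m) (M N : Matrix TwoQubit TwoQubit ℂ) :
    Commute (onRegister ℓ M) (onRegister m N) := by
  rw [Commute, SemiconjBy]
  simp only [onRegister_eq_prodMat, prodMat_mul]
  congr 1
  ext1 k
  by_cases hk : k = ℓ
  · subst hk; simp [Function.update_of_ne h]
  · simp [Function.update_of_ne hk]

end Registers

/-! ### Pauli expansions -/

noncomputable def pauli : Fin 4 → Matrix (Fin 2) (Fin 2) ℂ := ![1, pauliX, pauliY, pauliZ]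

theorem pauli_isHermitian (s : Fin 4) : (pauli s).IsHermitian := by
  rw [Matrix.IsHermitian]
  fin_cases s <;> ext i j <;> fin_cases i <;> fin_cases j <;>
    simp [pauli, pauliX, pauliY, pauliZ, Matrix.conjTranspose_apply]

theorem pauli_mul_self (s : Fin 4) : pauli s * pauli s = 1 := by
  fin_cases s <;> ext i j <;> fin_cases i <;> fin_cases j <;>
    simp [pauli, pauliX, pauliY, pauliZ, Matrix.mul_apply, Fin.sum_univ_two]

/-- The sum of `P ⊗ P` over the Pauli matrices is twice the swap operator. This one identity gives
both the inversion formula for Pauli coefficients and the Pauli expansion of the EPR pairs. -/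
theorem pauli_complete (i j k l : Fin 2) :
    ∑ s, pauli s i j * pauli s k l = if i = l ∧ j = k then 2 else 0 := by
  fin_cases i <;> fin_cases j <;> fin_cases k <;> fin_cases l <;>
    simp [pauli, pauliX, pauliY, pauliZ, Fin.sum_univ_four] <;> norm_num

theorem trace_pauli_mul (s t : Fin 4) : (pauli s * pauli t).trace = if s = t then 2 else 0 := by
  fin_cases s <;> fin_cases t <;>
    simp [pauli, pauliX, pauliY, pauliZ, Matrix.trace, Fin.sum_univ_two] <;>
    norm_num

theorem exists_anticommuting_pauli {s : Fin 4} (hs : s ≠ 0) :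
    ∃ t, pauli t * pauli s = -(pauli s * pauli t) := by
  have h : ∀ s : Fin 4, s = 0 ∨ ∃ t, pauli t * pauli s = -(pauli s * pauli t) := by
    intro s
    fin_cases s
    · left; rfl
    · right; refine ⟨3, ?_⟩
      ext i j; fin_cases i <;> fin_cases j <;>
        simp [pauli, pauliX, pauliZ, Matrix.mul_apply, Fin.sum_univ_two]
    · right; refine ⟨1, ?_⟩
      ext i j; fin_cases i <;> fin_cases j <;>
        simp [pauli, pauliX, pauliY, Matrix.mul_apply, Fin.sum_univ_two]
    · right; refine ⟨1, ?_⟩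
      ext i j; fin_cases i <;> fin_cases j <;>
        simp [pauli, pauliX, pauliZ, Matrix.mul_apply, Fin.sum_univ_two]
  exact (h s).resolve_left hs

/-- Labels of the two-qubit Pauli operators. -/
abbrev PauliLabel : Type := Fin 4 × Fin 4

noncomputable def pauli₂ (s : PauliLabel) : Matrix TwoQubit TwoQubit ℂ := pauli s.1 ⊗ₖ pauli s.2

theorem pauli₂_zero : pauli₂ 0 = 1 := by
  simp [pauli₂, pauli]

theorem pauli₂_isHermitian (s : PauliLabel) : (pauli₂ s).IsHermitian := by
  rw [Matrix.IsHermitian, pauli₂, Matrix.conjTranspose_kronecker, (pauli_isHermitian _).eq,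
    (pauli_isHermitian _).eq]

theorem pauli₂_mul_self (s : PauliLabel) : pauli₂ s * pauli₂ s = 1 := by
  rw [pauli₂, ← Matrix.mul_kronecker_mul, pauli_mul_self, pauli_mul_self, Matrix.one_kronecker_one]

theorem pauli₂_complete (i j k l : TwoQubit) :
    ∑ s, pauli₂ s i j * pauli₂ s k l = if i = l ∧ j = k then 4 else 0 := by
  have h : ∑ s, pauli₂ s i j * pauli₂ s k l =
      (∑ s, pauli s i.1 j.1 * pauli s k.1 l.1) * ∑ s, pauli s i.2 j.2 * pauli s k.2 l.2 := by
    rw [Finset.sum_mul_sum, Fintype.sum_prod_type]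
    refine Finset.sum_congr rfl fun s _ => Finset.sum_congr rfl fun t _ => ?_
    simp only [pauli₂, Matrix.kroneckerMap_apply]
    ring
  rw [h, pauli_complete, pauli_complete, ite_zero_mul_ite_zero]
  simp only [Prod.ext_iff]
  congr 1
  · rw [eq_iff_iff]; tauto
  · norm_num

theorem ntr_pauli₂_mul (s t : PauliLabel) : ntr (pauli₂ s * pauli₂ t) = if s = t then 1 else 0 := by
  rw [ntr, pauli₂, pauli₂, ← Matrix.mul_kronecker_mul, Matrix.trace_kronecker, trace_pauli_mul,
    trace_pauli_mul, ite_zero_mul_ite_zero]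
  simp only [← Prod.ext_iff]
  split_ifs <;> norm_num

theorem exists_anticommuting_pauli₂ {s : PauliLabel} (hs : s ≠ 0) :
    ∃ t, pauli₂ t * pauli₂ s = -(pauli₂ s * pauli₂ t) := by
  by_cases h1 : s.1 = 0
  · have h2 : s.2 ≠ 0 := fun h2 => hs (Prod.ext h1 h2)
    obtain ⟨t, ht⟩ := exists_anticommuting_pauli h2
    refine ⟨(0, t), ?_⟩
    simp only [pauli₂, ← Matrix.mul_kronecker_mul, ht]
    ext i j
    simp [h1, Matrix.kroneckerMap_apply]
  · obtain ⟨t, ht⟩ := exists_anticommuting_pauli h1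
    refine ⟨(t, 0), ?_⟩
    simp only [pauli₂, ← Matrix.mul_kronecker_mul, ht]
    rw [show pauli 0 * pauli s.2 = pauli s.2 * pauli 0 by simp [pauli]]
    ext i j
    simp [Matrix.kroneckerMap_apply]

/-! ### Pauli coefficients on many registers, Parseval, and supports. -/

section Fourier
variable {n : ℕ}

/-- The `n`-register Pauli operator with label `σ`. -/
noncomputable def pauliString (σ : Fin n → PauliLabel) : Matrix (Reg n) (Reg n) ℂ :=
  prodMat fun k => pauli₂ (σ k)

/-- The Pauli coefficient of `M` at `σ`. -/
noncomputable def coef (M : Matrix (Reg n) (Reg n) ℂ) (σ : Fin n → PauliLabel) : ℂ :=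
  ntr (pauliString σ * M)

/-- The number of registers on which the Pauli operator with label `σ` acts. -/
def weight (σ : Fin n → PauliLabel) : ℕ := (Finset.univ.filter fun k => σ k ≠ 0).card

theorem pauliString_zero : pauliString (0 : Fin n → PauliLabel) = 1 := by
  simp only [pauliString, Pi.zero_apply, pauli₂_zero, prodMat_one]

theorem pauliString_isHermitian (σ : Fin n → PauliLabel) : (pauliString σ).IsHermitian := by
  rw [Matrix.IsHermitian, pauliString, prodMat_conjTranspose]
  simp only [(pauli₂_isHermitian _).eq]

theorem pauliString_complete (p q p' q' : Reg n) :
    ∑ σ, pauliString σ p q * pauliString σ p' q' = if p = q' ∧ q = p' then 4 ^ n else 0 := by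
  have h : ∑ σ : Fin n → PauliLabel, pauliString σ p q * pauliString σ p' q' =
      ∏ k, ∑ s, pauli₂ s (p k) (q k) * pauli₂ s (p' k) (q' k) := by
    rw [Finset.prod_univ_sum, Fintype.piFinset_univ]
    simp only [pauliString, prodMat, Matrix.of_apply, Finset.prod_mul_distrib]
  rw [h]
  simp only [pauli₂_complete]
  rw [Finset.prod_ite_zero]
  simp only [Finset.mem_univ, forall_true_left, Finset.prod_const, Finset.card_univ,
    Fintype.card_fin, forall_and, funext_iff]

theorem ntr_pauliString_mul (σ τ : Fin n → PauliLabel) :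
    ntr (pauliString σ * pauliString τ) = if σ = τ then 1 else 0 := by
  rw [pauliString, pauliString, prodMat_mul, ntr_prodMat]
  simp only [ntr_pauli₂_mul]
  rw [Finset.prod_ite_zero]
  simp [funext_iff]

theorem card_reg : (Fintype.card (Reg n) : ℂ) = 4 ^ n := by
  simp

theorem sum_coef_smul_pauliString (A : Matrix (Reg n) (Reg n) ℂ) :
    ∑ σ, coef A σ • pauliString σ = A := by
  ext p' q'
  have h4 : (4 : ℂ) ^ n ≠ 0 := by positivity
  have h : ∀ σ, coef A σ * pauliString σ p' q' =
      (1 / 4 ^ n) * ∑ p, ∑ q, A q p * (pauliString σ p q * pauliString σ p' q') := by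
    intro σ
    rw [coef, ntr, card_reg, Matrix.trace, div_eq_inv_mul, mul_assoc, one_div, Finset.sum_mul]
    congr 1
    refine Finset.sum_congr rfl fun p _ => ?_
    rw [Matrix.diag_apply, Matrix.mul_apply, Finset.sum_mul]
    refine Finset.sum_congr rfl fun q _ => ?_
    ring
  simp only [Matrix.sum_apply, Matrix.smul_apply, smul_eq_mul, h]
  rw [← Finset.mul_sum, Finset.sum_comm]
  have h2 : ∀ p : Reg n, ∑ σ : Fin n → PauliLabel, ∑ q,
      A q p * (pauliString σ p q * pauliString σ p' q') =
      if p = q' then 4 ^ n * A p' q' else 0 := by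
    intro p
    rw [Finset.sum_comm]
    simp only [← Finset.mul_sum, pauliString_complete, ite_and]
    split_ifs with hp
    · subst hp
      simp [mul_comm]
    · simp
  simp only [h2]
  rw [Finset.sum_ite_eq' Finset.univ q', if_pos (Finset.mem_univ _), ← mul_assoc, one_div,
    inv_mul_cancel₀ h4, one_mul]

/-- Parseval, in bilinear form. -/
theorem sum_coef_mul_coef (A B : Matrix (Reg n) (Reg n) ℂ) :
    ∑ σ, coef A σ * coef B σ = ntr (A * B) := by
  conv_rhs => rw [← sum_coef_smul_pauliString A, Finset.sum_mul, ntr_sum]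
  refine Finset.sum_congr rfl fun σ _ => ?_
  rw [Matrix.smul_mul, ntr_smul]
  rfl

theorem coef_zero (A : Matrix (Reg n) (Reg n) ℂ) : coef A 0 = ntr A := by
  rw [coef, pauliString_zero, Matrix.one_mul]

theorem coef_sub (A B : Matrix (Reg n) (Reg n) ℂ) (σ : Fin n → PauliLabel) :
    coef (A - B) σ = coef A σ - coef B σ := by
  rw [coef, Matrix.mul_sub, ntr_sub]; rfl

theorem coef_star_of_isHermitian {A : Matrix (Reg n) (Reg n) ℂ} (hA : A.IsHermitian)
    (σ : Fin n → PauliLabel) : star (coef A σ) = coef A σ := by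
  rw [coef, ← ntr_conjTranspose, Matrix.conjTranspose_mul, hA.eq, (pauliString_isHermitian σ).eq,
    ntr_mul_comm]

theorem coef_eq_re {A : Matrix (Reg n) (Reg n) ℂ} (hA : A.IsHermitian)
    (σ : Fin n → PauliLabel) : coef A σ = ((coef A σ).re : ℂ) :=
  (Complex.conj_eq_iff_re.1 (coef_star_of_isHermitian hA σ)).symm

theorem normF_sq_eq_sum_coef {A : Matrix (Reg n) (Reg n) ℂ} (hA : A.IsHermitian) :
    normF A ^ 2 = ∑ σ, (coef A σ).re ^ 2 := by
  rw [normF_sq, hA.eq, ← sum_coef_mul_coef, Complex.re_sum]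
  refine Finset.sum_congr rfl fun σ _ => ?_
  rw [coef_eq_re hA σ, ← Complex.ofReal_mul, Complex.ofReal_re, Complex.ofReal_re, sq]

/-- `A` acts as the identity outside the registers in `S`. -/
def SupportedOn (S : Finset (Fin n)) (A : Matrix (Reg n) (Reg n) ℂ) : Prop :=
  ∀ k ∉ S, ∀ N, Commute (onRegister k N) A

theorem SupportedOn.mul {S : Finset (Fin n)} {A B : Matrix (Reg n) (Reg n) ℂ}
    (hA : SupportedOn S A) (hB : SupportedOn S B) : SupportedOn S (A * B) :=
  fun k hk N => (hA k hk N).mul_right (hB k hk N)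

theorem supportedOn_onRegister {S : Finset (Fin n)} {k : Fin n} (hk : k ∈ S)
    (M : Matrix TwoQubit TwoQubit ℂ) : SupportedOn S (onRegister k M) :=
  fun _ hm _ => onRegister_commute (fun h => hm (by rwa [h])) _ _

theorem supportedOn_sum {S : Finset (Fin n)} {ι : Type*} {s : Finset ι}
    {f : ι → Matrix (Reg n) (Reg n) ℂ} (h : ∀ i ∈ s, SupportedOn S (f i)) :
    SupportedOn S (∑ i ∈ s, f i) :=
  fun k hk N => Commute.sum_right _ _ _ fun i hi => h i hi k hk N

/-- A Pauli operator on register `k` anticommuting with the letter `σ k` fixes `A` under conjugation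
but flips the sign of the string, so the coefficient equals its own negative. -/
theorem SupportedOn.coef_eq_zero {S : Finset (Fin n)} {A : Matrix (Reg n) (Reg n) ℂ}
    (hA : SupportedOn S A) {σ : Fin n → PauliLabel} {k : Fin n} (hk : k ∉ S) (hσ : σ k ≠ 0) :
    coef A σ = 0 := by
  obtain ⟨t, ht⟩ := exists_anticommuting_pauli₂ hσ
  set V := onRegister k (pauli₂ t) with hV
  have hVV : V * V = 1 := by rw [hV, ← onRegister_mul, pauli₂_mul_self, onRegister_one]
  have hc : V * A = A * V := hA k hk _
  have ha : V * pauliString σ = -(pauliString σ * V) := by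
    rw [hV, onRegister_eq_prodMat, pauliString, prodMat_mul, prodMat_mul]
    ext p q
    simp only [prodMat, Matrix.of_apply, Matrix.neg_apply]
    rw [← Finset.mul_prod_erase _ _ (Finset.mem_univ k),
      ← Finset.mul_prod_erase (Finset.univ) _ (Finset.mem_univ k)]
    simp only [Function.update_self, ht, Matrix.neg_apply]
    rw [neg_mul]
    congr 2
    refine Finset.prod_congr rfl fun m hm => ?_
    rw [Function.update_of_ne (Finset.ne_of_mem_erase hm), Matrix.one_mul, Matrix.mul_one]
  have h : coef A σ = -coef A σ := by
    calc coef A σ = ntr (pauliString σ * (A * V) * V) := by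
          rw [coef, Matrix.mul_assoc, Matrix.mul_assoc, hVV, Matrix.mul_one]
      _ = ntr (V * pauliString σ * V * A) := by
          rw [← hc, ntr_mul_comm]; simp only [Matrix.mul_assoc]
      _ = -coef A σ := by
          rw [ha, Matrix.neg_mul, Matrix.neg_mul, ntr_neg, Matrix.mul_assoc (pauliString σ), hVV,
            Matrix.mul_one]; rfl
  exact self_eq_neg.1 h

/-- Independence of disjoint registers: in Parseval, a nonidentity string has a nontrivial letter
outside `S` or outside `T`, which kills one of the two coefficients. -/
theorem ntr_mul_of_disjoint {S T : Finset (Fin n)} {A B : Matrix (Reg n) (Reg n) ℂ}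
    (hA : SupportedOn S A) (hB : SupportedOn T B) (h : Disjoint S T) :
    ntr (A * B) = ntr A * ntr B := by
  rw [← sum_coef_mul_coef, Finset.sum_eq_single 0, coef_zero, coef_zero]
  · intro σ _ hσ
    obtain ⟨k, hk⟩ : ∃ k, σ k ≠ 0 := by
      by_contra! h0
      exact hσ (funext h0)
    by_cases hkS : k ∈ S
    · rw [hB.coef_eq_zero (Finset.disjoint_left.1 h hkS) hk, mul_zero]
    · rw [hA.coef_eq_zero hkS hk, zero_mul]
  · simp

end Fourier

/-! ### Correlations in the noisy state -/

theorem epr_apply (p q : Fin 2 × Fin 2) :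
    epr p q = if p.1 = p.2 ∧ q.1 = q.2 then 1 / 2 else 0 := by
  have h : ((Real.sqrt 2 : ℝ) : ℂ) * ((Real.sqrt 2 : ℝ) : ℂ) = 2 := by
    rw [← Complex.ofReal_mul, Real.mul_self_sqrt (by norm_num)]; norm_num
  simp only [epr, Matrix.vecMulVec_apply, Pi.star_apply]
  by_cases h1 : p.1 = p.2 <;> by_cases h2 : q.1 = q.2 <;> simp [h1, h2]
  rw [← mul_inv, h]

theorem epr2_apply (p1 p2 q1 q2 : TwoQubit) :
    epr2 (p1, p2) (q1, q2) = if p1 = p2 ∧ q1 = q2 then 1 / 4 else 0 := by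
  simp only [epr2, Matrix.of_apply, epr_apply, ite_zero_mul_ite_zero, Prod.ext_iff]
  congr 1
  · rw [eq_iff_iff]; tauto
  · norm_num

theorem trace_epr2 : epr2.trace = 1 := by
  simp [Matrix.trace, Fintype.sum_prod_type, epr2_apply]

/-- Two EPR pairs are `1 / 16` times the sum of `P ⊗ Pᵀ` over two-qubit Paulis, and depolarizing
multiplies every nonidentity term by `ρ`. The transpose is the exchange of `q2` and `p2`. -/
theorem depolarize_epr2_apply (ρ : ℝ) (p1 p2 q1 q2 : TwoQubit) :
    depolarize ρ epr2 (p1, p2) (q1, q2) =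
      (1 / 16) * ∑ s, (if s ≠ 0 then (ρ : ℂ) else 1) * (pauli₂ s p1 q1 * pauli₂ s q2 p2) := by
  -- All labels get the factor `ρ`, and the identity label is topped up by `1 - ρ`; completeness
  -- then evaluates the main sum.
  have h : ∀ s : PauliLabel, (if s ≠ 0 then (ρ : ℂ) else 1) * (pauli₂ s p1 q1 * pauli₂ s q2 p2) =
      ρ * (pauli₂ s p1 q1 * pauli₂ s q2 p2) +
        if s = 0 then (1 - ρ) * (pauli₂ 0 p1 q1 * pauli₂ 0 q2 p2) else 0 := by
    intro s
    by_cases hs : s = 0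
    · subst hs; simp; ring
    · simp [hs]
  simp only [h]
  rw [Finset.sum_add_distrib, ← Finset.mul_sum, pauli₂_complete, Finset.sum_ite_eq' Finset.univ,
    if_pos (Finset.mem_univ _), pauli₂_zero, depolarize, trace_epr2, Matrix.add_apply,
    Matrix.smul_apply, Matrix.smul_apply, epr2_apply, Matrix.one_apply, Matrix.one_apply,
    Matrix.one_apply]
  have hc : (Fintype.card (TwoQubit × TwoQubit) : ℂ) = 16 := by simp
  rw [hc, ite_zero_mul_ite_zero]
  have e : ((p1, p2) = (q1, q2)) ↔ (p1 = q1 ∧ q2 = p2) := by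
    rw [Prod.mk.injEq, eq_comm (a := p2)]
  simp only [e, smul_eq_mul]
  split_ifs <;> ring

section Correlation
variable {n : ℕ}

/-- Expanding the tensor power gives one factor `ρ` for each nonidentity letter. -/
theorem noisyState_eq (n : ℕ) (ρ : ℝ) :
    noisyState n ρ = (1 / 16 ^ n : ℂ) •
      ∑ σ : Fin n → PauliLabel, (ρ : ℂ) ^ weight σ • (pauliString σ ⊗ₖ (pauliString σ)ᵀ) := by
  ext ⟨p1, p2⟩ ⟨q1, q2⟩
  simp only [noisyState, copies, Matrix.of_apply, depolarize_epr2_apply, Finset.prod_mul_distrib,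
    Finset.prod_const, Finset.card_univ, Fintype.card_fin, Matrix.smul_apply, Matrix.sum_apply,
    smul_eq_mul, one_div, inv_pow]
  congr 1
  rw [Finset.prod_univ_sum, Fintype.piFinset_univ]
  refine Finset.sum_congr rfl fun σ _ => ?_
  simp only [Finset.prod_mul_distrib, Matrix.kroneckerMap_apply, Matrix.transpose_apply,
    pauliString, prodMat, Matrix.of_apply]
  congr 1
  rw [Finset.prod_ite, Finset.prod_const, Finset.prod_const_one, mul_one]
  rfl

theorem trace_kronecker_mul_noisyState (A B : Matrix (Reg n) (Reg n) ℂ) (ρ : ℝ) :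
    ((A ⊗ₖ B) * noisyState n ρ).trace =
      ∑ σ, (ρ : ℂ) ^ weight σ * (coef A σ * coef Bᵀ σ) := by
  rw [noisyState_eq, Matrix.mul_smul, Matrix.trace_smul, Finset.mul_sum, Matrix.trace_sum,
    Finset.smul_sum]
  refine Finset.sum_congr rfl fun σ _ => ?_
  have hB : (B * (pauliString σ)ᵀ).trace = (pauliString σ * Bᵀ).trace := by
    rw [← Matrix.trace_transpose, Matrix.transpose_mul, Matrix.transpose_transpose]
  rw [Matrix.mul_smul, Matrix.trace_smul, ← Matrix.mul_kronecker_mul, Matrix.trace_kronecker, hB,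
    Matrix.trace_mul_comm A, coef, coef, ntr, ntr, card_reg, div_mul_div_comm, ← mul_pow]
  norm_num
  ring

/-- The correlation of two Hermitian operators under the noise operator. -/
noncomputable def noiseCorr (ρ : ℝ) (A B : Matrix (Reg n) (Reg n) ℂ) : ℝ :=
  ∑ σ, ρ ^ weight σ * ((coef A σ).re * (coef B σ).re)

theorem trace_kronecker_mul_noisyState_re {A B : Matrix (Reg n) (Reg n) ℂ} (hA : A.IsHermitian)
    (hB : B.IsHermitian) (ρ : ℝ) :
    ((A ⊗ₖ B) * noisyState n ρ).trace.re = noiseCorr ρ A Bᵀ := by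
  rw [trace_kronecker_mul_noisyState, Complex.re_sum, noiseCorr]
  refine Finset.sum_congr rfl fun σ _ => ?_
  rw [coef_eq_re hA, coef_eq_re hB.transpose, ← Complex.ofReal_mul, ← Complex.ofReal_pow,
    ← Complex.ofReal_mul]
  simp only [Complex.ofReal_re]

theorem weight_zero : weight (0 : Fin n → PauliLabel) = 0 := by simp [weight]

theorem weight_eq_zero {σ : Fin n → PauliLabel} : weight σ = 0 ↔ σ = 0 := by
  simp [weight, funext_iff, Finset.filter_eq_empty_iff]

theorem coef_one (σ : Fin n → PauliLabel) :
    coef (1 : Matrix (Reg n) (Reg n) ℂ) σ = if σ = 0 then 1 else 0 := by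
  rw [coef, ← pauliString_zero, ntr_pauliString_mul]

theorem noiseCorr_one_right (ρ : ℝ) (A : Matrix (Reg n) (Reg n) ℂ) :
    noiseCorr ρ A 1 = (ntr A).re := by
  rw [noiseCorr, Finset.sum_eq_single 0]
  · simp [coef_zero, weight_zero, ntr_one]
  · intro σ _ hσ; simp [coef_one, hσ]
  · simp

theorem noiseCorr_one_left (ρ : ℝ) (B : Matrix (Reg n) (Reg n) ℂ) :
    noiseCorr ρ 1 B = (ntr B).re := by
  rw [noiseCorr, Finset.sum_eq_single 0]
  · simp [coef_zero, weight_zero, ntr_one]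
  · intro σ _ hσ; simp [coef_one, hσ]
  · simp

/-! ### The part of weight one -/

/-- The operator on register `k` that carries the Pauli coefficients of `A` supported on `k`. -/
noncomputable def linPart (A : Matrix (Reg n) (Reg n) ℂ) (k : Fin n) :
    Matrix TwoQubit TwoQubit ℂ :=
  ∑ s ∈ Finset.univ.erase 0, coef A (Function.update 0 k s) • pauli₂ s

theorem linPart_isHermitian {A : Matrix (Reg n) (Reg n) ℂ} (hA : A.IsHermitian) (k : Fin n) :
    (linPart A k).IsHermitian := by
  rw [Matrix.IsHermitian, linPart, Matrix.conjTranspose_sum]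
  refine Finset.sum_congr rfl fun s _ => ?_
  rw [Matrix.conjTranspose_smul, coef_star_of_isHermitian hA, (pauli₂_isHermitian s).eq]

theorem ntr_linPart (A : Matrix (Reg n) (Reg n) ℂ) (k : Fin n) : ntr (linPart A k) = 0 := by
  rw [linPart, ntr_sum]
  refine Finset.sum_eq_zero fun s hs => ?_
  have := ntr_pauli₂_mul s 0
  rw [pauli₂_zero, Matrix.mul_one, if_neg (Finset.ne_of_mem_erase hs)] at this
  rw [ntr_smul, this, mul_zero]

theorem onRegister_pauli₂ (k : Fin n) (s : PauliLabel) :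
    onRegister k (pauli₂ s) = pauliString (Function.update 0 k s) := by
  rw [onRegister_eq_prodMat, pauliString]
  congr 1
  ext1 m
  by_cases h : m = k
  · subst h; simp
  · simp [Function.update_of_ne h, pauli₂_zero]

/-- A string of weight one is determined by its active register and the nonidentity letter there. -/
theorem sum_weight_one {M : Type*} [AddCommMonoid M] (g : (Fin n → PauliLabel) → M) :
    ∑ k, ∑ s ∈ Finset.univ.erase (0 : PauliLabel), g (Function.update 0 k s) =
      ∑ σ with weight σ = 1, g σ := by
  rw [← Finset.sum_product']
  refine Finset.sum_bij (fun q _ => Function.update 0 q.1 q.2) ?_ ?_ ?_ (fun _ _ => rfl)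
  · rintro ⟨k, s⟩ h
    have hs : s ≠ 0 := by simpa using h
    rw [Finset.mem_filter]
    refine ⟨Finset.mem_univ _, ?_⟩
    rw [weight, Finset.card_eq_one]
    refine ⟨k, ?_⟩
    ext m
    by_cases hm : m = k
    · subst hm; simpa using hs
    · simp [hm]
  · rintro ⟨k, s⟩ h ⟨m, t⟩ h' e
    have hs : s ≠ 0 := by simpa using h
    have hkm : k = m := by
      by_contra hne
      have := congrFun e k
      simp only [Function.update_self, Function.update_of_ne hne, Pi.zero_apply] at this
      exact hs this
    subst hkm
    have := congrFun e k
    simp only [Function.update_self] at this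
    rw [this]
  · intro σ hσ
    rw [Finset.mem_filter, weight, Finset.card_eq_one] at hσ
    obtain ⟨k, hk⟩ := hσ.2
    have hk' : ∀ m, σ m ≠ 0 ↔ m = k := fun m => by
      have := Finset.ext_iff.1 hk m
      simpa using this
    refine ⟨(k, σ k), by simpa using (hk' k).2 rfl, ?_⟩
    ext1 m
    by_cases hm : m = k
    · subst hm; simp
    · rw [Function.update_of_ne hm]
      have := mt (hk' m).1 hm
      push Not at this
      exact this.symm

/-- The sum of the `linPart`s is the orthogonal projection of `A` to the strings of weight one. -/
theorem coef_sum_linPart (A : Matrix (Reg n) (Reg n) ℂ) (τ : Fin n → PauliLabel) :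
    coef (∑ k, onRegister k (linPart A k)) τ = if weight τ = 1 then coef A τ else 0 := by
  have h : ∑ k, onRegister k (linPart A k) = ∑ σ with weight σ = 1, coef A σ • pauliString σ := by
    rw [← sum_weight_one (fun σ => coef A σ • pauliString σ)]
    refine Finset.sum_congr rfl fun k _ => ?_
    rw [linPart, onRegister_sum]
    refine Finset.sum_congr rfl fun s _ => ?_
    rw [onRegister_smul, onRegister_pauli₂]
  rw [h, coef, Finset.mul_sum, ntr_sum]
  simp only [Matrix.mul_smul, ntr_smul, ntr_pauliString_mul, mul_ite, mul_one, mul_zero]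
  rw [Finset.sum_ite_eq]
  simp

theorem normF_sub_sum_linPart_sq {A : Matrix (Reg n) (Reg n) ℂ} (hA : A.IsHermitian) :
    normF (A - ∑ k, onRegister k (linPart A k)) ^ 2 =
      ∑ σ with weight σ ≠ 1, (coef A σ).re ^ 2 := by
  have hL : (∑ k, onRegister k (linPart A k)).IsHermitian := by
    rw [Matrix.IsHermitian, Matrix.conjTranspose_sum]
    refine Finset.sum_congr rfl fun k _ => ?_
    rw [← onRegister_conjTranspose, (linPart_isHermitian hA k).eq]
  rw [normF_sq_eq_sum_coef (hA.sub hL), Finset.sum_filter]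
  refine Finset.sum_congr rfl fun σ _ => ?_
  rw [coef_sub, coef_sum_linPart]
  by_cases h : weight σ = 1 <;> simp [h]

end Correlation

/-! ### Operators close to a sum of single-register operators -/

section FKN
variable {n : ℕ}

/-- Submultiplicativity of the Frobenius norm; the factor is the square root of the dimension four.
This is the one-register case of the fourth-moment bound. -/
theorem normF_mul_self_le (l : Matrix TwoQubit TwoQubit ℂ) : normF (l * l) ≤ 2 * normF l ^ 2 := by
  open scoped Matrix.Norms.Frobenius in
  have h := Matrix.frobenius_norm_mul l l
  have h4 : Real.sqrt (Fintype.card TwoQubit) = 2 := by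
    rw [show (Fintype.card TwoQubit : ℝ) = 2 ^ 2 by simp; norm_num]
    exact Real.sqrt_sq (by norm_num)
  rw [normF_eq, normF_eq, h4]
  nlinarith

theorem isHermitian_mul_self {H : Type} [Fintype H] {A : Matrix H H ℂ} (hA : A.IsHermitian) :
    (A * A).IsHermitian := by
  rw [Matrix.IsHermitian, Matrix.conjTranspose_mul, hA.eq]

theorem ntr_mul_self_eq {H : Type} [Fintype H] [DecidableEq H] {A : Matrix H H ℂ}
    (hA : A.IsHermitian) : ntr (A * A) = ((normF A ^ 2 : ℝ) : ℂ) := by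
  rw [normF_sq, hA.eq]
  refine (Complex.conj_eq_iff_re.1 ?_).symm
  have := ntr_conjTranspose (A * A)
  rw [(isHermitian_mul_self hA).eq] at this
  exact this.symm

theorem isHermitian_onRegister {M : Matrix TwoQubit TwoQubit ℂ} (hM : M.IsHermitian) (k : Fin n) :
    (onRegister k M).IsHermitian := by
  rw [Matrix.IsHermitian, ← onRegister_conjTranspose, hM.eq]

/-- The sum over the registers in `S` of the single-register operators `l k`. -/
noncomputable def regSum (l : Fin n → Matrix TwoQubit TwoQubit ℂ) (S : Finset (Fin n)) :
    Matrix (Reg n) (Reg n) ℂ := ∑ k ∈ S, onRegister k (l k)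

variable {l : Fin n → Matrix TwoQubit TwoQubit ℂ}

theorem regSum_isHermitian (hl : ∀ k, (l k).IsHermitian) (S : Finset (Fin n)) :
    (regSum l S).IsHermitian := by
  rw [Matrix.IsHermitian, regSum, Matrix.conjTranspose_sum]
  exact Finset.sum_congr rfl fun k _ => (isHermitian_onRegister (hl k) k).eq

theorem supportedOn_regSum (S : Finset (Fin n)) : SupportedOn S (regSum l S) :=
  supportedOn_sum fun _ hk => supportedOn_onRegister hk _

theorem ntr_regSum (h0 : ∀ k, ntr (l k) = 0) (S : Finset (Fin n)) : ntr (regSum l S) = 0 := by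
  rw [regSum, ntr_sum]
  exact Finset.sum_eq_zero fun k _ => by rw [ntr_onRegister, h0]

theorem commute_regSum {S T : Finset (Fin n)} (h : Disjoint S T) :
    Commute (regSum l S) (regSum l T) :=
  Commute.sum_left _ _ _ fun _ hk =>
    supportedOn_regSum T _ (Finset.disjoint_left.1 h hk) _

theorem normF_regSum_sq (hl : ∀ k, (l k).IsHermitian) (h0 : ∀ k, ntr (l k) = 0)
    (S : Finset (Fin n)) : normF (regSum l S) ^ 2 = ∑ k ∈ S, normF (l k) ^ 2 := by
  induction S using Finset.induction_on with
  | empty => simp [regSum, normF_zero]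
  | insert k S hk ih =>
    have e : regSum l (insert k S) = onRegister k (l k) + regSum l S := by
      rw [regSum, Finset.sum_insert hk, regSum]
    have hd : Disjoint {k} S := Finset.disjoint_singleton_left.2 hk
    have h1 : ntr (onRegister k (l k) * regSum l S) = 0 := by
      rw [ntr_mul_of_disjoint (supportedOn_onRegister (Finset.mem_singleton_self k) _)
        (supportedOn_regSum S) hd, ntr_onRegister, h0, zero_mul]
    have h2 : ntr (regSum l S * onRegister k (l k)) = 0 := by rw [ntr_mul_comm, h1]
    rw [Finset.sum_insert hk, ← ih, ← normF_onRegister k (l k), normF_sq, normF_sq, normF_sq, e,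
      ((isHermitian_onRegister (hl k) k).add (regSum_isHermitian hl S)).eq,
      (isHermitian_onRegister (hl k) k).eq, (regSum_isHermitian hl S).eq, Matrix.add_mul,
      Matrix.mul_add, Matrix.mul_add, ntr_add, ntr_add, ntr_add, h1, h2]
    simp

/-- Fourth moments of sums of independent traceless operators. -/
theorem normF_regSum_mul_self_le (hl : ∀ k, (l k).IsHermitian) (h0 : ∀ k, ntr (l k) = 0)
    (S : Finset (Fin n)) : normF (regSum l S * regSum l S) ≤ 2 * normF (regSum l S) ^ 2 := by
  refine abs_le_of_sq_le_sq' ?_ (by positivity) |>.2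
  induction S using Finset.induction_on with
  | empty => simp [regSum, normF_zero]
  | insert k S hk ih =>
    have e : regSum l (insert k S) = onRegister k (l k) + regSum l S := by
      rw [regSum, Finset.sum_insert hk, regSum]
    have hd : Disjoint {k} S := Finset.disjoint_singleton_left.2 hk
    set A := regSum l S with hA
    set B := onRegister k (l k) with hB
    have hAH : A.IsHermitian := regSum_isHermitian hl S
    have hBH : B.IsHermitian := isHermitian_onRegister (hl k) k
    have sB : SupportedOn {k} B := supportedOn_onRegister (Finset.mem_singleton_self k) _
    have sA : SupportedOn S A := supportedOn_regSum S
    have hc : B * A = A * B := sA k hk _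
    have hB0 : ntr B = 0 := by rw [hB, ntr_onRegister, h0]
    have hA0 : ntr A = 0 := ntr_regSum h0 S
    have hnorm : normF (B + A) ^ 2 = normF B ^ 2 + normF A ^ 2 := by
      rw [← e, normF_regSum_sq hl h0, Finset.sum_insert hk, hA, normF_regSum_sq hl h0, hB,
        normF_onRegister]
    have hB4 : normF (B * B) ≤ 2 * normF B ^ 2 := by
      rw [hB, ← onRegister_mul, normF_onRegister, normF_onRegister]
      exact normF_mul_self_le _
    have t1 : ntr (B * (A * A * A)) = 0 := by
      rw [ntr_mul_of_disjoint sB ((sA.mul sA).mul sA) hd, hB0, zero_mul]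
    have t3 : ntr (B * B * B * A) = 0 := by
      rw [ntr_mul_of_disjoint ((sB.mul sB).mul sB) sA hd, hA0, mul_zero]
    have t2 : ntr (B * B * (A * A)) = ntr (B * B) * ntr (A * A) :=
      ntr_mul_of_disjoint (sB.mul sB) (sA.mul sA) hd
    -- Binomial expansion, valid because `A` and `B` commute. The terms with a single `A` or a
    -- single `B` have trace zero by independence and tracelessness.
    have x : (B + A) * (B + A) * ((B + A) * (B + A)) = B * B * (B * B) + 4 • (B * B * B * A) +
        6 • (B * B * (A * A)) + 4 • (B * (A * A * A)) + A * A * (A * A) := by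
      have hc' : ∀ X, A * (B * X) = B * (A * X) := fun X => by
        rw [← Matrix.mul_assoc, ← hc, Matrix.mul_assoc]
      simp only [Matrix.add_mul, Matrix.mul_add, Matrix.mul_assoc, ← hc, hc']
      abel
    have hBre : ntr (B * B) = ((normF B ^ 2 : ℝ) : ℂ) := ntr_mul_self_eq hBH
    have hAre : ntr (A * A) = ((normF A ^ 2 : ℝ) : ℂ) := ntr_mul_self_eq hAH
    rw [e]
    have l4 : normF ((B + A) * (B + A)) ^ 2 =
        normF (B * B) ^ 2 + 6 * (normF B ^ 2 * normF A ^ 2) + normF (A * A) ^ 2 := by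
      rw [normF_sq, (isHermitian_mul_self (hBH.add hAH)).eq, x, normF_sq (B * B),
        (isHermitian_mul_self hBH).eq, normF_sq (A * A), (isHermitian_mul_self hAH).eq]
      simp only [ntr_add, ← Nat.cast_smul_eq_nsmul ℂ, ntr_smul, t1, t2, t3, hBre, hAre, mul_zero,
        add_zero, Complex.add_re, ← Complex.ofReal_mul]
      rw [show ((6 : ℕ) : ℂ) = ((6 : ℝ) : ℂ) by norm_num, ← Complex.ofReal_mul, Complex.ofReal_re]
    rw [l4, hnorm]
    have hb : normF (B * B) ^ 2 ≤ (2 * normF B ^ 2) ^ 2 := by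
      have := normF_nonneg (B * B)
      gcongr
    -- The induction closes because the mixed coefficient 6 is at most the 8 in `4 * (x + y) ^ 2`.
    nlinarith [mul_nonneg (sq_nonneg (normF B)) (sq_nonneg (normF A))]

/-- If `P` is close to a sum of independent traceless operators and `P * P` is close to the
identity, then in every bipartition of the registers one side carries little weight. -/
theorem normF_regSum_mul_normF_regSum_compl_le (hl : ∀ k, (l k).IsHermitian)
    (h0 : ∀ k, ntr (l k) = 0) {P : Matrix (Reg n) (Reg n) ℂ} (hP : P.IsHermitian)
    (hP1 : (1 - P * P).PosSemidef) {η : ℝ} (hη0 : 0 ≤ η) (hη : η ≤ 1 / 10)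
    (hP2 : normF (1 - P * P) ≤ η) (hL : normF (P - regSum l Finset.univ) ≤ η)
    (S : Finset (Fin n)) : normF (regSum l S) * normF (regSum l Sᶜ) ≤ 4 * η := by
  set L := regSum l Finset.univ with hLdef
  have hd : Disjoint S Sᶜ := disjoint_compl_right
  have e : L = regSum l S + regSum l Sᶜ := by
    rw [hLdef, regSum, regSum, regSum, Finset.sum_add_sum_compl]
  have hnormL : normF L ^ 2 = normF (regSum l S) ^ 2 + normF (regSum l Sᶜ) ^ 2 := by
    rw [hLdef, normF_regSum_sq hl h0, normF_regSum_sq hl h0, normF_regSum_sq hl h0,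
      Finset.sum_add_sum_compl]
  have hA4 := normF_regSum_mul_self_le hl h0 S
  have hB4 := normF_regSum_mul_self_le hl h0 Sᶜ
  have hAH : (regSum l S).IsHermitian := regSum_isHermitian hl S
  have hBH : (regSum l Sᶜ).IsHermitian := regSum_isHermitian hl Sᶜ
  have hA0 : ntr (regSum l S) = 0 := ntr_regSum h0 S
  have hB0 : ntr (regSum l Sᶜ) = 0 := ntr_regSum h0 Sᶜ
  have sA : SupportedOn S (regSum l S) := supportedOn_regSum S
  have sB : SupportedOn Sᶜ (regSum l Sᶜ) := supportedOn_regSum Sᶜ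
  have hc : regSum l S * regSum l Sᶜ = regSum l Sᶜ * regSum l S := commute_regSum hd
  generalize regSum l S = A at *
  generalize regSum l Sᶜ = B at *
  have hc' : ∀ X, B * (A * X) = A * (B * X) := fun X => by
    rw [← Matrix.mul_assoc, ← hc, Matrix.mul_assoc]
  have hmom : ∀ X Y : Matrix (Reg n) (Reg n) ℂ, SupportedOn S X → SupportedOn Sᶜ Y →
      X.IsHermitian → Y.IsHermitian → normF (X * Y) ^ 2 = normF X ^ 2 * normF Y ^ 2 := by
    intro X Y hX hY hXH hYH
    have hcyc : ntr (Y * X * (X * Y)) = ntr (X * X * (Y * Y)) := by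
      rw [Matrix.mul_assoc, ntr_mul_comm]
      simp only [Matrix.mul_assoc]
    rw [normF_sq, Matrix.conjTranspose_mul, hXH.eq, hYH.eq, hcyc, ntr_mul_of_disjoint (hX.mul hX) (hY.mul hY) hd, ntr_mul_self_eq hXH, ntr_mul_self_eq hYH,
      ← Complex.ofReal_mul, Complex.ofReal_re]
  have nA := normF_nonneg A
  have nB := normF_nonneg B
  have nL := normF_nonneg L
  have nAB : normF (A * B) = normF A * normF B := by
    rw [← sq_eq_sq₀ (normF_nonneg _) (by positivity), hmom A B sA sB hAH hBH]
    ring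
  have nAAB : normF (A * A * B) = normF (A * A) * normF B := by
    rw [← sq_eq_sq₀ (normF_nonneg _) (mul_nonneg (normF_nonneg _) nB),
      hmom _ B (sA.mul sA) sB (isHermitian_mul_self hAH) hBH]
    ring
  have nABB : normF (A * (B * B)) = normF A * normF (B * B) := by
    rw [← sq_eq_sq₀ (normF_nonneg _) (mul_nonneg nA (normF_nonneg _)),
      hmom A _ sA (sB.mul sB) hAH (isHermitian_mul_self hBH)]
    ring
  have nL11 : normF L ≤ 11 / 10 := by
    have h1 := normF_triangle L P 0
    rw [sub_zero, sub_zero, normF_sub_comm] at h1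
    have h2 := normF_le_one_of_contraction hP hP1
    linarith
  -- Testing `L * L` against `A * B` isolates the cross term `2 • (A * B)`; the two squares
  -- contribute nothing, as `A` and `B` are traceless and independent.
  have main : ntr (A * B * (L * L)) = ((2 * (normF A ^ 2 * normF B ^ 2) : ℝ) : ℂ) := by
    have x : A * B * (L * L) = A * A * A * B + 2 • (A * A * (B * B)) + A * (B * B * B) := by
      rw [e]
      simp only [Matrix.add_mul, Matrix.mul_add, Matrix.mul_assoc, ← hc, hc']
      abel
    rw [x, ntr_add, ntr_add, ntr_mul_of_disjoint ((sA.mul sA).mul sA) sB hd, hB0, mul_zero,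
      ntr_mul_of_disjoint sA ((sB.mul sB).mul sB) hd, hA0, zero_mul,
      ← Nat.cast_smul_eq_nsmul ℂ, ntr_smul, ntr_mul_of_disjoint (sA.mul sA) (sB.mul sB) hd,
      ntr_mul_self_eq hAH, ntr_mul_self_eq hBH]
    push_cast
    ring
  -- Now `L * L` is compared with the identity through `P * P`; the identity contributes `ntr (A *
  -- B) = 0`, so only error terms survive.
  have split : ntr (A * B * (L * L)) = -ntr (A * B * (1 - P * P)) -
      ntr (A * B * L * (P - L)) - ntr (P * (A * B) * (P - L)) := by
    have h1 : ntr (A * B) = 0 := by rw [ntr_mul_of_disjoint sA sB hd, hA0, zero_mul]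
    have h2 : ntr (P * (A * B) * (P - L)) = ntr (A * B * ((P - L) * P)) := by
      rw [Matrix.mul_assoc, ntr_mul_comm, Matrix.mul_assoc]
    have h3 : A * B * (L * L) = A * B - A * B * (1 - P * P) - A * B * L * (P - L) -
        A * B * ((P - L) * P) := by
      noncomm_ring
    rw [h3, ntr_sub, ntr_sub, ntr_sub, h1, h2]
    ring
  -- In the middle term `A * B * L` is controlled by the fourth moments; in the last, the
  -- contraction `P` is absorbed.
  have bound : 2 * (normF A ^ 2 * normF B ^ 2) ≤
      normF A * normF B * η + (2 * normF A ^ 2 * normF B + 2 * normF A * normF B ^ 2) * η +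
        normF A * normF B * η := by
    have h1 : ‖ntr (A * B * (1 - P * P))‖ ≤ normF A * normF B * η := by
      refine (norm_ntr_mul_le _ _).trans ?_
      rw [nAB]
      gcongr
    have h2 : ‖ntr (A * B * L * (P - L))‖ ≤
        (2 * normF A ^ 2 * normF B + 2 * normF A * normF B ^ 2) * η := by
      refine (norm_ntr_mul_le _ _).trans ?_
      refine mul_le_mul ?_ hL (normF_nonneg _)
        (add_nonneg (mul_nonneg (by linarith [sq_nonneg (normF A)]) nB)
          (mul_nonneg (by linarith) (sq_nonneg _)))
      have : A * B * L = A * A * B + A * (B * B) := by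
        rw [e, Matrix.mul_add]
        simp only [Matrix.mul_assoc, ← hc]
      rw [this]
      refine (normF_add_le _ _).trans ?_
      rw [nAAB, nABB]
      have := mul_le_mul_of_nonneg_right hA4 nB
      have := mul_le_mul_of_nonneg_left hB4 nA
      linarith
    have h3 : ‖ntr (P * (A * B) * (P - L))‖ ≤ normF A * normF B * η := by
      refine (norm_ntr_mul_le _ _).trans ?_
      refine mul_le_mul ?_ hL (normF_nonneg _) (mul_nonneg nA nB)
      rw [← nAB]
      exact normF_contraction_mul_le hP hP1 _
    have h4 : 2 * (normF A ^ 2 * normF B ^ 2) = ‖ntr (A * B * (L * L))‖ := by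
      rw [main, Complex.norm_real, Real.norm_of_nonneg (by positivity)]
    have h5 : ∀ x y z : ℂ, ‖-x - y - z‖ ≤ ‖x‖ + ‖y‖ + ‖z‖ := fun x y z => by
      have h6 := norm_sub_le (-x - y) z
      have h7 := norm_sub_le (-x) y
      rw [norm_neg] at h7
      linarith
    rw [h4, split]
    linarith [h5 (ntr (A * B * (1 - P * P))) (ntr (A * B * L * (P - L)))
      (ntr (P * (A * B) * (P - L)))]
  clear_value L
  clear main split hmom hc' e nAB nAAB nABB hA4 hB4 hP2 hL
  generalize normF A = α at *
  generalize normF B = β at *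
  generalize normF L = κ at *
  have hA11 : α ≤ 11 / 10 := by nlinarith
  have hB11 : β ≤ 11 / 10 := by nlinarith
  -- Dividing by `α * β > 0` leaves `2αβ ≤ η(2 + 2(α + β))`, and `α, β ≤ 11 / 10` gives `αβ ≤ 3.2η`.
  rcases (mul_nonneg nA nB).eq_or_lt with h | h
  · rw [← h]; positivity
  · have : α * β * (2 * (α * β)) ≤ α * β * (η * (2 + 2 * (α + β))) := by linarith
    have := le_of_mul_le_mul_left this h
    nlinarith

/-- An operator version of the Friedgut–Kalai–Naor theorem. -/
theorem exists_register_of_close_to_regSum (hl : ∀ k, (l k).IsHermitian)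
    (h0 : ∀ k, ntr (l k) = 0) {P : Matrix (Reg n) (Reg n) ℂ} (hP : P.IsHermitian)
    (hP1 : (1 - P * P).PosSemidef) {η : ℝ} (hη0 : 0 ≤ η) (hη : η ≤ 1 / 10)
    (hP2 : normF (1 - P * P) ≤ η) (hL : normF (P - regSum l Finset.univ) ≤ η) :
    ∃ ℓ, normF (P - onRegister ℓ (l ℓ)) ≤ 11 * η := by
  set w : Fin n → ℝ := fun k => normF (l k) ^ 2 with hw
  have hw0 : ∀ k, 0 ≤ w k := fun k => sq_nonneg _
  set W := ∑ k, w k with hW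
  have hWL : normF (regSum l Finset.univ) ^ 2 = W := normF_regSum_sq hl h0 _
  -- With `η ≤ 1 / 10`, `P` has norm at least `9 / 10`, hence its linear approximation at least `8 /
  -- 10`.
  have hWlb : 64 / 100 ≤ W := by
    have h1 : 1 - η ≤ normF P ^ 2 := by
      have h2 := (Complex.abs_re_le_norm _).trans (norm_ntr_le (1 - P * P))
      rw [ntr_sub, ntr_one, Complex.sub_re, Complex.one_re, ntr_mul_self_eq hP,
        Complex.ofReal_re] at h2
      linarith [le_abs_self (1 - normF P ^ 2)]
    have h2 := normF_le_one_of_contraction hP hP1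
    have h3 := normF_nonneg P
    have h4 := normF_triangle P (regSum l Finset.univ) 0
    rw [sub_zero, sub_zero] at h4
    have h5 : 8 / 10 ≤ normF (regSum l Finset.univ) := by nlinarith
    rw [← hWL]
    nlinarith
  have key : ∀ S : Finset (Fin n), (∑ k ∈ S, w k) * (W - ∑ k ∈ S, w k) ≤ 16 * η ^ 2 := by
    intro S
    have h := normF_regSum_mul_normF_regSum_compl_le hl h0 hP hP1 hη0 hη hP2 hL S
    have h1 : ∑ k ∈ S, w k = normF (regSum l S) ^ 2 := (normF_regSum_sq hl h0 S).symm
    have h2 : W - ∑ k ∈ S, w k = normF (regSum l Sᶜ) ^ 2 := by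
      rw [normF_regSum_sq hl h0, hW, ← Finset.sum_add_sum_compl S]
      ring
    rw [h2, h1, ← mul_pow, show 16 * η ^ 2 = (4 * η) ^ 2 by ring]
    have := mul_nonneg (normF_nonneg (regSum l S)) (normF_nonneg (regSum l Sᶜ))
    gcongr
  -- The dominant register is the one at which the prefix sums of the weights first reach half of
  -- the total.
  have hex : ∃ m, W / 2 ≤ ∑ k with (k : Fin n).val < m, w k := by
    refine ⟨n, ?_⟩
    rw [Finset.filter_true_of_mem (fun k _ => k.2)]
    linarith
  classical
  obtain ⟨hm, hmin⟩ : W / 2 ≤ ∑ k with (k : Fin n).val < Nat.find hex, w k ∧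
      ∀ m < Nat.find hex, ¬ W / 2 ≤ ∑ k with (k : Fin n).val < m, w k :=
    ⟨Nat.find_spec hex, fun m hm => Nat.find_min hex hm⟩
  generalize Nat.find hex = m at hm hmin
  have hm0 : m ≠ 0 := by
    rintro rfl
    simp at hm
    linarith
  have hmn : m - 1 < n := by
    by_contra! h
    refine hmin (m - 1) (by omega) ?_
    rw [Finset.filter_true_of_mem (fun k _ => k.2.trans_le h)]
    linarith
  set ℓ : Fin n := ⟨m - 1, hmn⟩ with hℓ
  have hlow := hmin (m - 1) (by omega)
  push Not at hlow
  have hins : ∑ k with (k : Fin n).val < m, w k =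
      w ℓ + ∑ k with (k : Fin n).val < m - 1, w k := by
    rw [← Finset.sum_insert (by simp [hℓ])]
    congr 1
    ext k
    simp only [Finset.mem_filter, Finset.mem_univ, true_and, Finset.mem_insert, hℓ, Fin.ext_iff]
    omega
  have k1 := key (Finset.univ.filter fun k : Fin n => k.val < m - 1)
  have k2 := key (Finset.univ.filter fun k : Fin n => k.val < m)
  rw [hins] at hm k2
  have p1 : 0 ≤ ∑ k with (k : Fin n).val < m - 1, w k := Finset.sum_nonneg fun k _ => hw0 k
  have p2 : w ℓ + ∑ k with (k : Fin n).val < m - 1, w k ≤ W := by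
    rw [← hins]
    exact Finset.sum_le_sum_of_subset_of_nonneg (Finset.filter_subset _ _) fun k _ _ => hw0 k
  -- The registers before `ℓ` carry at most half of `W`, and so do those after it. In each
  -- bipartition the other side carries at least `0.32`, so each light side has weight at most `16 *
  -- η ^ 2 / 0.32 = 50 * η ^ 2`.
  have hrest : W - w ℓ ≤ 100 * η ^ 2 := by
    generalize ∑ k with (k : Fin n).val < m - 1, w k = f at *
    have q1 : f ≤ 50 * η ^ 2 := by nlinarith
    have q2 : W - (w ℓ + f) ≤ 50 * η ^ 2 := by nlinarith
    linarith
  have herase : normF (regSum l Finset.univ - onRegister ℓ (l ℓ)) ≤ 10 * η := by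
    have e1 : regSum l Finset.univ - onRegister ℓ (l ℓ) = regSum l (Finset.univ.erase ℓ) := by
      rw [regSum, regSum, ← Finset.add_sum_erase _ _ (Finset.mem_univ ℓ), add_sub_cancel_left]
    refine abs_le_of_sq_le_sq' ?_ (by positivity) |>.2
    rw [e1, normF_regSum_sq hl h0, Finset.sum_erase_eq_sub (Finset.mem_univ ℓ)]
    calc _ = W - w ℓ := rfl
      _ ≤ _ := by rw [mul_pow]; linarith
  refine ⟨ℓ, (normF_triangle _ (regSum l Finset.univ) _).trans ?_⟩
  linarith

end FKN

/-! ### Two-qubit observables -/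

section TwoQubitObservables

theorem sqrt_card_twoQubit : Real.sqrt (Fintype.card TwoQubit) = 2 := by
  rw [show (Fintype.card TwoQubit : ℝ) = 2 ^ 2 by simp; norm_num]
  exact Real.sqrt_sq (by norm_num)

theorem normF_mul_le (M N : Matrix TwoQubit TwoQubit ℂ) :
    normF (M * N) ≤ 2 * normF M * normF N := by
  open scoped Matrix.Norms.Frobenius in
  have h := Matrix.frobenius_norm_mul M N
  rw [normF_eq, normF_eq, normF_eq, sqrt_card_twoQubit]
  linarith

theorem norm_entry_le_normF (M : Matrix TwoQubit TwoQubit ℂ) (p q : TwoQubit) :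
    ‖M p q‖ ≤ 2 * normF M := by
  rw [normF_eq, sqrt_card_twoQubit]
  linarith [norm_entry_le_frobenius M p q]

theorem normF_sq_eq_sum (M : Matrix TwoQubit TwoQubit ℂ) :
    normF M ^ 2 = (∑ q, ∑ p, ‖M p q‖ ^ 2) / 4 := by
  rw [normF_sq, ntr, Complex.div_natCast_re, Matrix.trace, Complex.re_sum]
  congr 1
  · refine Finset.sum_congr rfl fun q _ => ?_
    rw [Matrix.diag_apply, Matrix.mul_apply, Complex.re_sum]
    refine Finset.sum_congr rfl fun p _ => ?_
    rw [Matrix.conjTranspose_apply, ← starRingEnd_apply, ← Complex.normSq_eq_conj_mul_self,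
      Complex.ofReal_re, Complex.normSq_eq_norm_sq]

theorem normF_le_of_entries {M : Matrix TwoQubit TwoQubit ℂ} {c : ℝ} (hc : 0 ≤ c)
    (h : ∀ p q, ‖M p q‖ ≤ c) : normF M ≤ 2 * c := by
  refine abs_le_of_sq_le_sq' ?_ (by positivity) |>.2
  rw [normF_sq_eq_sum]
  have : ∑ q, ∑ p, ‖M p q‖ ^ 2 ≤ ∑ _q : TwoQubit, ∑ _p : TwoQubit, c ^ 2 :=
    Finset.sum_le_sum fun q _ => Finset.sum_le_sum fun p _ => by
      have := h p q
      gcongr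
  simp at this
  linarith

theorem IsBinaryObservable.conjTranspose_mul_self {H : Type} [Fintype H] [DecidableEq H]
    {M : Matrix H H ℂ} (hM : IsBinaryObservable M) : Mᴴ * M = 1 := by rw [hM.1.eq, hM.2]

theorem IsBinaryObservable.mul_conjTranspose_self {H : Type} [Fintype H] [DecidableEq H]
    {M : Matrix H H ℂ} (hM : IsBinaryObservable M) : M * Mᴴ = 1 := by rw [hM.1.eq, hM.2]

/-- The trace of a projection is its rank. -/
theorem trace_idempotent {H : Type} [Fintype H] [DecidableEq H] {E : Matrix H H ℂ}
    (hE : E * E = E) : ∃ r : ℕ, E.trace = r := by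
  have h : IsIdempotentElem (Matrix.toLin' E) := by
    rw [IsIdempotentElem, Module.End.mul_eq_comp, ← Matrix.toLin'_mul, hE]
  refine ⟨Module.finrank ℂ (LinearMap.range (Matrix.toLin' E)), ?_⟩
  rw [← Matrix.trace_toLin'_eq]
  exact ((LinearMap.isProj_range_iff_isIdempotentElem _).2 h).trace

/-- `(1 + M) / 2` is idempotent of integer trace `r`, so `M` has trace `2 * r - 4`; normalized
traces are multiples of `1 / 2`, and being nearly traceless means being traceless. -/
theorem IsBinaryObservable.trace_eq_zero {M : Matrix TwoQubit TwoQubit ℂ}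
    (hM : IsBinaryObservable M) (h : ‖ntr M‖ < 1 / 2) : M.trace = 0 := by
  obtain ⟨r, hr⟩ := trace_idempotent (E := (1 / 2 : ℂ) • (1 + M)) (by
    rw [Matrix.smul_mul, Matrix.mul_smul, Matrix.add_mul, Matrix.mul_add, Matrix.mul_add, hM.2]
    simp only [Matrix.one_mul, Matrix.mul_one]
    module)
  have h1 : M.trace = 2 * (r : ℂ) - 4 := by
    rw [Matrix.trace_smul, Matrix.trace_add, Matrix.trace_one] at hr
    simp at hr
    rw [← hr]
    ring
  have hc : (Fintype.card TwoQubit : ℂ) = 4 := by simp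
  rw [ntr, hc, h1] at h
  have h2 : ‖(2 * (r : ℂ) - 4) / 4‖ = |2 * (r : ℝ) - 4| / 4 := by
    rw [norm_div]
    congr 1
    · rw [← Real.norm_eq_abs, ← Complex.norm_real]; push_cast; rfl
    · norm_num
  rw [h2] at h
  have h3 : |2 * (r : ℝ) - 4| < 2 := by linarith
  rw [abs_lt] at h3
  have h4 : (1 : ℝ) < r := by linarith
  have h5 : (r : ℝ) < 3 := by linarith
  norm_cast at h4 h5
  have : r = 2 := by omega
  rw [h1, this]
  norm_num

/-- Rounding a traceless Hermitian matrix with square close to `1`. -/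
theorem exists_binaryObservable_near {l : Matrix TwoQubit TwoQubit ℂ} (hl : l.IsHermitian)
    (h0 : ntr l = 0) {η : ℝ} (hη : η < 1 / 2) (h : normF (l * l - 1) ≤ η) :
    ∃ M, IsBinaryObservable M ∧ M.trace = 0 ∧ normF (l - M) ≤ η := by
  obtain ⟨R, hR, hRc, hU, hn⟩ := exists_polar (T := l) (by
    rw [hl.eq, sqrt_card_twoQubit]; linarith)
  rw [hl.eq] at hRc hn
  -- Since `l` commutes with `l * l`, the polar part `l * R` is Hermitian as well as unitary, that
  -- is, an involution (the sign of `l`).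
  have hc : R * l = l * R := (hRc l ((Commute.refl l).mul_left (Commute.refl l))).eq
  have hH : (l * R).IsHermitian := by
    rw [Matrix.IsHermitian, Matrix.conjTranspose_mul, hl.eq, hR.eq, hc]
  have hb : IsBinaryObservable (l * R) := ⟨hH, by rwa [hH.eq] at hU⟩
  refine ⟨l * R, hb, hb.trace_eq_zero ?_, hn.trans h⟩
  have := norm_ntr_le (l - l * R)
  rw [ntr_sub, h0, zero_sub, norm_neg] at this
  linarith

end TwoQubitObservables

/-! ### Rigidity of the magic square relations in dimension four -/

section Rigidity

theorem pauliTable_isBinaryObservable (i j : Fin 3) : IsBinaryObservable (pauliTable i j) := by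
  have k : ∀ s t : Fin 4, IsBinaryObservable (pauli s ⊗ₖ pauli t) := fun s t =>
    ⟨pauli₂_isHermitian (s, t), pauli₂_mul_self (s, t)⟩
  fin_cases i <;> fin_cases j
  exacts [k 1 0, k 0 1, k 1 1, k 0 3, k 3 0, k 3 3, k 1 3, k 3 1, k 2 2]

theorem trace_pauliTable (i j : Fin 3) : (pauliTable i j).trace = 0 := by
  fin_cases i <;> fin_cases j <;>
    simp [pauliTable, Matrix.trace_kronecker, pauliX, pauliY, pauliZ, Matrix.trace_fin_two]

theorem pauliTable_row_zero : pauliTable 0 2 = pauliTable 0 0 * pauliTable 0 1 := by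
  simp [pauliTable, ← Matrix.mul_kronecker_mul]

theorem pauliTable_row_one : pauliTable 1 2 = pauliTable 1 0 * pauliTable 1 1 := by
  simp [pauliTable, ← Matrix.mul_kronecker_mul]

theorem pauliTable_col_zero : pauliTable 2 0 = pauliTable 0 0 * pauliTable 1 0 := by
  simp [pauliTable, ← Matrix.mul_kronecker_mul]

theorem pauliTable_col_one : pauliTable 2 1 = pauliTable 0 1 * pauliTable 1 1 := by
  simp [pauliTable, ← Matrix.mul_kronecker_mul]

/-- The sign is `(-i) ^ 2`, from `X Z = -i Y` on each of the two qubits. -/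
theorem pauliTable_col_two : pauliTable 2 2 = -(pauliTable 0 2 * pauliTable 1 2) := by
  have h : pauliX * pauliZ = -(Complex.I) • pauliY := by
    ext i j; fin_cases i <;> fin_cases j <;>
      simp [pauliX, pauliY, pauliZ, Matrix.mul_apply, Fin.sum_univ_two]
  have e : pauliTable 0 2 * pauliTable 1 2 = (pauliX * pauliZ) ⊗ₖ (pauliX * pauliZ) := by
    simp [pauliTable, ← Matrix.mul_kronecker_mul]
  rw [e, h, Matrix.smul_kronecker, Matrix.kronecker_smul, smul_smul]
  simp [pauliTable]

theorem conj_pauliTable_zero_zero (M : Matrix TwoQubit TwoQubit ℂ) (a b c d : Fin 2) :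
    (pauliTable 0 0 * M * pauliTable 0 0) (a, b) (c, d) = M (a + 1, b) (c + 1, d) := by
  fin_cases a <;> fin_cases b <;> fin_cases c <;> fin_cases d <;>
    simp [pauliTable, pauliX, Matrix.mul_apply, Fintype.sum_prod_type, Fin.sum_univ_two,
      Matrix.one_apply]

theorem conj_pauliTable_zero_one (M : Matrix TwoQubit TwoQubit ℂ) (a b c d : Fin 2) :
    (pauliTable 0 1 * M * pauliTable 0 1) (a, b) (c, d) = M (a, b + 1) (c, d + 1) := by
  fin_cases a <;> fin_cases b <;> fin_cases c <;> fin_cases d <;>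
    simp [pauliTable, pauliX, Matrix.mul_apply, Fintype.sum_prod_type, Fin.sum_univ_two,
      Matrix.one_apply]

theorem conj_pauliTable_one_one (M : Matrix TwoQubit TwoQubit ℂ) (a b c d : Fin 2) :
    (pauliTable 1 1 * M * pauliTable 1 1) (a, b) (c, d) =
      (if a = c then 1 else -1) * M (a, b) (c, d) := by
  fin_cases a <;> fin_cases b <;> fin_cases c <;> fin_cases d <;>
    simp [pauliTable, pauliZ, Matrix.mul_apply, Fintype.sum_prod_type, Fin.sum_univ_two,
      Matrix.one_apply]

theorem conj_pauliTable_one_zero (M : Matrix TwoQubit TwoQubit ℂ) (a b c d : Fin 2) :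
    (pauliTable 1 0 * M * pauliTable 1 0) (a, b) (c, d) =
      (if b = d then 1 else -1) * M (a, b) (c, d) := by
  fin_cases a <;> fin_cases b <;> fin_cases c <;> fin_cases d <;>
    simp [pauliTable, pauliZ, Matrix.mul_apply, Fintype.sum_prod_type, Fin.sum_univ_two,
      Matrix.one_apply]

/-- A matrix that is almost invariant under conjugation with the generators of the Pauli group is
almost scalar. -/
theorem normF_sub_one_le_of_conj_pauliTable {G : Matrix TwoQubit TwoQubit ℂ} {κ : ℝ} (hκ : 0 ≤ κ)
    (hG : G (0, 0) (0, 0) = 1)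
    (hx : normF (pauliTable 0 0 * G * pauliTable 0 0 - G) ≤ κ)
    (hx' : normF (pauliTable 0 1 * G * pauliTable 0 1 - G) ≤ κ)
    (hz : normF (pauliTable 1 1 * G * pauliTable 1 1 - G) ≤ κ)
    (hz' : normF (pauliTable 1 0 * G * pauliTable 1 0 - G) ≤ κ) :
    normF (G - 1) ≤ 8 * κ := by
  -- Conjugation with the `X` operators compares the diagonal entries with each other, hence with
  -- the entry fixed to be 1 by `hG`.
  have e1 : ∀ b, ‖G (1, b) (1, b) - G (0, b) (0, b)‖ ≤ 2 * κ := fun b => by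
    have := (norm_entry_le_normF _ (0, b) (0, b)).trans (mul_le_mul_of_nonneg_left hx zero_le_two)
    rwa [Matrix.sub_apply, conj_pauliTable_zero_zero] at this
  have e2 : ‖G (0, 1) (0, 1) - G (0, 0) (0, 0)‖ ≤ 2 * κ := by
    have := (norm_entry_le_normF _ (0, 0) (0, 0)).trans
      (mul_le_mul_of_nonneg_left hx' zero_le_two)
    rwa [Matrix.sub_apply, conj_pauliTable_zero_one] at this
  have e3 : ∀ a b, ‖G (a, b) (a, b) - 1‖ ≤ 4 * κ := by
    intro a b
    have h0 : ∀ b, ‖G (0, b) (0, b) - 1‖ ≤ 2 * κ := fun b => by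
      fin_cases b
      · simpa [hG] using hκ
      · rw [hG] at e2; exact e2
    fin_cases a
    · exact (h0 b).trans (by linarith)
    · have := norm_add_le (G (1, b) (1, b) - G (0, b) (0, b)) (G (0, b) (0, b) - 1)
      rw [sub_add_sub_cancel] at this
      exact this.trans (by linarith [e1 b, h0 b])
  -- Conjugation with a `Z` operator negates the entries off its diagonal blocks, so near-invariance
  -- bounds twice such an entry.
  have hneg : ∀ z : ℂ, ‖-1 * z - z‖ = 2 * ‖z‖ := fun z => by
    rw [show -1 * z - z = -2 * z by ring, norm_mul]; norm_num
  have h4 : normF (G - 1) ≤ 2 * (4 * κ) := by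
    refine normF_le_of_entries (by positivity) ?_
    rintro ⟨a, b⟩ ⟨c, d⟩
    by_cases hac : a = c
    · by_cases hbd : b = d
      · subst hac hbd
        rw [Matrix.sub_apply, Matrix.one_apply_eq]
        exact e3 a b
      · have := (norm_entry_le_normF _ (a, b) (c, d)).trans
          (mul_le_mul_of_nonneg_left hz' zero_le_two)
        rw [Matrix.sub_apply, conj_pauliTable_one_zero, if_neg hbd, hneg] at this
        rw [Matrix.sub_apply, Matrix.one_apply_ne (by simp [hbd]), sub_zero]
        linarith
    · have := (norm_entry_le_normF _ (a, b) (c, d)).trans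
        (mul_le_mul_of_nonneg_left hz zero_le_two)
      rw [Matrix.sub_apply, conj_pauliTable_one_one, if_neg hac, hneg] at this
      rw [Matrix.sub_apply, Matrix.one_apply_ne (by simp [hac]), sub_zero]
      linarith
  linarith

/-- A rank-one matrix whose range lies in the `+1` eigenspace of `D` and almost in that of `B`. -/
theorem exists_seed {B D : Matrix TwoQubit TwoQubit ℂ} (hB : IsBinaryObservable B)
    (hD : IsBinaryObservable D) (hB0 : ntr B = 0) (hD0 : ntr D = 0) {κ : ℝ}
    (hDB : ‖ntr (D * B)‖ ≤ 1 / 4) (hc : normF (B * D - D * B) ≤ κ) :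
    ∃ V : Matrix TwoQubit TwoQubit ℂ, D * V = V ∧ normF ((B - 1) * V) ≤ 3 * κ ∧
      normF V = 1 / 2 ∧ (∀ p q, q ≠ (0, 0) → V p q = 0) := by
  -- Four times the product of the two `+1` eigenprojections. Its normalized trace `1 + ntr (D * B)`
  -- keeps it away from zero, and some column is at least as large as the average.
  set M := (1 + D) * (1 + B) with hM
  have hMn : 3 / 4 ≤ normF M := by
    refine le_trans ?_ (norm_ntr_le M)
    have : ntr M = 1 + ntr (D * B) := by
      rw [hM, Matrix.add_mul, Matrix.mul_add, Matrix.mul_add, ntr_add, ntr_add, ntr_add,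
        Matrix.one_mul, Matrix.one_mul, Matrix.mul_one, ntr_one, hB0, hD0]
      ring
    have h1 := norm_sub_norm_le (1 : ℂ) (-ntr (D * B))
    rw [norm_neg, norm_one, sub_neg_eq_add, ← this] at h1
    linarith
  obtain ⟨k, hk⟩ : ∃ k, 9 / 16 ≤ ∑ p, ‖M p k‖ ^ 2 := by
    by_contra! h
    have h1 := normF_sq_eq_sum M
    have h2 : ∑ q, ∑ p, ‖M p q‖ ^ 2 < ∑ _q : TwoQubit, (9 / 16 : ℝ) :=
      Finset.sum_lt_sum_of_nonempty Finset.univ_nonempty fun q _ => h q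
    simp at h2
    nlinarith
  set w := Real.sqrt (∑ p, ‖M p k‖ ^ 2) with hw
  have hw2 : w ^ 2 = ∑ p, ‖M p k‖ ^ 2 := Real.sq_sqrt (by positivity)
  have hw34 : 3 / 4 ≤ w := Real.le_sqrt_of_sq_le (by norm_num; exact hk)
  -- Right multiplication by `E` moves column `k` to column `(0, 0)` and erases the others.
  set E : Matrix TwoQubit TwoQubit ℂ := Matrix.single k (0, 0) 1 with hE
  have hNE : ∀ (N : Matrix TwoQubit TwoQubit ℂ) p q,
      (N * E) p q = if q = (0, 0) then N p k else 0 := by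
    intro N p q
    by_cases hq : q = (0, 0)
    · subst hq
      rw [hE, if_pos rfl, Matrix.mul_single_apply_same, mul_one]
    · rw [hE, if_neg hq, Matrix.mul_single_apply_of_ne _ _ _ _ _ hq]
  have hnE : ∀ N : Matrix TwoQubit TwoQubit ℂ,
      normF (N * E) ^ 2 = (∑ p, ‖N p k‖ ^ 2) / 4 := by
    intro N
    rw [normF_sq_eq_sum]
    congr 1
    simp only [hNE]
    rw [Finset.sum_eq_single (0, 0)]
    · simp
    · intro q _ hq; simp [hq]
    · simp
  have hnE' : ∀ N : Matrix TwoQubit TwoQubit ℂ, normF (N * E) ≤ normF N := by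
    intro N
    refine abs_le_of_sq_le_sq' ?_ (normF_nonneg _) |>.2
    rw [hnE, normF_sq_eq_sum]
    refine div_le_div_of_nonneg_right ?_ (by norm_num)
    exact Finset.single_le_sum (f := fun q => ∑ p, ‖N p q‖ ^ 2) (fun _ _ => by positivity)
      (Finset.mem_univ k)
  have hwn : ‖((1 / w : ℝ) : ℂ)‖ = 1 / w := by
    rw [Complex.norm_real, Real.norm_of_nonneg (by positivity)]
  refine ⟨((1 / w : ℝ) : ℂ) • (M * E), ?_, ?_, ?_, ?_⟩
  · have e : D * M = M := by
      rw [hM, ← Matrix.mul_assoc, Matrix.mul_add D, hD.2, Matrix.mul_one, add_comm D]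
    rw [Matrix.mul_smul, ← Matrix.mul_assoc, e]
  -- Were `B` and `D` to commute, `B - 1` would annihilate `M`; the defect is exactly the
  -- commutator.
  · have e : (B - 1) * M = (B * D - D * B) * (1 + B) := by
      have : (B - 1) * M = (B * D - D * B) * (1 + B) + (1 + D) * (B * B - 1) := by
        rw [hM]; noncomm_ring
      rw [this, hB.2, sub_self, Matrix.mul_zero, add_zero]
    rw [Matrix.mul_smul, ← Matrix.mul_assoc, normF_smul, hwn, e]
    have h1 : normF ((B * D - D * B) * (1 + B)) ≤ 2 * κ := by
      rw [Matrix.mul_add, Matrix.mul_one]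
      refine (normF_add_le _ _).trans ?_
      rw [normF_mul_unitary hB.mul_conjTranspose_self]
      linarith
    have h2 := (hnE' ((B * D - D * B) * (1 + B))).trans h1
    have hκ : 0 ≤ κ := (normF_nonneg _).trans hc
    have h3 : 1 / w ≤ 3 / 2 := by
      rw [div_le_iff₀ (by linarith)]; linarith
    calc _ ≤ 3 / 2 * (2 * κ) := by
          have := normF_nonneg ((B * D - D * B) * (1 + B) * E)
          gcongr
      _ = _ := by ring
  · rw [normF_smul, hwn]
    have h1 : normF (M * E) = w / 2 := by
      rw [← sq_eq_sq₀ (normF_nonneg _) (by positivity), hnE, ← hw2]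
      ring
    rw [h1]
    have : w ≠ 0 := by linarith
    field_simp
  · intro p q hq
    rw [Matrix.smul_apply, hNE, if_neg hq, smul_zero]

/-- The basis vector `(0, 0)` is a `+1` eigenvector of both `Z` operators, matching the eigenvector
property of the seed on the other side. -/
theorem mul_pauliZ_of_column_zero {V : Matrix TwoQubit TwoQubit ℂ}
    (hV : ∀ p q, q ≠ (0, 0) → V p q = 0) :
    V * pauliTable 1 1 = V ∧ V * pauliTable 1 0 = V := by
  have h : ∀ p a b, V p (a, b) = if (a, b) = (0, 0) then V p (0, 0) else 0 := by
    intro p a b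
    split_ifs with h
    · rw [h]
    · exact hV _ _ h
  constructor
  · ext p ⟨a, b⟩
    rw [Matrix.mul_apply, Fintype.sum_prod_type]
    simp only [Fin.sum_univ_two]
    rw [h p 0 1, h p 1 0, h p 1 1, h p a b]
    fin_cases a <;> fin_cases b <;> simp [pauliTable, pauliZ]
  · ext p ⟨a, b⟩
    rw [Matrix.mul_apply, Fintype.sum_prod_type]
    simp only [Fin.sum_univ_two]
    rw [h p 0 1, h p 1 0, h p 1 1, h p a b]
    fin_cases a <;> fin_cases b <;> simp [pauliTable, pauliZ]

theorem mul_pauliTable_apply_zero {V : Matrix TwoQubit TwoQubit ℂ}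
    (hV : ∀ p q, q ≠ (0, 0) → V p q = 0) (M : Matrix TwoQubit TwoQubit ℂ) (p : TwoQubit) :
    (V * M) p (0, 0) = V p (0, 0) * M (0, 0) (0, 0) := by
  rw [Matrix.mul_apply, Finset.sum_eq_single (0, 0)]
  · intro q _ hq
    rw [hV p q hq, zero_mul]
  · simp

theorem pauliZ_mul_pauliX : pauliZ * pauliX = -(pauliX * pauliZ) := by
  ext i j; fin_cases i <;> fin_cases j <;>
    simp [pauliX, pauliZ, Matrix.mul_apply, Fin.sum_univ_two]

theorem pauliTable_relations :
    pauliTable 0 1 * pauliTable 0 0 = pauliTable 0 0 * pauliTable 0 1 ∧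
    pauliTable 0 1 * pauliTable 1 1 = pauliTable 1 1 * pauliTable 0 1 ∧
    pauliTable 0 0 * pauliTable 1 0 = pauliTable 1 0 * pauliTable 0 0 ∧
    pauliTable 0 0 * pauliTable 1 1 = -(pauliTable 1 1 * pauliTable 0 0) ∧
    pauliTable 0 1 * pauliTable 1 0 = -(pauliTable 1 0 * pauliTable 0 1) := by
  have hn : ∀ M N : Matrix (Fin 2) (Fin 2) ℂ, (-M) ⊗ₖ N = -(M ⊗ₖ N) ∧ M ⊗ₖ (-N) = -(M ⊗ₖ N) := by
    intro M N
    constructor <;> ext i j <;> simp [Matrix.kroneckerMap_apply]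
  refine ⟨?_, ?_, ?_, ?_, ?_⟩ <;>
    simp [pauliTable, ← Matrix.mul_kronecker_mul, pauliZ_mul_pauliX, hn]

/-- The sum over the group generated by two involutions of `g V g'`. -/
noncomputable def intertwiner (A C V X₁ X₂ : Matrix TwoQubit TwoQubit ℂ) :
    Matrix TwoQubit TwoQubit ℂ :=
  V + C * (V * X₂) + A * (V * X₁) + A * (C * (V * (X₁ * X₂)))

/-! ### Approximate intertwining relations and the Gram matrix. -/

section Intertwiner
variable {A B C D V X₁ X₂ Z₁ Z₂ : Matrix TwoQubit TwoQubit ℂ} {κ : ℝ}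

/-- Exact, because `A` stands outermost in the sum and left multiplication by it just permutes the
terms. -/
theorem intertwiner_left (hA : A * A = 1) (h₁ : X₁ * X₁ = 1) (h₂₁ : X₂ * X₁ = X₁ * X₂) :
    A * intertwiner A C V X₁ X₂ = intertwiner A C V X₁ X₂ * X₁ := by
  have hA' : ∀ Y, A * (A * Y) = Y := fun Y => by rw [← Matrix.mul_assoc, hA, Matrix.one_mul]
  have h₁' : ∀ Y, X₁ * (X₁ * Y) = Y := fun Y => by rw [← Matrix.mul_assoc, h₁, Matrix.one_mul]
  simp only [intertwiner, Matrix.mul_add, Matrix.add_mul, Matrix.mul_assoc, hA', h₁, h₁', h₂₁,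
    Matrix.mul_one]
  abel

/-- `C` has to pass `A` in two of the four terms, each time at the cost of one commutator. -/
theorem normF_intertwiner_right_le (hC : IsBinaryObservable C)
    (hX₁ : IsBinaryObservable X₁) (hX₂ : IsBinaryObservable X₂)
    (hV : ∀ M : Matrix TwoQubit TwoQubit ℂ, normF (M * V) ≤ normF M)
    (cCA : normF (C * A - A * C) ≤ κ) :
    normF (C * intertwiner A C V X₁ X₂ - intertwiner A C V X₁ X₂ * X₂) ≤ 2 * κ := by
  have hC' : ∀ Y, C * (C * Y) = Y := fun Y => by rw [← Matrix.mul_assoc, hC.2, Matrix.one_mul]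
  have e : C * intertwiner A C V X₁ X₂ - intertwiner A C V X₁ X₂ * X₂ =
      (C * A - A * C) * V * X₁ + (C * A - A * C) * C * V * X₁ * X₂ := by
    simp only [intertwiner, Matrix.mul_add, Matrix.add_mul, Matrix.sub_mul, Matrix.mul_assoc, hC',
      hX₂.2, Matrix.mul_one]
    abel
  rw [e]
  refine (normF_add_le _ _).trans ?_
  rw [normF_mul_unitary hX₁.mul_conjTranspose_self, normF_mul_unitary hX₂.mul_conjTranspose_self,
    normF_mul_unitary hX₁.mul_conjTranspose_self]
  have h1 := hV (C * A - A * C)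
  have h2 := hV ((C * A - A * C) * C)
  rw [normF_mul_unitary hC.mul_conjTranspose_self] at h2
  linarith

/-- Moving `B` through to `V` costs four times a commutator or anticommutator, and in each of the
four terms `B * V ≈ V` costs `3 * κ`: in total `4 + 12 = 16`. -/
theorem normF_intertwiner_anti_left_le (hA : IsBinaryObservable A) (hC : IsBinaryObservable C)
    (hX₁ : IsBinaryObservable X₁) (hX₂ : IsBinaryObservable X₂)
    (hV : ∀ M : Matrix TwoQubit TwoQubit ℂ, normF (M * V) ≤ normF M)
    (hVZ : V * Z₁ = V) (r₂ : X₂ * Z₁ = Z₁ * X₂) (r₁ : X₁ * Z₁ = -(Z₁ * X₁))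
    (hBV : normF ((B - 1) * V) ≤ 3 * κ) (cBC : normF (B * C - C * B) ≤ κ)
    (aBA : normF (B * A + A * B) ≤ κ) :
    normF (B * intertwiner A C V X₁ X₂ - intertwiner A C V X₁ X₂ * Z₁) ≤ 16 * κ := by
  have hVZ' : ∀ Y, V * (Z₁ * Y) = V * Y := fun Y => by rw [← Matrix.mul_assoc, hVZ]
  have r₁' : ∀ Y, X₁ * (Z₁ * Y) = -(Z₁ * (X₁ * Y)) := fun Y => by
    rw [← Matrix.mul_assoc, r₁, Matrix.neg_mul, Matrix.mul_assoc]
  have e : B * intertwiner A C V X₁ X₂ - intertwiner A C V X₁ X₂ * Z₁ =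
      (B - 1) * V + (B * C - C * B) * V * X₂ + C * ((B - 1) * V) * X₂ + (B * A + A * B) * V * X₁
      - A * ((B - 1) * V) * X₁ + (B * A + A * B) * C * V * X₁ * X₂
      - A * ((B * C - C * B) * V) * X₁ * X₂ - A * (C * ((B - 1) * V)) * X₁ * X₂ := by
    simp only [intertwiner, Matrix.mul_add, Matrix.add_mul, Matrix.sub_mul, Matrix.mul_sub,
      Matrix.mul_assoc, hVZ, hVZ', r₂, r₁, r₁', Matrix.mul_neg, Matrix.one_mul]
    abel
  have uA := hA.conjTranspose_mul_self
  have uC := hC.conjTranspose_mul_self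
  have u₁ := hX₁.mul_conjTranspose_self
  have u₂ := hX₂.mul_conjTranspose_self
  have n1 : normF ((B * C - C * B) * V * X₂) ≤ κ := by
    rw [normF_mul_unitary u₂]; exact (hV _).trans cBC
  have n2 : normF (C * ((B - 1) * V) * X₂) ≤ 3 * κ := by
    rwa [normF_mul_unitary u₂, normF_unitary_mul uC]
  have n3 : normF ((B * A + A * B) * V * X₁) ≤ κ := by
    rw [normF_mul_unitary u₁]; exact (hV _).trans aBA
  have n4 : normF (A * ((B - 1) * V) * X₁) ≤ 3 * κ := by
    rwa [normF_mul_unitary u₁, normF_unitary_mul uA]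
  have n5 : normF ((B * A + A * B) * C * V * X₁ * X₂) ≤ κ := by
    rw [normF_mul_unitary u₂, normF_mul_unitary u₁]
    refine (hV _).trans ?_
    rwa [normF_mul_unitary hC.mul_conjTranspose_self]
  have n6 : normF (A * ((B * C - C * B) * V) * X₁ * X₂) ≤ κ := by
    rw [normF_mul_unitary u₂, normF_mul_unitary u₁, normF_unitary_mul uA]
    exact (hV _).trans cBC
  have n7 : normF (A * (C * ((B - 1) * V)) * X₁ * X₂) ≤ 3 * κ := by
    rwa [normF_mul_unitary u₂, normF_mul_unitary u₁, normF_unitary_mul uA, normF_unitary_mul uC]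
  rw [e]
  refine (normF_sub_le _ _).trans ?_
  refine (add_le_add_left (normF_sub_le _ _) _).trans ?_
  refine (add_le_add_left (add_le_add_left (normF_add_le _ _) _) _).trans ?_
  refine (add_le_add_left (add_le_add_left (add_le_add_left (normF_sub_le _ _) _) _) _).trans ?_
  have m1 := normF_add_le ((B - 1) * V + (B * C - C * B) * V * X₂ + C * ((B - 1) * V) * X₂)
    ((B * A + A * B) * V * X₁)
  have m2 := normF_add_le ((B - 1) * V + (B * C - C * B) * V * X₂) (C * ((B - 1) * V) * X₂)
  have m3 := normF_add_le ((B - 1) * V) ((B * C - C * B) * V * X₂)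
  linarith

/-- As for `B`, but `D` fixes the seed exactly, so only the four exchange errors remain. -/
theorem normF_intertwiner_anti_right_le (hA : IsBinaryObservable A) (hC : IsBinaryObservable C)
    (hX₁ : IsBinaryObservable X₁) (hX₂ : IsBinaryObservable X₂)
    (hV : ∀ M : Matrix TwoQubit TwoQubit ℂ, normF (M * V) ≤ normF M)
    (hVZ : V * Z₂ = V) (r₁ : X₁ * Z₂ = Z₂ * X₁) (r₂ : X₂ * Z₂ = -(Z₂ * X₂))
    (hDV : D * V = V) (cDA : normF (D * A - A * D) ≤ κ) (aDC : normF (D * C + C * D) ≤ κ) :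
    normF (D * intertwiner A C V X₁ X₂ - intertwiner A C V X₁ X₂ * Z₂) ≤ 4 * κ := by
  have hVZ' : ∀ Y, V * (Z₂ * Y) = V * Y := fun Y => by rw [← Matrix.mul_assoc, hVZ]
  have r₁' : ∀ Y, X₁ * (Z₂ * Y) = Z₂ * (X₁ * Y) := fun Y => by
    rw [← Matrix.mul_assoc, r₁, Matrix.mul_assoc]
  have e : D * intertwiner A C V X₁ X₂ - intertwiner A C V X₁ X₂ * Z₂ =
      (D * C + C * D) * V * X₂ + (D * A - A * D) * V * X₁ +
        (D * A - A * D) * C * V * X₁ * X₂ + A * ((D * C + C * D) * V) * X₁ * X₂ := by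
    simp only [intertwiner, Matrix.mul_add, Matrix.add_mul, Matrix.sub_mul,
      Matrix.mul_assoc, hVZ, hVZ', hDV, r₂, r₁, r₁', Matrix.mul_neg]
    abel
  have u₁ := hX₁.mul_conjTranspose_self
  have u₂ := hX₂.mul_conjTranspose_self
  have n1 : normF ((D * C + C * D) * V * X₂) ≤ κ := by
    rw [normF_mul_unitary u₂]; exact (hV _).trans aDC
  have n2 : normF ((D * A - A * D) * V * X₁) ≤ κ := by
    rw [normF_mul_unitary u₁]; exact (hV _).trans cDA
  have n3 : normF ((D * A - A * D) * C * V * X₁ * X₂) ≤ κ := by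
    rw [normF_mul_unitary u₂, normF_mul_unitary u₁]
    refine (hV _).trans ?_
    rwa [normF_mul_unitary hC.mul_conjTranspose_self]
  have n4 : normF (A * ((D * C + C * D) * V) * X₁ * X₂) ≤ κ := by
    rw [normF_mul_unitary u₂, normF_mul_unitary u₁, normF_unitary_mul hA.conjTranspose_mul_self]
    exact (hV _).trans aDC
  rw [e]
  have m1 := normF_add_le ((D * C + C * D) * V * X₂ + (D * A - A * D) * V * X₁ +
    (D * A - A * D) * C * V * X₁ * X₂) (A * ((D * C + C * D) * V) * X₁ * X₂)
  have m2 := normF_add_le ((D * C + C * D) * V * X₂ + (D * A - A * D) * V * X₁)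
    ((D * A - A * D) * C * V * X₁ * X₂)
  have m3 := normF_add_le ((D * C + C * D) * V * X₂) ((D * A - A * D) * V * X₁)
  linarith

theorem normF_intertwiner_le (hA : IsBinaryObservable A) (hC : IsBinaryObservable C)
    (hX₁ : IsBinaryObservable X₁) (hX₂ : IsBinaryObservable X₂) (hV : normF V = 1 / 2) :
    normF (intertwiner A C V X₁ X₂) ≤ 2 := by
  have uA := hA.conjTranspose_mul_self
  have uC := hC.conjTranspose_mul_self
  have u₁ := hX₁.mul_conjTranspose_self
  have u₂ := hX₂.mul_conjTranspose_self
  have n1 : normF (C * (V * X₂)) = 1 / 2 := by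
    rw [normF_unitary_mul uC, normF_mul_unitary u₂, hV]
  have n2 : normF (A * (V * X₁)) = 1 / 2 := by
    rw [normF_unitary_mul uA, normF_mul_unitary u₁, hV]
  have n3 : normF (A * (C * (V * (X₁ * X₂)))) = 1 / 2 := by
    rw [normF_unitary_mul uA, normF_unitary_mul uC, ← Matrix.mul_assoc, normF_mul_unitary u₂,
      normF_mul_unitary u₁, hV]
  have m1 := normF_add_le (V + C * (V * X₂) + A * (V * X₁)) (A * (C * (V * (X₁ * X₂))))
  have m2 := normF_add_le (V + C * (V * X₂)) (A * (V * X₁))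
  have m3 := normF_add_le V (C * (V * X₂))
  rw [intertwiner]
  linarith

/-- If `T * Z ≈ B * T`, the Gram matrix of `T * Z` is close to that of `B * T`, which equals `Tᴴ *
T` as `B` is unitary. -/
theorem normF_conj_gram_sub_le {B Z T : Matrix TwoQubit TwoQubit ℂ} (hB : IsBinaryObservable B)
    (hZ : IsBinaryObservable Z) (hT : normF T ≤ 2) {e : ℝ} (h : normF (B * T - T * Z) ≤ e) :
    normF (Z * (Tᴴ * T) * Z - Tᴴ * T) ≤ 8 * e := by
  have x : Z * (Tᴴ * T) * Z - Tᴴ * T = -((T * Z)ᴴ * (B * T - T * Z)) -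
      (B * T - T * Z)ᴴ * (B * T) := by
    have hBB : (B * T)ᴴ * (B * T) = Tᴴ * T := by
      rw [Matrix.conjTranspose_mul, Matrix.mul_assoc, ← Matrix.mul_assoc Bᴴ,
        hB.conjTranspose_mul_self, Matrix.one_mul]
    have hZZ : (T * Z)ᴴ * (T * Z) = Z * (Tᴴ * T) * Z := by
      rw [Matrix.conjTranspose_mul, hZ.1.eq]
      simp only [Matrix.mul_assoc]
    rw [Matrix.conjTranspose_sub, Matrix.mul_sub, Matrix.sub_mul, hBB, hZZ]
    abel
  rw [x]
  refine (normF_sub_le _ _).trans ?_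
  rw [normF_neg]
  have h1 := normF_mul_le (T * Z)ᴴ (B * T - T * Z)
  have h2 := normF_mul_le (B * T - T * Z)ᴴ (B * T)
  rw [normF_conjTranspose, normF_mul_unitary hZ.mul_conjTranspose_self] at h1
  rw [normF_conjTranspose, normF_unitary_mul hB.conjTranspose_mul_self] at h2
  have := normF_nonneg T
  have := normF_nonneg (B * T - T * Z)
  nlinarith

end Intertwiner

/-- Approximate solutions of the Pauli relations are close to a unitary conjugate of the exact
one. -/
theorem exists_unitary_of_pauli_relations {A B C D : Matrix TwoQubit TwoQubit ℂ}
    (hA : IsBinaryObservable A) (hB : IsBinaryObservable B) (hC : IsBinaryObservable C)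
    (hD : IsBinaryObservable D) (hB0 : ntr B = 0) (hD0 : ntr D = 0) {κ : ℝ}
    (hκ : κ ≤ 1 / 3000) (hDB : ‖ntr (D * B)‖ ≤ 1 / 4) (cBD : normF (B * D - D * B) ≤ κ)
    (cCA : normF (C * A - A * C) ≤ κ) (cBC : normF (B * C - C * B) ≤ κ)
    (cDA : normF (D * A - A * D) ≤ κ) (aBA : normF (B * A + A * B) ≤ κ)
    (aDC : normF (D * C + C * D) ≤ κ) :
    ∃ U : Matrix TwoQubit TwoQubit ℂ, Uᴴ * U = 1 ∧
      normF (A * U - U * pauliTable 0 0) ≤ 2100 * κ ∧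
      normF (B * U - U * pauliTable 1 1) ≤ 2100 * κ ∧
      normF (C * U - U * pauliTable 0 1) ≤ 2100 * κ ∧
      normF (D * U - U * pauliTable 1 0) ≤ 2100 * κ := by
  have hκ0 : 0 ≤ κ := (normF_nonneg _).trans cBD
  obtain ⟨V, hDV, hBV, hVn, hVz⟩ := exists_seed hB hD hB0 hD0 hDB cBD
  have hMV : ∀ M, normF (M * V) ≤ normF M := fun M => by
    have := normF_mul_le M V
    rw [hVn] at this
    linarith
  obtain ⟨hVZ1, hVZ2⟩ := mul_pauliZ_of_column_zero hVz
  obtain ⟨r1, r2, r3, r4, r5⟩ := pauliTable_relations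
  have bX1 := pauliTable_isBinaryObservable 0 0
  have bX2 := pauliTable_isBinaryObservable 0 1
  have bZ2 := pauliTable_isBinaryObservable 1 0
  have bZ1 := pauliTable_isBinaryObservable 1 1
  obtain ⟨T, hT⟩ : ∃ T, T = intertwiner A C V (pauliTable 0 0) (pauliTable 0 1) := ⟨_, rfl⟩
  -- The `X` operators have zero `(0, 0)` entry, so only the summand `V` reaches the first column of
  -- `T`. This normalizes the Gram matrix at `(0, 0)`.
  have T0 : ∀ p, T p (0, 0) = V p (0, 0) := by
    intro p
    have e : ∀ (M S : Matrix TwoQubit TwoQubit ℂ), S (0, 0) (0, 0) = 0 →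
        (M * (V * S)) p (0, 0) = 0 := by
      intro M S hS
      rw [Matrix.mul_apply]
      refine Finset.sum_eq_zero fun q _ => ?_
      rw [mul_pauliTable_apply_zero hVz, hS, mul_zero, mul_zero]
    rw [hT, intertwiner, Matrix.add_apply, Matrix.add_apply, Matrix.add_apply,
      ← Matrix.mul_assoc A C, e C _ (by simp [pauliTable, pauliX]),
      e A _ (by simp [pauliTable, pauliX]),
      e (A * C) _ (by rw [← pauliTable_row_zero]; simp [pauliTable, pauliX])]
    ring
  have tA : normF (A * T - T * pauliTable 0 0) ≤ 16 * κ := by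
    rw [hT, intertwiner_left hA.2 bX1.2 r1, sub_self, normF_zero]; positivity
  have tC : normF (C * T - T * pauliTable 0 1) ≤ 16 * κ :=
    hT ▸ (normF_intertwiner_right_le hC bX1 bX2 hMV cCA).trans (by linarith)
  have tB : normF (B * T - T * pauliTable 1 1) ≤ 16 * κ :=
    hT ▸ normF_intertwiner_anti_left_le hA hC bX1 bX2 hMV hVZ1 r2 r4 hBV cBC aBA
  have tD : normF (D * T - T * pauliTable 1 0) ≤ 16 * κ :=
    hT ▸ (normF_intertwiner_anti_right_le hA hC bX1 bX2 hMV hVZ2 r3 r5 hDV cDA aDC).trans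
      (by linarith)
  have tn : normF T ≤ 2 := hT ▸ normF_intertwiner_le hA hC bX1 bX2 hVn
  have hG0 : (Tᴴ * T) (0, 0) (0, 0) = 1 := by
    have h1 := normF_sq_eq_sum V
    rw [hVn, Finset.sum_eq_single (0, 0) (fun q _ hq => by simp [hVz _ q hq]) (by simp)] at h1
    have h2 : ((∑ p, ‖V p (0, 0)‖ ^ 2 : ℝ) : ℂ) = 1 := by
      rw [show ∑ p, ‖V p (0, 0)‖ ^ 2 = 1 by linarith]; norm_num
    rw [Matrix.mul_apply, ← h2, Complex.ofReal_sum]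
    refine Finset.sum_congr rfl fun p _ => ?_
    rw [Matrix.conjTranspose_apply, T0, ← starRingEnd_apply, ← Complex.normSq_eq_conj_mul_self,
      Complex.normSq_eq_norm_sq]
  -- Here `128 = 8 * 16`, so `Tᴴ * T` is within `1024 * κ` of the identity. Twice this is below 1,
  -- as the polar decomposition needs.
  have hG := normF_sub_one_le_of_conj_pauliTable (κ := 128 * κ) (by positivity) hG0
    ((normF_conj_gram_sub_le hA bX1 tn tA).trans (by linarith))
    ((normF_conj_gram_sub_le hC bX2 tn tC).trans (by linarith))
    ((normF_conj_gram_sub_le hB bZ1 tn tB).trans (by linarith))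
    ((normF_conj_gram_sub_le hD bZ2 tn tD).trans (by linarith))
  obtain ⟨R, -, -, hU, hn⟩ := exists_polar (T := T) (by rw [sqrt_card_twoQubit]; linarith)
  have fin : ∀ M S : Matrix TwoQubit TwoQubit ℂ, IsBinaryObservable M → IsBinaryObservable S →
      normF (M * T - T * S) ≤ 16 * κ → normF (M * (T * R) - T * R * S) ≤ 2100 * κ := by
    intro M S hM hS h
    have e : M * (T * R) - T * R * S = (M * T - T * S) - M * (T - T * R) + (T - T * R) * S := by
      noncomm_ring
    have h1 := normF_add_le ((M * T - T * S) - M * (T - T * R)) ((T - T * R) * S)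
    have h2 := normF_sub_le (M * T - T * S) (M * (T - T * R))
    rw [normF_mul_unitary hS.mul_conjTranspose_self] at h1
    rw [normF_unitary_mul hM.conjTranspose_mul_self] at h2
    rw [e]
    linarith
  exact ⟨T * R, hU, fin _ _ hA bX1 tA, fin _ _ hB bZ1 tB, fin _ _ hC bX2 tC, fin _ _ hD bZ2 tD⟩

/-- Approximate solutions of the magic square relations on `ℂ⁴` are close to a unitary conjugate of
the Pauli table. -/
theorem exists_unitary_of_magicSquare_relations
    {P : Fin 3 → Fin 3 → Matrix TwoQubit TwoQubit ℂ} (hP : ∀ i j, IsBinaryObservable (P i j))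
    (h0 : ∀ i j, ntr (P i j) = 0) {η : ℝ} (hη : η ≤ 1 / 18000)
    (hrow : ∀ i, normF (P i 0 * P i 1 - P i 2) ≤ η ∧ normF (P i 1 * P i 0 - P i 2) ≤ η)
    (hcol : ∀ j, normF (P 0 j * P 1 j - (if j = 2 then (-1 : ℂ) else 1) • P 2 j) ≤ η ∧
      normF (P 1 j * P 0 j - (if j = 2 then (-1 : ℂ) else 1) • P 2 j) ≤ η) :
    ∃ U ∈ Matrix.unitaryGroup TwoQubit ℂ, ∀ i j,
      normF (U * P i j * Uᴴ - pauliTable i j) ≤ 60000 * η := by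
  set A := P 0 0
  set C := P 0 1
  set D := P 1 0
  set B := P 1 1
  have bA : IsBinaryObservable A := hP 0 0
  have bC : IsBinaryObservable C := hP 0 1
  have bD : IsBinaryObservable D := hP 1 0
  have bB : IsBinaryObservable B := hP 1 1
  have r0 := hrow 0
  have r1 := hrow 1
  have r2 := hrow 2
  have c0 := hcol 0
  have c1 := hcol 1
  have c2 := hcol 2
  simp only [Fin.isValue, if_neg (show ¬((0 : Fin 3) = 2) by decide), one_smul] at c0
  simp only [Fin.isValue, if_neg (show ¬((1 : Fin 3) = 2) by decide), one_smul] at c1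
  simp only [Fin.isValue, if_true, neg_smul, one_smul, sub_neg_eq_add] at c2
  have comm : ∀ X Y Z : Matrix TwoQubit TwoQubit ℂ, normF (X * Y - Z) ≤ η →
      normF (Y * X - Z) ≤ η → normF (X * Y - Y * X) ≤ 6 * η := by
    intro X Y Z h1 h2
    have := normF_triangle (X * Y) Z (Y * X)
    rw [normF_sub_comm Z] at this
    have := normF_nonneg (X * Y - Z)
    linarith
  have six : ∀ X₁ X₂ X₃ X₄ X₅ X₆ : Matrix TwoQubit TwoQubit ℂ, normF X₁ ≤ η → normF X₂ ≤ η →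
      normF X₃ ≤ η → normF X₄ ≤ η → normF X₅ ≤ η → normF X₆ ≤ η →
      normF (X₁ + X₂ + X₃ + X₄ + X₅ + X₆) ≤ 6 * η := by
    intro X₁ X₂ X₃ X₄ X₅ X₆ h1 h2 h3 h4 h5 h6
    have m1 := normF_add_le (X₁ + X₂ + X₃ + X₄ + X₅) X₆
    have m2 := normF_add_le (X₁ + X₂ + X₃ + X₄) X₅
    have m3 := normF_add_le (X₁ + X₂ + X₃) X₄
    have m4 := normF_add_le (X₁ + X₂) X₃
    have m5 := normF_add_le X₁ X₂
    linarith
  have ul : ∀ {X : Matrix TwoQubit TwoQubit ℂ} (_ : IsBinaryObservable X)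
      (M : Matrix TwoQubit TwoQubit ℂ), normF (X * M) = normF M :=
    fun h => normF_unitary_mul h.conjTranspose_mul_self
  have ur : ∀ {X : Matrix TwoQubit TwoQubit ℂ} (_ : IsBinaryObservable X)
      (M : Matrix TwoQubit TwoQubit ℂ), normF (M * X) = normF M :=
    fun h => normF_mul_unitary h.mul_conjTranspose_self
  -- The Mermin–Peres parity argument: `A * C * D * B` is multiplied along rows 0 and 1 and then
  -- column 2, giving `-P 2 2`; `A * D * C * B` along columns 0 and 1 and then row 2, giving `P 2
  -- 2`.
  have aDC : normF (D * C + C * D) ≤ 6 * η := by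
    have e : A * (D * C + C * D) * B = (A * C - P 0 2) * D * B + P 0 2 * (D * B - P 1 2) +
        (P 0 2 * P 1 2 + P 2 2) + (A * D - P 2 0) * C * B + P 2 0 * (C * B - P 2 1) +
        (P 2 0 * P 2 1 - P 2 2) := by noncomm_ring
    rw [← ul bA, ← ur bB, e]
    refine six _ _ _ _ _ _ ?_ ?_ c2.1 ?_ ?_ r2.1
    · rw [ur bB, ur bD]; exact r0.1
    · rw [ul (hP 0 2)]; exact r1.1
    · rw [ur bB, ur bC]; exact c0.1
    · rw [ul (hP 2 0)]; exact c1.1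
  have aBA : normF (B * A + A * B) ≤ 6 * η := by
    have e : C * (B * A + A * B) * D = (C * A - P 0 2) * B * D + P 0 2 * (B * D - P 1 2) +
        (P 0 2 * P 1 2 + P 2 2) + (C * B - P 2 1) * A * D + P 2 1 * (A * D - P 2 0) +
        (P 2 1 * P 2 0 - P 2 2) := by noncomm_ring
    rw [← ul bC, ← ur bD, e]
    refine six _ _ _ _ _ _ ?_ ?_ c2.1 ?_ ?_ r2.2
    · rw [ur bD, ur bB]; exact r0.2
    · rw [ul (hP 0 2)]; exact r1.2
    · rw [ur bD, ur bA]; exact c1.1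
    · rw [ul (hP 2 1)]; exact c0.1
  -- `D * B` is close to the traceless `P 1 2`.
  have hDB : ‖ntr (D * B)‖ ≤ 1 / 4 := by
    have := norm_ntr_le (D * B - P 1 2)
    rw [ntr_sub, h0, sub_zero] at this
    linarith [r1.1]
  obtain ⟨U, hU, hUA, hUB, hUC, hUD⟩ := exists_unitary_of_pauli_relations bA bB bC bD (h0 1 1)
    (h0 1 0) (κ := 6 * η) (by linarith) hDB (comm _ _ _ r1.2 r1.1) (comm _ _ _ r0.2 r0.1)
    (comm _ _ _ c1.2 c1.1) (comm _ _ _ c0.2 c0.1) aBA aDC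
  have hη0 : 0 ≤ η := (normF_nonneg _).trans r0.1
  have prod : ∀ {M N S R : Matrix TwoQubit TwoQubit ℂ} {x y : ℝ}, IsBinaryObservable M →
      IsBinaryObservable R → normF (M * U - U * S) ≤ x → normF (N * U - U * R) ≤ y →
      normF (M * N * U - U * (S * R)) ≤ x + y := by
    intro M N S R x y hM hR h1 h2
    have e : M * N * U - U * (S * R) = M * (N * U - U * R) + (M * U - U * S) * R := by
      noncomm_ring
    rw [e]
    refine (normF_add_le _ _).trans ?_
    rw [ul hM, ur hR]
    linarith
  have hU' : U * Uᴴ = 1 := mul_eq_one_comm.1 hU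
  have near : ∀ {M N S : Matrix TwoQubit TwoQubit ℂ} {x : ℝ}, normF (N - M) ≤ η →
      normF (N * U - U * S) ≤ x → normF (M * U - U * S) ≤ η + x := by
    intro M N S x h1 h2
    have := normF_triangle (M * U) (N * U) (U * S)
    rw [← Matrix.sub_mul, normF_mul_unitary hU', normF_sub_comm M] at this
    linarith
  have b := fun i j => pauliTable_isBinaryObservable i j
  have h02 := near r0.1 (pauliTable_row_zero ▸ prod bA (b 0 1) hUA hUC)
  have h12 := near r1.1 (pauliTable_row_one ▸ prod bD (b 1 1) hUD hUB)
  have h20 := near c0.1 (pauliTable_col_zero ▸ prod bA (b 1 0) hUA hUD)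
  have h21 := near c1.1 (pauliTable_col_one ▸ prod bC (b 1 1) hUC hUB)
  have h22 : normF (P 2 2 * U - U * pauliTable 2 2) ≤ 60000 * η := by
    have h := prod (hP 0 2) (b 1 2) h02 h12
    rw [← normF_neg] at h
    have h3 : normF (-(P 0 2 * P 1 2) - P 2 2) ≤ η := by
      rw [← normF_neg, neg_sub, sub_neg_eq_add, add_comm]; exact c2.1
    refine (near h3 (S := pauliTable 2 2) (x := 59000 * η) ?_).trans (by linarith)
    rw [pauliTable_col_two]
    refine le_trans (le_of_eq ?_) (h.trans (by linarith))
    congr 1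
    rw [Matrix.neg_mul, Matrix.mul_neg]
    abel
  have all : ∀ i j, normF (P i j * U - U * pauliTable i j) ≤ 60000 * η := by
    intro i j
    fin_cases i <;> fin_cases j
    exacts [hUA.trans (by linarith), hUC.trans (by linarith), h02.trans (by linarith),
      hUD.trans (by linarith), hUB.trans (by linarith), h12.trans (by linarith),
      h20.trans (by linarith), h21.trans (by linarith), h22]
  -- The unitary found above carries the Pauli table to `P`, so the statement needs its adjoint.
  refine ⟨Uᴴ, ?_, fun i j => ?_⟩
  · rw [Matrix.mem_unitaryGroup_iff, Matrix.star_eq_conjTranspose, Matrix.conjTranspose_conjTranspose,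
      hU]
  · have e : Uᴴ * P i j * Uᴴᴴ - pauliTable i j = Uᴴ * (P i j * U - U * pauliTable i j) := by
      rw [Matrix.conjTranspose_conjTranspose, Matrix.mul_sub, ← Matrix.mul_assoc Uᴴ U, hU,
        Matrix.one_mul, Matrix.mul_assoc]
    rw [e, normF_unitary_mul (by rw [Matrix.conjTranspose_conjTranspose, hU'])]
    exact all i j

end Rigidity

/-! ### Concentration of the frequencies in the trace test -/

/-- Keeping the linear term alone makes it vanish for centered variables, giving a moment generating
function bounded by `exp (r ^ 2)` for every real `r`. -/
theorem exp_le_add_exp_sq (x : ℝ) : Real.exp x ≤ x + Real.exp (x ^ 2) := by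
  have h2 := Real.add_one_le_exp (x ^ 2)
  rcases le_or_gt |x| 1 with h | h
  · have h1 := Real.abs_exp_sub_one_sub_id_le h
    linarith [le_abs_self (Real.exp x - 1 - x)]
  · rcases lt_abs.1 h with h | h
    · have : Real.exp x ≤ Real.exp (x ^ 2) := Real.exp_le_exp.2 (by nlinarith)
      linarith
    · have : Real.exp x ≤ 1 := Real.exp_le_one_iff.2 (by linarith)
      nlinarith

theorem bernoulli_mgf_le {q : ℝ} (h0 : 0 ≤ q) (h1 : q ≤ 1) (r : ℝ) :
    q * Real.exp (r * (1 - q) - r ^ 2) + (1 - q) * Real.exp (r * (0 - q) - r ^ 2) ≤ 1 := by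
  have h : ∀ x : ℝ, |x| ≤ 1 →
      Real.exp (r * x - r ^ 2) ≤ r * x * Real.exp (-r ^ 2) + 1 := by
    intro x hx
    have hx2 : x ^ 2 ≤ 1 := (sq_le_one_iff_abs_le_one x).2 hx
    rw [sub_eq_add_neg]
    have e := mul_le_mul_of_nonneg_right (exp_le_add_exp_sq (r * x)) (Real.exp_pos (-r ^ 2)).le
    rw [add_mul, ← Real.exp_add, ← Real.exp_add] at e
    have : Real.exp ((r * x) ^ 2 + -r ^ 2) ≤ 1 := Real.exp_le_one_iff.2 (by nlinarith [sq_nonneg r])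
    linarith
  have a := mul_le_mul_of_nonneg_left (h (1 - q) (abs_le.2 ⟨by linarith, by linarith⟩)) h0
  have b := mul_le_mul_of_nonneg_left (h (0 - q) (abs_le.2 ⟨by linarith, by linarith⟩))
    (sub_nonneg.2 h1)
  linarith

section Supermartingale
variable {α Q : Type} [MeasurableSpace α] [DiscreteMeasurableSpace α] [DecidableEq Q]

/-- The sum of `f` over the first `t` among the first `N` entries of `ω` that are mapped to `v`. -/
noncomputable def stoppedSum (t : ℕ) (g : α → Q) (v : Q) (f : α → ℝ) (N : ℕ) (ω : ℕ → α) : ℝ :=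
  ∑ k ∈ Finset.range N,
    if g (ω k) = v ∧ Nat.count (fun m => g (ω m) = v) k < t then f (ω k) else 0

variable (t : ℕ) (g : α → Q) (v : Q) (f : α → ℝ)

theorem stoppedSum_succ (N : ℕ) (ω : ℕ → α) :
    stoppedSum t g v f (N + 1) ω = stoppedSum t g v f N ω +
      if g (ω N) = v ∧ Nat.count (fun m => g (ω m) = v) N < t then f (ω N) else 0 :=
  Finset.sum_range_succ _ _

theorem measurable_count (k : ℕ) :
    Measurable fun ω : ℕ → α => Nat.count (fun m => g (ω m) = v) k := by
  induction k with
  | zero => simp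
  | succ k ih =>
    simp only [Nat.count_succ]
    refine ih.add ?_
    exact (measurable_of_countable (fun b : ℕ => b)).comp
      ((Measurable.of_discrete (f := fun a : α => if g a = v then 1 else 0)).comp
        (measurable_pi_apply k))

theorem measurable_stoppedSum (N : ℕ) : Measurable (stoppedSum t g v f N) := by
  refine Finset.measurable_sum _ fun k _ => Measurable.ite ?_ ?_ measurable_const
  · refine MeasurableSet.inter ?_ (measurable_count g v k measurableSet_Iio)
    exact measurable_pi_apply (X := fun _ : ℕ => α) k
      (MeasurableSet.of_discrete (s := {a : α | g a = v}))
  · exact Measurable.of_discrete.comp (measurable_pi_apply k)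

theorem stoppedSum_congr {N : ℕ} {ω ω' : ℕ → α} (h : ∀ k < N, ω k = ω' k) :
    stoppedSum t g v f N ω = stoppedSum t g v f N ω' := by
  refine Finset.sum_congr rfl fun k hk => ?_
  have hk := Finset.mem_range.1 hk
  have hc : Nat.count (fun m => g (ω m) = v) k = Nat.count (fun m => g (ω' m) = v) k := by
    rw [Nat.count_eq_card_filter_range, Nat.count_eq_card_filter_range]
    congr 1
    refine Finset.filter_congr fun m hm => ?_
    rw [h m ((Finset.mem_range.1 hm).trans hk)]
  rw [h k hk, hc]

theorem stoppedSum_one_eq_min (N : ℕ) (ω : ℕ → α) :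
    stoppedSum t g v (fun _ => 1) N ω = (min (Nat.count (fun m => g (ω m) = v) N) t : ℕ) := by
  induction N with
  | zero => simp [stoppedSum]
  | succ N ih =>
    rw [stoppedSum_succ, ih, Nat.count_succ]
    by_cases h1 : g (ω N) = v <;> by_cases h2 : Nat.count (fun m => g (ω m) = v) N < t
    · rw [if_pos ⟨h1, h2⟩, if_pos h1, min_eq_left h2.le, min_eq_left h2]
      push_cast; ring
    · rw [if_neg (fun h => h2 h.2), if_pos h1, min_eq_right (by omega), min_eq_right (by omega)]
      ring
    · rw [if_neg (fun h => h1 h.1), if_neg h1]; simp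
    · rw [if_neg (fun h => h1 h.1), if_neg h1]; simp

variable {t g v f}

/-- Supermartingale property: whether round `N` is counted depends on earlier rounds and on its own
question only, and a fresh independent round multiplies the exponential by a factor of mean at most
one. -/
theorem lintegral_exp_stoppedSum_le_one (ν : Measure α) [IsProbabilityMeasure ν] [Nonempty α]
    (hf : ∫⁻ a, (if g a = v then ENNReal.ofReal (Real.exp (f a)) else 1) ∂ν ≤ 1) (N : ℕ) :
    ∫⁻ ω, ENNReal.ofReal (Real.exp (stoppedSum t g v f N ω)) ∂(Measure.infinitePi fun _ : ℕ => ν)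
      ≤ 1 := by
  set μ := Measure.infinitePi fun _ : ℕ => ν with hμ
  induction N with
  | zero => simp [stoppedSum]
  | succ N ih =>
    set Z : (ℕ → α) → ENNReal := fun ω => ENNReal.ofReal (Real.exp (stoppedSum t g v f N ω)) with hZ
    have hZm : Measurable Z :=
      ENNReal.measurable_ofReal.comp (Real.measurable_exp.comp (measurable_stoppedSum t g v f N))
    set A : Set (ℕ → α) := {ω | Nat.count (fun m => g (ω m) = v) N < t} with hA
    have hAm : MeasurableSet A := measurable_count g v N measurableSet_Iio
    set F : α → ENNReal := fun a => if g a = v then ENNReal.ofReal (Real.exp (f a)) else 1 with hF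
    have step : ∀ ω, ENNReal.ofReal (Real.exp (stoppedSum t g v f (N + 1) ω)) =
        Aᶜ.indicator Z ω + A.indicator Z ω * F (ω N) := by
      intro ω
      rw [stoppedSum_succ]
      by_cases h2 : ω ∈ A
      · have h2' : Nat.count (fun m => g (ω m) = v) N < t := h2
        rw [Set.indicator_of_notMem (by simpa using h2), Set.indicator_of_mem h2, zero_add]
        by_cases h1 : g (ω N) = v
        · simp only [hF, hZ, if_pos h1, if_pos (And.intro h1 h2')]
          rw [Real.exp_add, ENNReal.ofReal_mul (Real.exp_pos _).le]
        · simp only [hF, hZ, if_neg h1, h1, false_and, if_false, add_zero, mul_one]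
      · have h2' : ¬ Nat.count (fun m => g (ω m) = v) N < t := h2
        rw [Set.indicator_of_mem (by simpa using h2), Set.indicator_of_notMem h2, zero_mul,
          if_neg (fun h => h2' h.2), add_zero, add_zero]
    have hind : ProbabilityTheory.IndepFun (A.indicator Z) (fun ω => F (ω N)) μ := by
      have h0 : ProbabilityTheory.iIndepFun (fun (k : ℕ) (ω : ℕ → α) => ω k) μ :=
        ProbabilityTheory.iIndepFun_infinitePi (X := fun _ a => a) (fun _ => measurable_id)
      have h1 := h0.indepFun_finset (Finset.range N) {N} (by simp)
        (fun k => measurable_pi_apply k)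
      -- A partial sequence is completed by an arbitrary value; the sum and the count up to `N` read
      -- only the first `N` coordinates, so they factor through the restriction.
      let ext : (Finset.range N → α) → (ℕ → α) := fun x k =>
        if h : k ∈ Finset.range N then x ⟨k, h⟩ else Classical.arbitrary α
      have hext : Measurable ext := by
        refine measurable_pi_iff.2 fun k => ?_
        by_cases h : k ∈ Finset.range N
        · simp only [ext, dif_pos h]; exact measurable_pi_apply _
        · simp only [ext, dif_neg h]; exact measurable_const
      have h2 := h1.comp (φ := fun x => A.indicator Z (ext x))
        (ψ := fun x => F (x ⟨N, Finset.mem_singleton_self N⟩))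
        ((hZm.indicator hAm).comp hext) (by exact (Measurable.of_discrete (f := F)).comp (measurable_pi_apply (X := fun _ : ({N} : Finset ℕ) => α) _))
      convert h2 using 1
      swap
      · rfl
      ext1 ω
      have hag : ∀ k < N, ext (fun i : Finset.range N => ω i) k = ω k := fun k hk => by
        simp only [ext, dif_pos (Finset.mem_range.2 hk)]
      have hc := stoppedSum_congr t g v f hag
      have hc1 : Nat.count (fun m => g (ext (fun i : Finset.range N => ω i) m) = v) N =
          Nat.count (fun m => g (ω m) = v) N := by
        rw [Nat.count_eq_card_filter_range, Nat.count_eq_card_filter_range]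
        congr 1
        refine Finset.filter_congr fun m hm => ?_
        rw [hag m (Finset.mem_range.1 hm)]
      have hmem : ext (fun i : Finset.range N => ω i) ∈ A ↔ ω ∈ A := by
        simp only [hA, Set.mem_ofPred_eq, hc1]
      show A.indicator Z ω = A.indicator Z (ext fun i : Finset.range N => ω i)
      by_cases h : ω ∈ A
      · rw [Set.indicator_of_mem h, Set.indicator_of_mem (hmem.2 h)]
        simp only [hZ, hc]
      · rw [Set.indicator_of_notMem h, Set.indicator_of_notMem (fun h' => h (hmem.1 h'))]
    have hFm : Measurable fun ω : ℕ → α => F (ω N) :=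
      (Measurable.of_discrete (f := F)).comp (measurable_pi_apply N)
    have hFint : ∫⁻ ω, F (ω N) ∂μ ≤ 1 := by
      have := (measurePreserving_eval_infinitePi (fun _ : ℕ => ν) N).lintegral_comp
        (f := F) Measurable.of_discrete
      exact this.trans_le hf
    simp only [step]
    rw [lintegral_add_left (hZm.indicator hAm.compl)]
    have := ProbabilityTheory.lintegral_mul_eq_lintegral_mul_lintegral_of_indepFun
      (hZm.indicator hAm) hFm hind
    simp only [Pi.mul_apply] at this
    rw [this]
    calc _ ≤ ∫⁻ ω, Aᶜ.indicator Z ω ∂μ + (∫⁻ ω, A.indicator Z ω ∂μ) * 1 := by gcongr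
      _ = ∫⁻ ω, Z ω ∂μ := by
          rw [mul_one, ← lintegral_add_left (hZm.indicator hAm.compl)]
          congr 1
          ext1 ω
          rw [add_comm]
          exact Set.indicator_self_add_compl_apply A Z ω
      _ ≤ 1 := ih

/-- If the sums over the first `t` occurrences of `v` exceed `log K` on an event, then the event
has probability at most `1 / K`. -/
theorem measure_le_of_stoppedSum (ν : Measure α) [IsProbabilityMeasure ν] [Nonempty α]
    (hf : ∫⁻ a, (if g a = v then ENNReal.ofReal (Real.exp (f a)) else 1) ∂ν ≤ 1)
    {E : Set (ℕ → α)} {b : ℝ}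
    (hE : ∀ ω ∈ E, ∃ N, ∀ M, N ≤ M → b ≤ stoppedSum t g v f M ω) :
    (Measure.infinitePi fun _ : ℕ => ν).real E ≤ Real.exp (-b) := by
  set μ := Measure.infinitePi fun _ : ℕ => ν with hμ
  -- Markov's inequality at a fixed time bounds each `B N`; these sets increase and cover `E`, so
  -- the bound passes to the limit without measurability of `E`.
  set B : ℕ → Set (ℕ → α) := fun N => {ω | ∀ M, N ≤ M → b ≤ stoppedSum t g v f M ω} with hB
  have hmono : Monotone B := fun N N' h ω hω M hM => hω M (h.trans hM)
  have hsub : E ⊆ ⋃ N, B N := fun ω hω => Set.mem_iUnion.2 (hE ω hω)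
  have hBN : ∀ N, μ (B N) ≤ ENNReal.ofReal (Real.exp (-b)) := by
    intro N
    have hm : Measurable fun ω => ENNReal.ofReal (Real.exp (stoppedSum t g v f N ω)) :=
      ENNReal.measurable_ofReal.comp (Real.measurable_exp.comp (measurable_stoppedSum t g v f N))
    have h1 := mul_meas_ge_le_lintegral hm (μ := μ) (ENNReal.ofReal (Real.exp b))
    have h2 : B N ⊆ {ω | ENNReal.ofReal (Real.exp b) ≤
        ENNReal.ofReal (Real.exp (stoppedSum t g v f N ω))} := fun ω hω =>
      ENNReal.ofReal_le_ofReal (Real.exp_le_exp.2 (hω N le_rfl))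
    have h3 := (mul_le_mul_right (measure_mono h2 (μ := μ)) (ENNReal.ofReal (Real.exp b))).trans
      (h1.trans (lintegral_exp_stoppedSum_le_one ν hf N))
    rw [Real.exp_neg, ENNReal.ofReal_inv_of_pos (Real.exp_pos b)]
    rw [ENNReal.le_inv_iff_mul_le, mul_comm]
    exact h3
  have hfin : μ E ≤ ENNReal.ofReal (Real.exp (-b)) := by
    refine (measure_mono hsub).trans ?_
    rw [hmono.measure_iUnion]
    exact iSup_le hBN
  exact ENNReal.toReal_le_of_le_ofReal (Real.exp_pos _).le hfin

/-- After `t` occurrences no later round is counted, so the set over all rounds defining the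
frequency already lies below `M`. -/
theorem stoppedSum_indicator_eq_empFreq (t : ℕ) (g : α → Q) (v : Q) (c : α → ℤˣ) (ht : 0 < t)
    {M : ℕ} {ω : ℕ → α} (hM : t ≤ Nat.count (fun m => g (ω m) = v) M) :
    stoppedSum t g v (fun a => if c a = 1 then 1 else 0) M ω =
      t * empFreq t (fun k => g (ω k)) v (fun k => c (ω k)) := by
  have hset : {k : ℕ | g (ω k) = v ∧ Nat.count (fun m => g (ω m) = v) k < t ∧ c (ω k) = 1} =
      ((Finset.range M).filter fun k =>
        (g (ω k) = v ∧ Nat.count (fun m => g (ω m) = v) k < t) ∧ c (ω k) = 1 : Finset ℕ) := by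
    ext k
    simp only [Set.mem_ofPred_eq, Finset.coe_filter, Finset.mem_range, and_assoc]
    refine ⟨fun h => ⟨?_, h⟩, fun h => h.2⟩
    by_contra! hk
    have := Nat.count_monotone (fun m => g (ω m) = v) hk
    have h2 := h.2.1
    omega
  have ht' : (t : ℝ) ≠ 0 := by positivity
  rw [empFreq, hset, Set.ncard_coe_finset, Finset.card_filter, mul_div_cancel₀ _ ht', stoppedSum]
  push_cast
  refine Finset.sum_congr rfl fun k _ => ?_
  simp only [ite_and]

/-- If the frequency of the value `1` over the first `t` occurrences of `v` is within `δ` of `1/2`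
with probability at least `p`, then the underlying bias is within `3δ` of `1/2`. -/
theorem abs_bias_sub_half_le (ν : Measure α) [IsProbabilityMeasure ν] [Nonempty α] {t : ℕ}
    {g : α → Q} {v : Q} {c : α → ℤˣ} {q δ p : ℝ}
    (hf : ∀ r : ℝ, ∫⁻ a, (if g a = v then
      ENNReal.ofReal (Real.exp (r * ((if c a = 1 then 1 else 0) - q) - r ^ 2)) else 1) ∂ν ≤ 1)
    (ht : 0 < t) (hp : 0 < p) (hp1 : p ≤ 1) (hδ : δ = Real.sqrt (2 * Real.log (2 / p) / t))
    {E : Set (ℕ → α)}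
    (hE : ∀ ω ∈ E, (∃ N, t ≤ Nat.count (fun m => g (ω m) = v) N) ∧
      |empFreq t (fun k => g (ω k)) v (fun k => c (ω k)) - 1 / 2| ≤ δ)
    (hpE : p ≤ (Measure.infinitePi fun _ : ℕ => ν).real E) : |q - 1 / 2| ≤ 3 * δ := by
  have ht' : (0 : ℝ) < t := by positivity
  have hlog : 0 ≤ Real.log (2 / p) := Real.log_nonneg (by rw [le_div_iff₀ hp]; linarith)
  have hδ0 : 0 ≤ δ := hδ ▸ Real.sqrt_nonneg _
  have hδ2 : t * δ ^ 2 = 2 * Real.log (2 / p) := by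
    rw [hδ, Real.sq_sqrt (by positivity)]
    field_simp
  have hsum : ∀ (r : ℝ) (M : ℕ) (ω : ℕ → α), t ≤ Nat.count (fun m => g (ω m) = v) M →
      stoppedSum t g v (fun a => r * ((if c a = 1 then 1 else 0) - q) - r ^ 2) M ω =
        t * (r * (empFreq t (fun k => g (ω k)) v (fun k => c (ω k)) - q) - r ^ 2) := by
    intro r M ω hM
    have h1 := stoppedSum_indicator_eq_empFreq t g v c ht hM
    have h2 := stoppedSum_one_eq_min t g v M ω
    rw [min_eq_right hM] at h2
    have h3 : stoppedSum t g v (fun a => r * ((if c a = 1 then 1 else 0) - q) - r ^ 2) M ω =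
        r * stoppedSum t g v (fun a => if c a = 1 then 1 else 0) M ω -
          (r * q + r ^ 2) * stoppedSum t g v (fun _ => 1) M ω := by
      simp only [stoppedSum, Finset.mul_sum, ← Finset.sum_sub_distrib]
      refine Finset.sum_congr rfl fun k _ => ?_
      split_ifs <;> ring
    rw [h3, h1, h2]
    ring
  -- With `r = ±δ`, a bias off by more than `3 * δ` makes the exponent at least `t * δ ^ 2 = 2 * log
  -- (2 / p)` on `E`. Then `E` has probability at most `(p / 2) ^ 2 < p`.
  have contra : ∀ r : ℝ, r ^ 2 = δ ^ 2 →
      (∀ x : ℝ, |x - 1 / 2| ≤ δ → 2 * δ ^ 2 ≤ r * (x - q)) → False := by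
    intro r hr hx
    have h := measure_le_of_stoppedSum (b := 2 * Real.log (2 / p)) (t := t) ν (hf r) (E := E) (by
      intro ω hω
      obtain ⟨⟨N, hN⟩, hfr⟩ := hE ω hω
      refine ⟨N, fun M hM => ?_⟩
      rw [hsum r M ω (hN.trans (Nat.count_monotone _ hM)), hr, ← hδ2]
      have := hx _ hfr
      refine mul_le_mul_of_nonneg_left ?_ ht'.le
      linarith)
    have h2 : Real.exp (-(2 * Real.log (2 / p))) = (p / 2) ^ 2 := by
      rw [show -(2 * Real.log (2 / p)) = Real.log (p / 2) + Real.log (p / 2) by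
        rw [← inv_div, Real.log_inv]; ring, Real.exp_add, Real.exp_log (by positivity)]
      ring
    rw [h2] at h
    nlinarith
  rw [abs_le]
  constructor
  · by_contra! h
    refine contra δ rfl fun x hx => ?_
    have := (abs_le.1 hx).1
    nlinarith
  · by_contra! h
    refine contra (-δ) (by ring) fun x hx => ?_
    have := (abs_le.1 hx).2
    nlinarith

end Supermartingale

/-! ### Observables of a POVM -/

section PovmOp
variable {O H : Type} [Fintype O] [DecidableEq O] [Fintype H] [DecidableEq H]

/-- The observable of the POVM `E` with the value `f o` for the outcome `o`. -/
noncomputable def povmOp (E : POVM O H) (f : O → ℝ) : Matrix H H ℂ := ∑ o, (f o : ℂ) • E.elem o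

theorem povmOp_isHermitian (E : POVM O H) (f : O → ℝ) : (povmOp E f).IsHermitian := by
  rw [Matrix.IsHermitian, povmOp, Matrix.conjTranspose_sum]
  refine Finset.sum_congr rfl fun o _ => ?_
  rw [Matrix.conjTranspose_smul, (E.posSemidef o).1.eq, Complex.star_def, Complex.conj_ofReal]

theorem povmOp_one (E : POVM O H) : povmOp E (fun _ => 1) = 1 := by
  rw [povmOp, ← E.sum_eq_one]
  simp

theorem povmOp_add_smul (E : POVM O H) (f g : O → ℝ) (c : ℝ) :
    povmOp E (fun o => f o + c * g o) = povmOp E f + (c : ℂ) • povmOp E g := by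
  simp only [povmOp, Finset.smul_sum, ← Finset.sum_add_distrib, smul_smul, ← add_smul]
  push_cast
  rfl

theorem povmOp_posSemidef (E : POVM O H) {f : O → ℝ} (hf : ∀ o, 0 ≤ f o) :
    (povmOp E f).PosSemidef :=
  Matrix.posSemidef_sum _ fun o _ => (E.posSemidef o).smul (by exact_mod_cast hf o)

/-- In the dilation, `1 - P * P` splits into the Gram matrix of `J * D - D * P`, measuring how far
the POVM is from projective, and the observable of `1 - f ^ 2`. -/
theorem one_sub_povmOp_sq_posSemidef (E : POVM O H) {f : O → ℝ} (hf : ∀ o, |f o| ≤ 1) :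
    (1 - povmOp E f * povmOp E f).PosSemidef := by
  obtain ⟨D, hD⟩ := E.exists_dilation
  set P := povmOp E f with hP
  set J : Matrix (O × H) (O × H) ℂ := Matrix.diagonal fun q => (f q.1 : ℂ) with hJ
  have hPH : Pᴴ = P := povmOp_isHermitian E f
  have h1 : Dᴴ * D = 1 := by
    have := hD fun _ => 1
    rw [Matrix.diagonal_one, Matrix.mul_one] at this
    rw [this, ← povmOp_one E, povmOp]
    simp
  have h2 : Dᴴ * J * D = P := hD fun o => (f o : ℂ)
  have hJH : Jᴴ = J := by
    rw [hJ, Matrix.diagonal_conjTranspose]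
    congr 1
    ext q
    simp
  have h3 : Dᴴ * (J * J) * D = povmOp E fun o => f o ^ 2 := by
    rw [hJ, Matrix.diagonal_mul_diagonal, povmOp]
    simp only [sq, Complex.ofReal_mul]
    exact hD fun o => (f o : ℂ) * f o
  have h4 : (povmOp E fun o => 1 - f o ^ 2) = 1 - Dᴴ * (J * J) * D := by
    have := povmOp_add_smul E (fun _ => 1) (fun o => f o ^ 2) (-1)
    rw [← h3, povmOp_one] at this
    simp only [neg_mul, one_mul, ← sub_eq_add_neg] at this
    rw [this]
    push_cast
    rw [neg_smul, one_smul, sub_eq_add_neg]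
  have e : 1 - P * P = (J * D - D * P)ᴴ * (J * D - D * P) + povmOp E fun o => 1 - f o ^ 2 := by
    rw [h4, Matrix.conjTranspose_sub, Matrix.conjTranspose_mul, Matrix.conjTranspose_mul, hJH, hPH,
      Matrix.mul_sub, Matrix.sub_mul, Matrix.sub_mul]
    have e1 : Dᴴ * J * (J * D) = Dᴴ * (J * J) * D := by simp only [Matrix.mul_assoc]
    have e2 : P * Dᴴ * (J * D) = P * P := by
      rw [Matrix.mul_assoc, ← Matrix.mul_assoc Dᴴ, h2]
    have e3 : Dᴴ * J * (D * P) = P * P := by rw [← Matrix.mul_assoc, h2]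
    have e4 : P * Dᴴ * (D * P) = P * P := by
      rw [Matrix.mul_assoc, ← Matrix.mul_assoc Dᴴ, h1, Matrix.one_mul]
    rw [e1, e2, e3, e4]
    abel
  rw [e]
  refine (Matrix.posSemidef_conjTranspose_mul_self _).add (povmOp_posSemidef E fun o => ?_)
  have := (sq_le_one_iff_abs_le_one _).2 (hf o)
  linarith

open scoped Matrix.Norms.Frobenius in
/-- If the observables of a POVM with values `f₁, f₂, f₃` are close to unitary observables
`N₁, N₂, N₃` and the product of the three values is almost always `s`, then `N₁ N₂ N₃ ≈ s`. -/
theorem normF_mul_mul_sub_le [Nonempty H] (E : POVM O H) {f₁ f₂ f₃ : O → ℝ}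
    {N₁ N₂ N₃ : Matrix H H ℂ}
    (hf₁ : ∀ o, f₁ o ^ 2 = 1) (hf₂ : ∀ o, f₂ o ^ 2 = 1) (hf₃ : ∀ o, f₃ o ^ 2 = 1)
    (hN₁ : IsBinaryObservable N₁) (hN₂ : IsBinaryObservable N₂) (hN₃ : IsBinaryObservable N₃)
    {s e b : ℝ} (hs : s ^ 2 = 1) (he : 0 ≤ e) (hb : 0 ≤ b)
    (h₁ : normF (povmOp E f₁ - N₁) ^ 2 + 1 - normF (povmOp E f₁) ^ 2 ≤ e ^ 2)
    (h₂ : normF (povmOp E f₂ - N₂) ^ 2 + 1 - normF (povmOp E f₂) ^ 2 ≤ e ^ 2)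
    (h₃ : normF (povmOp E f₃ - N₃) ^ 2 + 1 - normF (povmOp E f₃) ^ 2 ≤ e ^ 2)
    (hbad : (ntr (povmOp E fun o => if f₁ o * f₂ o * f₃ o = s then 0 else 1)).re ≤ b ^ 2) :
    normF (N₁ * N₂ * N₃ - (s : ℂ) • 1) ≤ 3 * e + 2 * b := by
  obtain ⟨D, hD⟩ := E.exists_dilation
  have hD1 : Dᴴ * D = 1 := by
    have := hD fun _ => 1
    rw [Matrix.diagonal_one, Matrix.mul_one] at this
    rw [this, ← povmOp_one E, povmOp]
    simp
  obtain ⟨J, hJ⟩ : ∃ J : (O → ℝ) → Matrix (O × H) (O × H) ℂ,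
      ∀ f, J f = Matrix.diagonal fun q => (f q.1 : ℂ) := ⟨_, fun _ => rfl⟩
  obtain ⟨d, hd⟩ : ∃ d, d = Real.sqrt (Fintype.card H) := ⟨_, rfl⟩
  have hd0 : 0 < d := by rw [hd]; positivity
  have hd2 : d ^ 2 = Fintype.card H := hd ▸ Real.sq_sqrt (by positivity)
  have hJH : ∀ f, (J f)ᴴ = J f := fun f => by
    rw [hJ, Matrix.diagonal_conjTranspose]
    congr 1
    ext q
    simp
  have hJJ : ∀ f g, J f * J g = J fun o => f o * g o := fun f g => by
    simp only [hJ, Matrix.diagonal_mul_diagonal, Complex.ofReal_mul]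
  have hDJ : ∀ f, Dᴴ * J f * D = povmOp E f := fun f => by
    rw [hJ]
    exact hD fun o => (f o : ℂ)
  have hJ1 : J (fun _ => 1) = 1 := by
    rw [hJ]; simp
  have hJu : ∀ f : O → ℝ, (∀ o, f o ^ 2 = 1) → (J f)ᴴ * J f = 1 := fun f hf => by
    rw [hJH, hJJ, ← hJ1]
    exact congrArg J (funext fun o => by rw [← sq, hf])
  -- The left side of the hypothesis is exactly the normalized square of `‖J f * D - D * N‖`.
  have hclose : ∀ (f : O → ℝ) (N : Matrix H H ℂ), (∀ o, f o ^ 2 = 1) → IsBinaryObservable N →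
      normF (povmOp E f - N) ^ 2 + 1 - normF (povmOp E f) ^ 2 ≤ e ^ 2 →
      ‖J f * D - D * N‖ ≤ e * d := by
    intro f N hf hN h
    refine abs_le_of_sq_le_sq' ?_ (by positivity) |>.2
    set P := povmOp E f with hP
    have hPH : Pᴴ = P := povmOp_isHermitian E f
    have hNH : Nᴴ = N := hN.1
    have x1 : (J f * D - D * N)ᴴ * (J f * D - D * N) = 1 - P * N - N * P + 1 := by
      rw [Matrix.conjTranspose_sub, Matrix.conjTranspose_mul, Matrix.conjTranspose_mul, hNH,
        Matrix.mul_sub, Matrix.sub_mul, Matrix.sub_mul]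
      have e1 : Dᴴ * (J f)ᴴ * (J f * D) = 1 := by
        rw [Matrix.mul_assoc, ← Matrix.mul_assoc (J f)ᴴ, hJu f hf, Matrix.one_mul, hD1]
      have e2 : N * Dᴴ * (J f * D) = N * P := by
        rw [Matrix.mul_assoc, ← Matrix.mul_assoc Dᴴ, hDJ]
      have e3 : Dᴴ * (J f)ᴴ * (D * N) = P * N := by rw [hJH, ← Matrix.mul_assoc, hDJ]
      have e4 : N * Dᴴ * (D * N) = 1 := by
        rw [Matrix.mul_assoc, ← Matrix.mul_assoc Dᴴ, hD1, Matrix.one_mul, hN.2]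
      rw [e1, e2, e3, e4]
      abel
    have x2 : (P - N)ᴴ * (P - N) = P * P - P * N - N * P + 1 := by
      rw [Matrix.conjTranspose_sub, hPH, hNH, Matrix.mul_sub, Matrix.sub_mul, Matrix.sub_mul, hN.2]
      abel
    rw [frobenius_norm_sq, x1]
    rw [normF_sq, normF_sq, hPH, x2] at h
    have h1 := ntr_one (H := H)
    simp only [ntr_add, ntr_sub, Complex.add_re, Complex.sub_re, h1, Complex.one_re] at h
    have h5 : ∀ M : Matrix H H ℂ, M.trace.re = d ^ 2 * (ntr M).re := fun M => by
      rw [ntr, Complex.div_natCast_re, hd2]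
      field_simp
    rw [h5]
    simp only [ntr_add, ntr_sub, Complex.add_re, Complex.sub_re, h1, Complex.one_re]
    rw [mul_pow, mul_comm (e ^ 2)]
    refine mul_le_mul_of_nonneg_left ?_ (by positivity)
    linarith
  have c1 := hclose f₁ N₁ hf₁ hN₁ h₁
  have c2 := hclose f₂ N₂ hf₂ hN₂ h₂
  have c3 := hclose f₃ N₃ hf₃ hN₃ h₃
  -- The product of the three signs differs from `s` by 2 in absolute value on bad outcomes and by 0
  -- on the others.
  have c4 : ‖J (fun o => f₁ o * f₂ o * f₃ o - s) * D‖ ≤ 2 * b * d := by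
    refine abs_le_of_sq_le_sq' ?_ (by positivity) |>.2
    rw [frobenius_norm_sq, Matrix.conjTranspose_mul, hJH, Matrix.mul_assoc,
      ← Matrix.mul_assoc (J _) (J _), hJJ, ← Matrix.mul_assoc, hDJ]
    have e1 : (fun o => (f₁ o * f₂ o * f₃ o - s) * (f₁ o * f₂ o * f₃ o - s)) =
        fun o => 0 + 4 * (if f₁ o * f₂ o * f₃ o = s then 0 else 1) := by
      ext o
      split_ifs with h
      · rw [h]; ring
      · have hx : (f₁ o * f₂ o * f₃ o) ^ 2 = 1 := by
          rw [mul_pow, mul_pow, hf₁, hf₂, hf₃]; norm_num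
        have hx2 : (f₁ o * f₂ o * f₃ o - s) * (f₁ o * f₂ o * f₃ o + s) = 0 := by
          linear_combination hx - hs
        have hx3 : f₁ o * f₂ o * f₃ o + s = 0 :=
          (mul_eq_zero.1 hx2).resolve_left (sub_ne_zero.2 h)
        rw [show f₁ o * f₂ o * f₃ o = -s by linarith]
        linear_combination 4 * hs
    rw [e1, povmOp_add_smul, show povmOp E (fun _ => 0) = 0 by simp [povmOp], zero_add,
      Matrix.trace_smul]
    have h5 : ∀ M : Matrix H H ℂ, M.trace.re = d ^ 2 * (ntr M).re := fun M => by
      rw [ntr, Complex.div_natCast_re, hd2]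
      field_simp
    rw [smul_eq_mul, Complex.re_ofReal_mul, h5]
    nlinarith [sq_nonneg d]
  -- Telescoping: the `N`s are moved one at a time across `D`, becoming diagonal unitaries upstairs.
  have x : D * (N₁ * N₂ * N₃ - (s : ℂ) • 1) = -((J f₁ * D - D * N₁) * N₂ * N₃) -
      J f₁ * ((J f₂ * D - D * N₂) * N₃) - J f₁ * (J f₂ * (J f₃ * D - D * N₃)) +
      J (fun o => f₁ o * f₂ o * f₃ o - s) * D := by
    have hJs : J (fun o => f₁ o * f₂ o * f₃ o - s) = J f₁ * (J f₂ * J f₃) - (s : ℂ) • 1 := by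
      rw [hJJ, hJJ, ← hJ1]
      simp only [hJ]
      ext p q
      by_cases hpq : p = q
      · subst hpq; simp [mul_assoc]
      · simp [hpq]
    rw [hJs]
    simp only [Matrix.mul_sub, Matrix.sub_mul, Matrix.mul_assoc, Matrix.mul_smul, Matrix.smul_mul,
      Matrix.mul_one, Matrix.one_mul]
    abel
  have u1 := hJu f₁ hf₁
  have u2 := hJu f₂ hf₂
  have v2 := hN₂.mul_conjTranspose_self
  have v3 := hN₃.mul_conjTranspose_self
  rw [normF_eq, ← hd, div_le_iff₀ hd0, ← frobenius_mul_of_isometry hD1, x]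
  have n1 : ‖-((J f₁ * D - D * N₁) * N₂ * N₃)‖ ≤ e * d := by
    rw [norm_neg, frobenius_mul_of_coisometry v3, frobenius_mul_of_coisometry v2]
    exact c1
  have n2 : ‖J f₁ * ((J f₂ * D - D * N₂) * N₃)‖ ≤ e * d := by
    rw [frobenius_mul_of_isometry u1, frobenius_mul_of_coisometry v3]
    exact c2
  have n3 : ‖J f₁ * (J f₂ * (J f₃ * D - D * N₃))‖ ≤ e * d := by
    rw [frobenius_mul_of_isometry u1, frobenius_mul_of_isometry u2]
    exact c3
  refine (norm_add_le _ _).trans ?_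
  refine (add_le_add (norm_sub_le _ _) c4).trans ?_
  have := norm_sub_le (-((J f₁ * D - D * N₁) * N₂ * N₃)) (J f₁ * ((J f₂ * D - D * N₂) * N₃))
  linarith

end PovmOp

/-! ### Correlations close to the maximum -/

section NoiseCorr
variable {n : ℕ} {A B : Matrix (Reg n) (Reg n) ℂ} {ρ : ℝ}

/-- Every nonidentity string is damped by at least `ρ`; the arithmetic–geometric mean inequality and
Parseval bound the rest. -/
theorem noiseCorr_le (hA : A.IsHermitian) (hB : B.IsHermitian) (hA1 : normF A ≤ 1)
    (hB1 : normF B ≤ 1) (hρ0 : 0 ≤ ρ) (hρ1 : ρ ≤ 1) :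
    noiseCorr ρ A B ≤ (ntr A).re * (ntr B).re + ρ := by
  rw [noiseCorr, ← Finset.add_sum_erase _ _ (Finset.mem_univ 0), weight_zero, pow_zero, one_mul,
    coef_zero, coef_zero]
  have h : ∀ σ ∈ Finset.univ.erase (0 : Fin n → PauliLabel),
      ρ ^ weight σ * ((coef A σ).re * (coef B σ).re) ≤
        ρ * (((coef A σ).re ^ 2 + (coef B σ).re ^ 2) / 2) := by
    intro σ hσ
    have hw : ρ ^ weight σ ≤ ρ :=
      pow_le_of_le_one hρ0 hρ1 (fun h => Finset.ne_of_mem_erase hσ (weight_eq_zero.1 h))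
    have h0 : 0 ≤ ρ ^ weight σ := by positivity
    calc _ ≤ ρ ^ weight σ * (((coef A σ).re ^ 2 + (coef B σ).re ^ 2) / 2) :=
          mul_le_mul_of_nonneg_left
            (by nlinarith [sq_nonneg ((coef A σ).re - (coef B σ).re)]) h0
      _ ≤ _ := mul_le_mul_of_nonneg_right hw (by positivity)
  have h2 := Finset.sum_le_sum h
  have h3 : ∑ σ ∈ Finset.univ.erase (0 : Fin n → PauliLabel),
      ρ * (((coef A σ).re ^ 2 + (coef B σ).re ^ 2) / 2) ≤
      ∑ σ, ρ * (((coef A σ).re ^ 2 + (coef B σ).re ^ 2) / 2) :=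
    Finset.sum_le_sum_of_subset_of_nonneg (Finset.erase_subset _ _)
      fun _ _ _ => by positivity
  have h4 : ∑ σ, ρ * (((coef A σ).re ^ 2 + (coef B σ).re ^ 2) / 2) =
      ρ * ((normF A ^ 2 + normF B ^ 2) / 2) := by
    rw [normF_sq_eq_sum_coef hA, normF_sq_eq_sum_coef hB, ← Finset.mul_sum, ← Finset.sum_div,
      Finset.sum_add_distrib]
  have h5 : ρ * ((normF A ^ 2 + normF B ^ 2) / 2) ≤ ρ := by
    have := normF_nonneg A
    have := normF_nonneg B
    refine mul_le_of_le_one_right hρ0 ?_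
    nlinarith
  linarith

/-- Using `a * b ≤ (a + b) ^ 2 / 4` on each coefficient pair and then the parallelogram law, any
distance between `A` and `B` shows up as a loss of correlation. -/
theorem normF_sub_sq_le_of_noiseCorr (hA : A.IsHermitian) (hB : B.IsHermitian) (hA1 : normF A ≤ 1)
    (hB1 : normF B ≤ 1) (hρ0 : 0 < ρ) (hρ1 : ρ ≤ 1) {τ K : ℝ} (hAτ : |(ntr A).re| ≤ τ)
    (hBτ : |(ntr B).re| ≤ τ) (hc : ρ - K + τ ^ 2 ≤ noiseCorr ρ A B) :
    normF (A - B) ^ 2 ≤ 4 * K / ρ := by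
  have hsum : noiseCorr ρ A B ≤ τ ^ 2 +
      ∑ σ, ρ * (((coef A σ).re + (coef B σ).re) ^ 2 / 4) := by
    rw [noiseCorr, ← Finset.add_sum_erase _ _ (Finset.mem_univ 0), weight_zero, pow_zero, one_mul,
      coef_zero, coef_zero]
    refine add_le_add ?_ ?_
    · have h1 := abs_mul (ntr A).re (ntr B).re
      have h2 := le_abs_self ((ntr A).re * (ntr B).re)
      have h3 := mul_le_mul hAτ hBτ (abs_nonneg _) ((abs_nonneg _).trans hAτ)
      linarith
    · refine le_trans (Finset.sum_le_sum ?_) (Finset.sum_le_sum_of_subset_of_nonneg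
        (Finset.erase_subset _ _) fun _ _ _ => by positivity)
      intro σ hσ
      have hw : ρ ^ weight σ ≤ ρ :=
        pow_le_of_le_one hρ0.le hρ1 (fun h => Finset.ne_of_mem_erase hσ (weight_eq_zero.1 h))
      have h0 : 0 ≤ ρ ^ weight σ := by positivity
      calc _ ≤ ρ ^ weight σ * (((coef A σ).re + (coef B σ).re) ^ 2 / 4) :=
            mul_le_mul_of_nonneg_left
              (by nlinarith [sq_nonneg ((coef A σ).re - (coef B σ).re)]) h0
        _ ≤ _ := mul_le_mul_of_nonneg_right hw (by positivity)
  have hpar : ∑ σ, ρ * (((coef A σ).re + (coef B σ).re) ^ 2 / 4) =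
      ρ / 4 * (2 * normF A ^ 2 + 2 * normF B ^ 2 - normF (A - B) ^ 2) := by
    rw [normF_sq_eq_sum_coef hA, normF_sq_eq_sum_coef hB, normF_sq_eq_sum_coef (hA.sub hB),
      Finset.mul_sum, Finset.mul_sum, ← Finset.sum_add_distrib, ← Finset.sum_sub_distrib,
      Finset.mul_sum]
    refine Finset.sum_congr rfl fun σ _ => ?_
    rw [coef_sub, Complex.sub_re]
    ring
  rw [le_div_iff₀ hρ0]
  rw [hpar] at hsum
  have a2 : normF A ^ 2 ≤ 1 := by nlinarith [normF_nonneg A]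
  have b2 : normF B ^ 2 ≤ 1 := by nlinarith [normF_nonneg B]
  nlinarith

/-- A string of weight at least two is damped by `ρ ^ 2` or more, so mass `W` there loses at least
`ρ * (1 - ρ) / 2 * W` of the optimum `ρ`, which must fit into the deficit `K`. The identity string
adds at most `τ ^ 2`. -/
theorem weights_le_of_noiseCorr (hA : A.IsHermitian) (hB : B.IsHermitian) (hA1 : normF A ≤ 1)
    (hB1 : normF B ≤ 1) (hρ0 : 0 < ρ) (hρ1 : ρ < 1) {τ K : ℝ} (hAτ : |(ntr A).re| ≤ τ)
    (hBτ : |(ntr B).re| ≤ τ) (hc : ρ - K + τ ^ 2 ≤ noiseCorr ρ A B) :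
    1 - normF A ^ 2 ≤ 2 * K / ρ ∧
      normF (A - ∑ k, onRegister k (linPart A k)) ^ 2 ≤ τ ^ 2 + 2 * K / (ρ * (1 - ρ)) := by
  set W := ∑ σ with 2 ≤ weight σ, (coef A σ).re ^ 2 with hW
  have hW0 : 0 ≤ W := Finset.sum_nonneg fun _ _ => by positivity
  have hsum : noiseCorr ρ A B ≤ τ ^ 2 +
      ∑ σ, (ρ * (((coef A σ).re ^ 2 + (coef B σ).re ^ 2) / 2) -
        if 2 ≤ weight σ then ρ * (1 - ρ) / 2 * (coef A σ).re ^ 2 else 0) := by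
    rw [noiseCorr, ← Finset.add_sum_erase _ _ (Finset.mem_univ 0), weight_zero, pow_zero, one_mul,
      coef_zero, coef_zero]
    refine add_le_add ?_ ?_
    · have h1 := abs_mul (ntr A).re (ntr B).re
      have h2 := le_abs_self ((ntr A).re * (ntr B).re)
      have h3 := mul_le_mul hAτ hBτ (abs_nonneg _) ((abs_nonneg _).trans hAτ)
      linarith
    · refine le_trans (Finset.sum_le_sum ?_) (Finset.sum_le_sum_of_subset_of_nonneg
        (Finset.erase_subset _ _) fun σ _ _ => ?_)
      · intro σ hσ
        have h0 : 0 ≤ ρ ^ weight σ := by positivity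
        have h1 : ρ ^ weight σ * ((coef A σ).re * (coef B σ).re) ≤
            ρ ^ weight σ * (((coef A σ).re ^ 2 + (coef B σ).re ^ 2) / 2) :=
          mul_le_mul_of_nonneg_left
            (by nlinarith [sq_nonneg ((coef A σ).re - (coef B σ).re)]) h0
        split_ifs with h2
        · have hw : ρ ^ weight σ ≤ ρ ^ 2 := pow_le_pow_of_le_one hρ0.le hρ1.le h2
          have h3 : ρ ^ weight σ * (((coef A σ).re ^ 2 + (coef B σ).re ^ 2) / 2) ≤
              ρ ^ 2 * (((coef A σ).re ^ 2 + (coef B σ).re ^ 2) / 2) :=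
            mul_le_mul_of_nonneg_right hw (by positivity)
          have h4 : 0 ≤ ρ * (1 - ρ) * (coef B σ).re ^ 2 :=
            mul_nonneg (mul_nonneg hρ0.le (by linarith)) (sq_nonneg _)
          nlinarith
        · have hw : ρ ^ weight σ ≤ ρ := pow_le_of_le_one hρ0.le hρ1.le
            (fun h => Finset.ne_of_mem_erase hσ (weight_eq_zero.1 h))
          have h3 : ρ ^ weight σ * (((coef A σ).re ^ 2 + (coef B σ).re ^ 2) / 2) ≤
              ρ * (((coef A σ).re ^ 2 + (coef B σ).re ^ 2) / 2) :=
            mul_le_mul_of_nonneg_right hw (by positivity)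
          linarith
      · split_ifs
        · nlinarith [mul_nonneg hρ0.le (sq_nonneg (coef B σ).re),
            mul_nonneg (mul_nonneg hρ0.le hρ0.le) (sq_nonneg (coef A σ).re)]
        · rw [sub_zero]; positivity
  have hsum2 : ∑ σ, (ρ * (((coef A σ).re ^ 2 + (coef B σ).re ^ 2) / 2) -
        if 2 ≤ weight σ then ρ * (1 - ρ) / 2 * (coef A σ).re ^ 2 else 0) =
      ρ * ((normF A ^ 2 + normF B ^ 2) / 2) - ρ * (1 - ρ) / 2 * W := by
    rw [normF_sq_eq_sum_coef hA, normF_sq_eq_sum_coef hB, Finset.sum_sub_distrib,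
      ← Finset.mul_sum, ← Finset.sum_div, Finset.sum_add_distrib, hW, Finset.mul_sum,
      Finset.sum_filter]
  rw [hsum2] at hsum
  have a2 : normF A ^ 2 ≤ 1 := by nlinarith [normF_nonneg A]
  have b2 : normF B ^ 2 ≤ 1 := by nlinarith [normF_nonneg B]
  have hρρ : 0 < ρ * (1 - ρ) := mul_pos hρ0 (by linarith)
  constructor
  · rw [le_div_iff₀ hρ0]
    nlinarith [mul_nonneg hρρ.le hW0]
  · have hWle : W ≤ 2 * K / (ρ * (1 - ρ)) := by
      rw [le_div_iff₀ hρρ]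
      nlinarith
    rw [normF_sub_sum_linPart_sq hA]
    have e : (Finset.univ.filter fun σ : Fin n → PauliLabel => weight σ ≠ 1) =
        insert 0 (Finset.univ.filter fun σ => 2 ≤ weight σ) := by
      ext σ
      simp only [Finset.mem_filter, Finset.mem_univ, true_and, Finset.mem_insert,
        ← weight_eq_zero (σ := σ)]
      omega
    rw [e, Finset.sum_insert (by simp [weight_zero]), coef_zero]
    have : (ntr A).re ^ 2 ≤ τ ^ 2 := by
      rw [← sq_abs]
      have := abs_nonneg (ntr A).re
      gcongr
    linarith

end NoiseCorr

/-! ### The magic square game with the noisy state -/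

section NoisyGame
variable {n : ℕ} {ρ : ℝ}

theorem noiseCorr_povmOp_left {O : Type} [Fintype O] [DecidableEq O] (E : POVM O (Reg n))
    (f : O → ℝ) (B : Matrix (Reg n) (Reg n) ℂ) :
    noiseCorr ρ (povmOp E f) B = ∑ o, f o * noiseCorr ρ (E.elem o) B := by
  simp only [noiseCorr, Finset.mul_sum]
  rw [Finset.sum_comm]
  refine Finset.sum_congr rfl fun σ _ => ?_
  have : (coef (povmOp E f) σ).re = ∑ o, f o * (coef (E.elem o) σ).re := by
    rw [coef, povmOp, Finset.mul_sum, ntr_sum, Complex.re_sum]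
    refine Finset.sum_congr rfl fun o _ => ?_
    rw [Matrix.mul_smul, ntr_smul, Complex.re_ofReal_mul]
    rfl
  rw [this, Finset.sum_mul, Finset.mul_sum]
  refine Finset.sum_congr rfl fun o _ => ?_
  ring

theorem noiseCorr_povmOp_right {O : Type} [Fintype O] [DecidableEq O] (E : POVM O (Reg n))
    (f : O → ℝ) (A : Matrix (Reg n) (Reg n) ℂ) :
    noiseCorr ρ A (povmOp E f)ᵀ = ∑ o, f o * noiseCorr ρ A (E.elem o)ᵀ := by
  simp only [noiseCorr, Finset.mul_sum]
  rw [Finset.sum_comm]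
  refine Finset.sum_congr rfl fun σ _ => ?_
  have : (coef (povmOp E f)ᵀ σ).re = ∑ o, f o * (coef (E.elem o)ᵀ σ).re := by
    rw [coef, povmOp, Matrix.transpose_sum, Finset.mul_sum, ntr_sum, Complex.re_sum]
    refine Finset.sum_congr rfl fun o _ => ?_
    rw [Matrix.transpose_smul, Matrix.mul_smul, ntr_smul, Complex.re_ofReal_mul]
    rfl
  rw [this, Finset.mul_sum, Finset.mul_sum]
  refine Finset.sum_congr rfl fun o _ => ?_
  ring

variable {X Y A B : Type} [Fintype A] [Fintype B] [DecidableEq A] [DecidableEq B]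

theorem answerProb_eq_noiseCorr (S : QuantumStrategy X Y A B (Reg n) (Reg n))
    (hS : S.state = noisyState n ρ) (x : X) (y : Y) (a : A) (b : B) :
    S.answerProb x y a b = noiseCorr ρ ((S.alice x).elem a) ((S.bob y).elem b)ᵀ := by
  rw [QuantumStrategy.answerProb, hS, trace_kronecker_mul_noisyState_re
    ((S.alice x).posSemidef a).1 ((S.bob y).posSemidef b).1]

theorem sum_mul_answerProb (S : QuantumStrategy X Y A B (Reg n) (Reg n))
    (hS : S.state = noisyState n ρ) (x : X) (y : Y) (f : A → ℝ) (g : B → ℝ) :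
    ∑ a, ∑ b, f a * g b * S.answerProb x y a b =
      noiseCorr ρ (povmOp (S.alice x) f) (povmOp (S.bob y) g)ᵀ := by
  rw [noiseCorr_povmOp_left]
  refine Finset.sum_congr rfl fun a _ => ?_
  rw [noiseCorr_povmOp_right, Finset.mul_sum]
  refine Finset.sum_congr rfl fun b _ => ?_
  rw [answerProb_eq_noiseCorr S hS]
  ring

theorem sum_alice_mul_answerProb (S : QuantumStrategy X Y A B (Reg n) (Reg n))
    (hS : S.state = noisyState n ρ) (x : X) (y : Y) (f : A → ℝ) :
    ∑ a, ∑ b, f a * S.answerProb x y a b = (ntr (povmOp (S.alice x) f)).re := by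
  have := sum_mul_answerProb S hS x y f fun _ => 1
  rw [povmOp_one, Matrix.transpose_one, noiseCorr_one_right] at this
  simpa only [mul_one] using this

theorem sum_bob_mul_answerProb (S : QuantumStrategy X Y A B (Reg n) (Reg n))
    (hS : S.state = noisyState n ρ) (x : X) (y : Y) (g : B → ℝ) :
    ∑ a, ∑ b, g b * S.answerProb x y a b = (ntr (povmOp (S.bob y) g)).re := by
  have := sum_mul_answerProb S hS x y (fun _ => 1) g
  rw [povmOp_one, noiseCorr_one_left, ntr_transpose] at this
  simpa only [one_mul] using this

/-- The real value of a sign. -/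
def signVal (u : ℤˣ) : ℝ := ((u : ℤ) : ℝ)

theorem signVal_sq (u : ℤˣ) : signVal u ^ 2 = 1 := by
  rcases Int.units_eq_one_or u with h | h <;> simp [signVal, h]

theorem abs_signVal (u : ℤˣ) : |signVal u| ≤ 1 := by
  rw [← sq_le_one_iff_abs_le_one, signVal_sq]

/-- Alice's observable for the variable `y` of the line `x`. -/
noncomputable def lineObs {H K : Type} [Fintype H] [DecidableEq H] [Fintype K] [DecidableEq K]
    (S : QuantumStrategy Line Cell (Fin 3 → ℤˣ) ℤˣ H K) (x : Line) (y : Cell) : Matrix H H ℂ :=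
  povmOp (S.alice x) fun a => signVal (assigned x y a)

theorem rowObs_eq {H K : Type} [Fintype H] [DecidableEq H] [Fintype K] [DecidableEq K]
    (S : QuantumStrategy Line Cell (Fin 3 → ℤˣ) ℤˣ H K) (i j : Fin 3) :
    rowObs S i j = lineObs S (Sum.inl i) (i, j) := by
  simp [rowObs, lineObs, povmOp, signVal, assigned]

theorem colObs_eq {H K : Type} [Fintype H] [DecidableEq H] [Fintype K] [DecidableEq K]
    (S : QuantumStrategy Line Cell (Fin 3 → ℤˣ) ℤˣ H K) (i j : Fin 3) :
    colObs S i j = lineObs S (Sum.inr j) (i, j) := by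
  simp [colObs, lineObs, povmOp, signVal, assigned]

theorem bobObs_eq {H K : Type} [Fintype H] [DecidableEq H] [Fintype K] [DecidableEq K]
    (S : QuantumStrategy Line Cell (Fin 3 → ℤˣ) ℤˣ H K) (i j : Fin 3) :
    bobObs S i j = povmOp (S.bob (i, j)) signVal := by
  simp [bobObs, povmOp, signVal]

/-- The probability of winning on the questions `x, y`. -/
noncomputable def winOn {H K : Type} [Fintype H] [DecidableEq H] [Fintype K] [DecidableEq K]
    (S : QuantumStrategy Line Cell (Fin 3 → ℤˣ) ℤˣ H K) (x : Line) (y : Cell) : ℝ :=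
  ∑ a, ∑ b, (if magicSquare.V x y a b then 1 else 0) * S.answerProb x y a b

theorem winProb_eq {H K : Type} [Fintype H] [DecidableEq H] [Fintype K] [DecidableEq K]
    (S : QuantumStrategy Line Cell (Fin 3 → ℤˣ) ℤˣ H K) :
    winProb magicSquare S =
      1 / 18 * ∑ q : Cell, (winOn S (Sum.inl q.1) q + winOn S (Sum.inr q.2) q) := by
  have h : winProb magicSquare S = ∑ x, ∑ y, magicSquare.μ x y * winOn S x y := by
    simp only [winProb, winOn, Finset.mul_sum, mul_assoc]
  rw [h]
  simp [magicSquare, onLine, Fintype.sum_prod_type, Fin.sum_univ_three]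
  ring

variable (S : QuantumStrategy Line Cell (Fin 3 → ℤˣ) ℤˣ (Reg n) (Reg n))

theorem indicator_win (x : Line) (y : Cell) (a : Fin 3 → ℤˣ) (b : ℤˣ) :
    (if magicSquare.V x y a b then (1 : ℝ) else 0) =
      (if a 0 * a 1 * a 2 = lineParity x then 1 else 0) *
        (1 / 2 + 1 / 2 * (signVal (assigned x y a) * signVal b)) := by
  have h : (1 / 2 + 1 / 2 * (signVal (assigned x y a) * signVal b)) =
      if assigned x y a = b then 1 else 0 := by
    rcases Int.units_eq_one_or (assigned x y a) with h1 | h1 <;>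
      rcases Int.units_eq_one_or b with h2 | h2 <;> simp [signVal, h1, h2] <;> norm_num
  rw [h, ite_zero_mul_ite_zero]
  simp [magicSquare]

theorem winOn_eq (hS : S.state = noisyState n ρ) (x : Line) (y : Cell) :
    winOn S x y =
      1 / 2 * (ntr (povmOp (S.alice x) fun a =>
        if a 0 * a 1 * a 2 = lineParity x then 1 else 0)).re +
      1 / 2 * noiseCorr ρ (povmOp (S.alice x) fun a =>
        (if a 0 * a 1 * a 2 = lineParity x then 1 else 0) * signVal (assigned x y a))
        (povmOp (S.bob y) signVal)ᵀ := by
  rw [← sum_alice_mul_answerProb S hS x y, ← sum_mul_answerProb S hS x y, winOn]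
  simp only [Finset.mul_sum, ← Finset.sum_add_distrib]
  refine Finset.sum_congr rfl fun a _ => Finset.sum_congr rfl fun b _ => ?_
  rw [indicator_win]
  ring

/-- Drops the parity condition, leaving the probability that two signs agree. -/
theorem winOn_le (hS : S.state = noisyState n ρ) (x : Line) (y : Cell) :
    winOn S x y ≤ 1 / 2 + 1 / 2 * noiseCorr ρ (lineObs S x y) (povmOp (S.bob y) signVal)ᵀ := by
  rw [lineObs, ← sum_mul_answerProb S hS x y, winOn]
  have h1 : (1 / 2 : ℝ) = ∑ a, ∑ b, 1 / 2 * S.answerProb x y a b := by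
    simp only [← Finset.mul_sum, S.answerProb_sum, mul_one]
  nth_rewrite 1 [h1]
  simp only [Finset.mul_sum, ← Finset.sum_add_distrib]
  refine Finset.sum_le_sum fun a _ => Finset.sum_le_sum fun b _ => ?_
  rw [indicator_win]
  have h2 := S.answerProb_nonneg x y a b
  have h3 : 0 ≤ 1 / 2 + 1 / 2 * (signVal (assigned x y a) * signVal b) := by
    have := abs_signVal (assigned x y a)
    have := abs_signVal b
    have h4 : |signVal (assigned x y a) * signVal b| ≤ 1 := by
      rw [abs_mul]; exact mul_le_one₀ ‹_› (abs_nonneg _) ‹_›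
    linarith [(abs_le.1 h4).1]
  have h5 : (if a 0 * a 1 * a 2 = lineParity x then (1 : ℝ) else 0) *
      (1 / 2 + 1 / 2 * (signVal (assigned x y a) * signVal b)) ≤
      1 / 2 + 1 / 2 * (signVal (assigned x y a) * signVal b) := by
    split_ifs
    · rw [one_mul]
    · rw [zero_mul]; exact h3
  have := mul_le_mul_of_nonneg_right h5 h2
  linarith

end NoisyGame

/-! ### The trace test -/

section TraceTest

/-- A function of a sign is affine in it, so its expectation depends only on the mean `m`; the claim
becomes the Bernoulli case of parameter `1 / 2 + 1 / 2 * m`. -/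
theorem sum_exp_bias_le {ι : Type} [Fintype ι] {w : ι → ℝ} (hw : ∑ i, w i = 1) (s : ι → ℤˣ) {m : ℝ}
    (hm : ∑ i, signVal (s i) * w i = m) (hm1 : |m| ≤ 1) (r : ℝ) :
    ∑ i, Real.exp (r * ((if s i = 1 then 1 else 0) - (1 / 2 + 1 / 2 * m)) - r ^ 2) * w i ≤ 1 := by
  obtain ⟨h1, h2⟩ := abs_le.1 hm1
  refine le_trans (le_of_eq ?_) (bernoulli_mgf_le (q := 1 / 2 + 1 / 2 * m) (by linarith)
    (by linarith) r)
  obtain ⟨q, hq⟩ : ∃ q, q = 1 / 2 + 1 / 2 * m := ⟨_, rfl⟩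
  rw [← hq]
  have h : ∀ i, Real.exp (r * ((if s i = 1 then 1 else 0) - q) - r ^ 2) * w i =
      1 / 2 * (Real.exp (r * (1 - q) - r ^ 2) + Real.exp (r * (0 - q) - r ^ 2)) * w i +
      1 / 2 * (Real.exp (r * (1 - q) - r ^ 2) - Real.exp (r * (0 - q) - r ^ 2)) *
        (signVal (s i) * w i) := by
    intro i
    rcases Int.units_eq_one_or (s i) with hi | hi <;> simp [hi, signVal] <;> ring
  simp only [h, Finset.sum_add_distrib, ← Finset.mul_sum, hw, hm]
  rw [hq]
  ring

section Rounds
variable {X Y A B H K : Type} [Fintype X] [Fintype Y] [Fintype A] [Fintype B]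
  [Fintype H] [DecidableEq H] [Fintype K] [DecidableEq K]

instance : DiscreteMeasurableSpace (Transcript X Y A B) := ⟨fun _ => trivial⟩

theorem lintegral_roundPMF_le_one (G : NonlocalGame X Y A B) (S : QuantumStrategy X Y A B H K)
    {f : Transcript X Y A B → ℝ} (hf : ∀ r, 0 ≤ f r)
    (h : ∀ x y, ∑ a, ∑ b, f ⟨x, y, a, b⟩ * S.answerProb x y a b ≤ 1) :
    ∫⁻ r, ENNReal.ofReal (f r) ∂(roundPMF G S).toMeasure ≤ 1 := by
  rw [lintegral_fintype]
  simp only [PMF.toMeasure_apply_singleton _ _ (MeasurableSet.singleton _)]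
  simp only [roundPMF, PMF.ofFintype_apply, ← ENNReal.ofReal_mul (hf _)]
  rw [← ENNReal.ofReal_sum_of_nonneg fun r _ =>
    mul_nonneg (hf r) (mul_nonneg (G.μ_nonneg _ _) (S.answerProb_nonneg _ _ _ _))]
  rw [ENNReal.ofReal_le_one, ← Equiv.sum_comp Transcript.equivProd.symm]
  simp only [Fintype.sum_prod_type, Transcript.equivProd, Equiv.coe_fn_symm_mk]
  rw [← G.μ_sum]
  refine Finset.sum_le_sum fun x _ => Finset.sum_le_sum fun y _ => ?_
  have := mul_le_mul_of_nonneg_left (h x y) (G.μ_nonneg x y)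
  rw [mul_one] at this
  refine le_trans (le_of_eq ?_) this
  simp only [Finset.mul_sum]
  refine Finset.sum_congr rfl fun a _ => Finset.sum_congr rfl fun b _ => ?_
  ring

/-- If the answers to the question `v` assign to a variable values of mean `m`, then `m` is small
whenever the frequency of the value `1` is close to `1/2` with probability at least `p`. -/
theorem abs_mean_le (G : NonlocalGame X Y A B) (S : QuantumStrategy X Y A B H K)
    {Q : Type} [DecidableEq Q] (g : X → Y → Q) (v : Q) (c : A → B → ℤˣ) {m δ p : ℝ} {t : ℕ}
    (hm : ∀ x y, g x y = v → ∑ a, ∑ b, signVal (c a b) * S.answerProb x y a b = m) (hm1 : |m| ≤ 1)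
    (ht : 0 < t) (hp : 0 < p) (hδ : δ = Real.sqrt (2 * Real.log (2 / p) / t))
    {E : Set (ℕ → Transcript X Y A B)}
    (hE : ∀ ω ∈ E, (∃ N, t ≤ Nat.count (fun k => g (ω k).x (ω k).y = v) N) ∧
      |empFreq t (fun k => g (ω k).x (ω k).y) v (fun k => c (ω k).a (ω k).b) - 1 / 2| ≤ δ)
    (hpE : p ≤ (repeatedMeasure G S).real E) : |m| ≤ 6 * δ := by
  have : Nonempty (Transcript X Y A B) := (roundPMF G S).support_nonempty.to_type
  have hp1 : p ≤ 1 := hpE.trans (by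
    have : IsProbabilityMeasure (repeatedMeasure G S) := by unfold repeatedMeasure; infer_instance
    exact measureReal_le_one)
  have h := abs_bias_sub_half_le (α := Transcript X Y A B) (roundPMF G S).toMeasure
    (g := fun r => g r.x r.y) (v := v) (c := fun r => c r.a r.b) (q := 1 / 2 + 1 / 2 * m)
    ?_ ht hp hp1 hδ hE hpE
  · rw [show 1 / 2 + 1 / 2 * m - 1 / 2 = 1 / 2 * m by ring, abs_mul] at h
    norm_num at h
    linarith
  · intro r
    have h1 : ∀ a : Transcript X Y A B, (if g a.x a.y = v then ENNReal.ofReal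
        (Real.exp (r * ((if c a.a a.b = 1 then 1 else 0) - (1 / 2 + 1 / 2 * m)) - r ^ 2)) else 1) =
        ENNReal.ofReal (if g a.x a.y = v then
          Real.exp (r * ((if c a.a a.b = 1 then 1 else 0) - (1 / 2 + 1 / 2 * m)) - r ^ 2) else 1) := by
      intro a
      split_ifs <;> simp
    simp only [h1]
    refine lintegral_roundPMF_le_one G S (fun a => by split_ifs <;> positivity) fun x y => ?_
    by_cases hxy : g x y = v
    · simp only [hxy, if_true]
      have := sum_exp_bias_le (ι := A × B) (w := fun q => S.answerProb x y q.1 q.2)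
        (by rw [Fintype.sum_prod_type]; exact S.answerProb_sum x y) (fun q => c q.1 q.2) (m := m)
        (by rw [Fintype.sum_prod_type]; exact hm x y hxy) hm1 r
      rwa [Fintype.sum_prod_type] at this
    · simp only [hxy, if_false, one_mul, S.answerProb_sum, le_refl]

end Rounds

variable {n : ℕ} {ρ : ℝ} (S : QuantumStrategy Line Cell (Fin 3 → ℤˣ) ℤˣ (Reg n) (Reg n))

theorem normF_povmOp_le_one {O : Type} [Fintype O] [DecidableEq O] (E : POVM O (Reg n)) {f : O → ℝ}
    (hf : ∀ o, |f o| ≤ 1) : normF (povmOp E f) ≤ 1 :=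
  normF_le_one_of_contraction (povmOp_isHermitian E f) (one_sub_povmOp_sq_posSemidef E hf)

theorem abs_ntr_povmOp_le_one {O : Type} [Fintype O] [DecidableEq O] (E : POVM O (Reg n))
    {f : O → ℝ} (hf : ∀ o, |f o| ≤ 1) : |(ntr (povmOp E f)).re| ≤ 1 :=
  (Complex.abs_re_le_norm _).trans ((norm_ntr_le _).trans (normF_povmOp_le_one E hf))

variable {S}

theorem abs_ntr_le_of_tracePassProb (hS : S.state = noisyState n ρ) {t : ℕ} {p δ : ℝ} (ht : 0 < t)
    (hp : 0 < p) (hδ : δ = Real.sqrt (2 * Real.log (2 / p) / t)) (h : p ≤ tracePassProb S t δ)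
    (i j : Fin 3) :
    |(ntr (rowObs S i j)).re| ≤ 6 * δ ∧ |(ntr (colObs S i j)).re| ≤ 6 * δ ∧
      |(ntr (bobObs S i j)).re| ≤ 6 * δ := by
  rw [rowObs_eq, colObs_eq, bobObs_eq]
  refine ⟨?_, ?_, ?_⟩
  · refine abs_mean_le magicSquare S (fun x _ => x) (Sum.inl i) (fun a _ => a j) ?_
      (abs_ntr_povmOp_le_one _ fun _ => abs_signVal _) ht hp hδ
      (fun ω hω => ⟨hω.1 _, (hω.2.2 i j).1⟩) h
    rintro x y rfl
    exact sum_alice_mul_answerProb S hS _ y fun a => signVal (a j)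
  · refine abs_mean_le magicSquare S (fun x _ => x) (Sum.inr j) (fun a _ => a i) ?_
      (abs_ntr_povmOp_le_one _ fun _ => abs_signVal _) ht hp hδ
      (fun ω hω => ⟨hω.1 _, (hω.2.2 i j).2.1⟩) h
    rintro x y rfl
    exact sum_alice_mul_answerProb S hS _ y fun a => signVal (a i)
  · refine abs_mean_le magicSquare S (fun _ y => y) (i, j) (fun _ b => b) ?_
      (abs_ntr_povmOp_le_one _ fun _ => abs_signVal _) ht hp hδ
      (fun ω hω => ⟨hω.2.1 _, (hω.2.2 i j).2.2⟩) h
    rintro x _ rfl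
    exact sum_bob_mul_answerProb S hS x (i, j) signVal

end TraceTest

/-! ### Consequences of a large winning probability -/

section Winning
variable {n : ℕ} {ρ τ : ℝ} {S : QuantumStrategy Line Cell (Fin 3 → ℤˣ) ℤˣ (Reg n) (Reg n)}

/-- The variables of a line, in order. -/
def lineCell : Line → Fin 3 → Cell
  | Sum.inl i, k => (i, k)
  | Sum.inr j, k => (k, j)

theorem lineObs_lineCell (x : Line) (k : Fin 3) :
    lineObs S x (lineCell x k) = povmOp (S.alice x) fun a => signVal (a k) := by
  cases x <;> rfl

theorem winOn_lineCell_le (hS : S.state = noisyState n ρ) (hρ0 : 0 ≤ ρ) (hρ1 : ρ ≤ 1)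
    (hA : ∀ x k, |(ntr (lineObs S x (lineCell x k))).re| ≤ τ)
    (hB : ∀ y, |(ntr (povmOp (S.bob y) signVal)).re| ≤ τ) (x : Line) (k : Fin 3) :
    winOn S x (lineCell x k) ≤ (1 + ρ + τ ^ 2) / 2 := by
  have h1 := winOn_le S hS x (lineCell x k)
  have h2 := noiseCorr_le (povmOp_isHermitian (S.alice x) fun a => signVal (assigned x (lineCell x k) a))
    (povmOp_isHermitian (S.bob (lineCell x k)) signVal).transpose
    (normF_povmOp_le_one _ fun _ => abs_signVal _)
    (by rw [normF_transpose]; exact normF_povmOp_le_one _ fun _ => abs_signVal _) hρ0 hρ1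
  rw [ntr_transpose] at h2
  have h3 := hA x k
  have h4 := hB (lineCell x k)
  rw [lineObs] at h1 h3
  have h5 := abs_mul (ntr (povmOp (S.alice x) fun a => signVal (assigned x (lineCell x k) a))).re
    (ntr (povmOp (S.bob (lineCell x k)) signVal)).re
  have h6 := mul_le_mul h3 h4 (abs_nonneg _) ((abs_nonneg _).trans h3)
  rw [← h5] at h6
  have h7 := (le_abs_self _).trans h6
  linarith

/-- Each of the 18 question pairs has probability `1 / 18`, and none is won with probability above
`(1 + ρ + τ ^ 2) / 2`. The other 17 can therefore not compensate for a bad pair. -/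
theorem le_winOn_lineCell (hS : S.state = noisyState n ρ) (hρ0 : 0 ≤ ρ) (hρ1 : ρ ≤ 1)
    (hA : ∀ x k, |(ntr (lineObs S x (lineCell x k))).re| ≤ τ)
    (hB : ∀ y, |(ntr (povmOp (S.bob y) signVal)).re| ≤ τ) {εwin : ℝ}
    (hwin : (1 + ρ) / 2 - εwin ≤ winProb magicSquare S) (x : Line) (k : Fin 3) :
    (1 + ρ) / 2 - 18 * εwin - 17 / 2 * τ ^ 2 ≤ winOn S x (lineCell x k) := by
  have hle := winOn_lineCell_le hS hρ0 hρ1 hA hB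
  obtain ⟨M, hM⟩ : ∃ M, M = (1 + ρ + τ ^ 2) / 2 := ⟨_, rfl⟩
  rw [← hM] at hle
  have hr : ∀ q : Cell, winOn S (Sum.inl q.1) q ≤ M := fun q => hle (Sum.inl q.1) q.2
  have hc : ∀ q : Cell, winOn S (Sum.inr q.2) q ≤ M := fun q => hle (Sum.inr q.2) q.1
  have hsum : ∀ q : Cell,
      18 * winProb magicSquare S - 16 * M ≤ winOn S (Sum.inl q.1) q + winOn S (Sum.inr q.2) q := by
    intro q
    have h1 := Finset.single_le_sum (s := Finset.univ)
      (f := fun q : Cell => 2 * M - (winOn S (Sum.inl q.1) q + winOn S (Sum.inr q.2) q))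
      (fun q _ => by linarith [hr q, hc q]) (Finset.mem_univ q)
    rw [Finset.sum_sub_distrib] at h1
    have h2 : ∑ _q : Cell, 2 * M = 18 * M := by simp; ring
    rw [winProb_eq]
    linarith
  cases x with
  | inl i =>
    have := hsum (i, k)
    have := hc (i, k)
    change _ ≤ winOn S (Sum.inl i) (i, k)
    simp only at *
    linarith
  | inr j =>
    have := hsum (k, j)
    have := hr (k, j)
    change _ ≤ winOn S (Sum.inr j) (k, j)
    simp only at *
    linarith

theorem le_noiseCorr_lineObs (hS : S.state = noisyState n ρ) (hρ0 : 0 ≤ ρ) (hρ1 : ρ ≤ 1)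
    (hA : ∀ x k, |(ntr (lineObs S x (lineCell x k))).re| ≤ τ)
    (hB : ∀ y, |(ntr (povmOp (S.bob y) signVal)).re| ≤ τ) {εwin : ℝ}
    (hwin : (1 + ρ) / 2 - εwin ≤ winProb magicSquare S) (x : Line) (k : Fin 3) :
    ρ - 36 * εwin - 17 * τ ^ 2 ≤
      noiseCorr ρ (lineObs S x (lineCell x k)) (povmOp (S.bob (lineCell x k)) signVal)ᵀ := by
  linarith [le_winOn_lineCell hS hρ0 hρ1 hA hB hwin x k, winOn_le S hS x (lineCell x k)]

theorem abs_ntr_povmOp_le {O : Type} [Fintype O] [DecidableEq O] (E : POVM O (Reg n)) {f g : O → ℝ}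
    (h : ∀ o, |f o| ≤ g o) : |(ntr (povmOp E f)).re| ≤ (ntr (povmOp E g)).re := by
  have key : ∀ c : ℝ, |c| = 1 → 0 ≤ (ntr (povmOp E g)).re + c * (ntr (povmOp E f)).re := by
    intro c hc
    have h1 := ntr_re_nonneg_of_posSemidef (povmOp_posSemidef E (f := fun o => g o + c * f o) fun o => by
      have h2 := neg_abs_le (c * f o)
      rw [abs_mul, hc, one_mul] at h2
      linarith [h o])
    rwa [povmOp_add_smul, ntr_add, ntr_smul, Complex.add_re, Complex.re_ofReal_mul] at h1
  have h1 := key 1 (by norm_num)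
  have h2 := key (-1) (by norm_num)
  exact abs_le.2 ⟨by linarith, by linarith⟩

/-- Outcomes of wrong parity, of total probability `β`, always lose. Restricting the observable to
the good outcomes keeps it a contraction, so its correlation is at most `ρ + (τ + β) * τ`;
comparison with the winning probability bounds `β * (1 - τ)`. -/
theorem ntr_bad_parity_le (hS : S.state = noisyState n ρ) (hρ0 : 0 ≤ ρ) (hρ1 : ρ ≤ 1)
    (hA : ∀ x k, |(ntr (lineObs S x (lineCell x k))).re| ≤ τ)
    (hB : ∀ y, |(ntr (povmOp (S.bob y) signVal)).re| ≤ τ) (hτ : τ ≤ 1 / 2) {εwin : ℝ}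
    (hwin : (1 + ρ) / 2 - εwin ≤ winProb magicSquare S) (x : Line) :
    (ntr (povmOp (S.alice x) fun a => if a 0 * a 1 * a 2 = lineParity x then 0 else 1)).re ≤
      72 * εwin + 36 * τ ^ 2 := by
  have hwin' := le_winOn_lineCell hS hρ0 hρ1 hA hB hwin x 0
  rw [winOn_eq S hS] at hwin'
  obtain ⟨G, hG⟩ : ∃ G : (Fin 3 → ℤˣ) → ℝ,
    G = fun a => if a 0 * a 1 * a 2 = lineParity x then 1 else 0 := ⟨_, rfl⟩
  obtain ⟨D, hD⟩ : ∃ D : (Fin 3 → ℤˣ) → ℝ,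
    D = fun a => if a 0 * a 1 * a 2 = lineParity x then 0 else 1 := ⟨_, rfl⟩
  have hDn : ∀ a, D a = 0 ∨ D a = 1 := fun a => by rw [hD]; simp only; split_ifs <;> simp
  have hGD : G = fun a => 1 + (-1) * D a := by
    rw [hG, hD]; funext a; by_cases h : a 0 * a 1 * a 2 = lineParity x <;> simp [h]
  obtain ⟨f, hf⟩ : ∃ f : (Fin 3 → ℤˣ) → ℝ, f = fun a => signVal (assigned x (lineCell x 0) a) :=
    ⟨_, rfl⟩
  have hf1 : ∀ a, |f a| ≤ 1 := fun a => by rw [hf]; exact abs_signVal _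
  have hGf : (fun a => (if a 0 * a 1 * a 2 = lineParity x then 1 else 0) *
      signVal (assigned x (lineCell x 0) a)) = fun a => f a + (-1) * (D a * f a) := by
    rw [hf, hD]; funext a; by_cases h : a 0 * a 1 * a 2 = lineParity x <;> simp [h]
  rw [hGf, ← hG, hGD] at hwin'
  rw [← hD]
  have hβ : (ntr (povmOp (S.alice x) fun a => 1 + (-1) * D a)).re =
      1 - (ntr (povmOp (S.alice x) D)).re := by
    rw [povmOp_add_smul, povmOp_one, ntr_add, ntr_one, ntr_smul, Complex.add_re,
      Complex.re_ofReal_mul, Complex.one_re]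
    ring
  have hDf : |(ntr (povmOp (S.alice x) fun a => D a * f a)).re| ≤
      (ntr (povmOp (S.alice x) D)).re := by
    refine abs_ntr_povmOp_le _ fun a => ?_
    rw [abs_mul]
    rcases hDn a with h | h <;> simp [h, hf1 a]
  have hT : (ntr (povmOp (S.alice x) fun a => f a + (-1) * (D a * f a))).re =
      (ntr (povmOp (S.alice x) f)).re - (ntr (povmOp (S.alice x) fun a => D a * f a)).re := by
    rw [povmOp_add_smul, ntr_add, ntr_smul, Complex.add_re, Complex.re_ofReal_mul]
    ring
  have hfτ : |(ntr (povmOp (S.alice x) f)).re| ≤ τ := by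
    have := hA x 0
    rwa [lineObs, ← hf] at this
  have hc := noiseCorr_le (povmOp_isHermitian (S.alice x) fun a => f a + (-1) * (D a * f a))
    (povmOp_isHermitian (S.bob (lineCell x 0)) signVal).transpose
    (normF_povmOp_le_one _ fun a => by
      rcases hDn a with h | h <;> simp [h, hf1 a])
    (by rw [normF_transpose]; exact normF_povmOp_le_one _ fun _ => abs_signVal _) hρ0 hρ1
  rw [ntr_transpose, hT] at hc
  rw [hβ] at hwin'
  generalize (ntr (povmOp (S.alice x) D)).re = β at *
  generalize (ntr (povmOp (S.alice x) f)).re = u at *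
  generalize (ntr (povmOp (S.alice x) fun a => D a * f a)).re = v at *
  have hb := hB (lineCell x 0)
  generalize (ntr (povmOp (S.bob (lineCell x 0)) signVal)).re = w at *
  have h1 : |u - v| ≤ τ + β := (abs_sub u v).trans (add_le_add hfτ hDf)
  have hβ0 : 0 ≤ β := (abs_nonneg _).trans hDf
  have hτ0 : 0 ≤ τ := (abs_nonneg _).trans hb
  have h2 : (u - v) * w ≤ (τ + β) * τ := by
    refine (le_abs_self _).trans ?_
    rw [abs_mul]
    exact mul_le_mul h1 hb (abs_nonneg _) (by linarith)
  nlinarith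

end Winning

/-! ### Rounding and the relations of the rounded observables -/

section Rounding
variable {n : ℕ}

theorem normF_pauliString (σ : Fin n → PauliLabel) : normF (pauliString σ) = 1 := by
  have h := normF_sq (pauliString σ)
  rw [(pauliString_isHermitian σ).eq, ntr_pauliString_mul, if_pos rfl, Complex.one_re] at h
  exact (pow_eq_one_iff_of_nonneg (normF_nonneg _) two_ne_zero).1 h

theorem norm_coef_le (A : Matrix (Reg n) (Reg n) ℂ) (σ : Fin n → PauliLabel) :
    ‖coef A σ‖ ≤ normF A := by
  have := norm_ntr_mul_le (pauliString σ) A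
  rwa [normF_pauliString, one_mul] at this

/-- A crude operator norm bound: the linear part is a combination of 15 unitaries with coefficients
at most one. -/
theorem normF_mul_onRegister_linPart_le {A : Matrix (Reg n) (Reg n) ℂ} (hA : normF A ≤ 1)
    (M : Matrix (Reg n) (Reg n) ℂ) (k : Fin n) :
    normF (M * onRegister k (linPart A k)) ≤ 16 * normF M := by
  have key : ∀ s : Finset PauliLabel,
      normF (M * onRegister k (∑ x ∈ s, coef A (Function.update 0 k x) • pauli₂ x)) ≤
        s.card * normF M := by
    intro s
    induction s using Finset.induction_on with
    | empty =>
      rw [onRegister_sum]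
      simp [normF_zero]
    | insert a s ha ih =>
      rw [Finset.sum_insert ha, onRegister_add, Matrix.mul_add, Finset.card_insert_of_notMem ha,
        onRegister_smul, Matrix.mul_smul]
      refine (normF_add_le _ _).trans ?_
      rw [normF_smul, normF_mul_unitary (by
        rw [← onRegister_conjTranspose, (pauli₂_isHermitian a).eq, ← onRegister_mul,
          pauli₂_mul_self, onRegister_one])]
      have := mul_le_mul_of_nonneg_right ((norm_coef_le A (Function.update 0 k a)).trans hA)
        (normF_nonneg M)
      push_cast
      linarith
  refine (key _).trans (mul_le_mul_of_nonneg_right ?_ (normF_nonneg M))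
  have : (Finset.univ.erase (0 : PauliLabel)).card ≤ 16 := by decide
  exact_mod_cast this

/-- An observable that is close to its linear part is close to a binary observable on one
register. -/
theorem exists_binaryObservable_onRegister {P : Matrix (Reg n) (Reg n) ℂ} (hP : P.IsHermitian)
    (hP1 : (1 - P * P).PosSemidef) {κ : ℝ} (hκ0 : 0 ≤ κ) (hκ : κ ≤ 1 / 1000)
    (h1 : 1 - normF P ^ 2 ≤ κ ^ 2) (hL : normF (P - ∑ k, onRegister k (linPart P k)) ≤ κ) :
    ∃ ℓ M, IsBinaryObservable M ∧ M.trace = 0 ∧ normF (P - onRegister ℓ M) ≤ 200 * κ := by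
  have hP2 : normF (1 - P * P) ≤ κ :=
    abs_le_of_sq_le_sq' ((normF_one_sub_sq_le hP hP1).trans h1) hκ0 |>.2
  obtain ⟨ℓ, hℓ⟩ := exists_register_of_close_to_regSum (fun k => linPart_isHermitian hP k)
    (fun k => ntr_linPart P k) hP hP1 hκ0 (by linarith) hP2 hL
  obtain ⟨l, hl⟩ : ∃ l, l = linPart P ℓ := ⟨_, rfl⟩
  -- `188 = 1 + 11 + 16 * 11`: the defect of `P * P`, and the `11 * κ` distance multiplied by the
  -- contraction `P` and by the linear part.
  have hl2 : normF (l * l - 1) ≤ 188 * κ := by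
    rw [← normF_onRegister ℓ, onRegister_sub, onRegister_mul, onRegister_one, hl]
    have e : onRegister ℓ (linPart P ℓ) * onRegister ℓ (linPart P ℓ) - 1 =
        -((1 - P * P) + (P * (P - onRegister ℓ (linPart P ℓ)) +
          (P - onRegister ℓ (linPart P ℓ)) * onRegister ℓ (linPart P ℓ))) := by
      noncomm_ring
    rw [e, normF_neg]
    have a1 := normF_add_le (1 - P * P) (P * (P - onRegister ℓ (linPart P ℓ)) +
          (P - onRegister ℓ (linPart P ℓ)) * onRegister ℓ (linPart P ℓ))
    have a2 := normF_add_le (P * (P - onRegister ℓ (linPart P ℓ)))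
      ((P - onRegister ℓ (linPart P ℓ)) * onRegister ℓ (linPart P ℓ))
    have a3 := normF_contraction_mul_le hP hP1 (P - onRegister ℓ (linPart P ℓ))
    have a4 := normF_mul_onRegister_linPart_le (normF_le_one_of_contraction hP hP1)
      (P - onRegister ℓ (linPart P ℓ)) ℓ
    linarith
  obtain ⟨M, hM, hM0, hlM⟩ := exists_binaryObservable_near (hl ▸ linPart_isHermitian hP ℓ)
    (hl ▸ ntr_linPart P ℓ) (by linarith) hl2
  refine ⟨ℓ, M, hM, hM0, ?_⟩
  have a := normF_triangle P (onRegister ℓ l) (onRegister ℓ M)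
  rw [← onRegister_sub, normF_onRegister, hl] at a
  rw [hl] at hlM
  linarith

theorem IsBinaryObservable.onRegister {M : Matrix TwoQubit TwoQubit ℂ} (hM : IsBinaryObservable M)
    (ℓ : Fin n) : IsBinaryObservable (onRegister ℓ M) :=
  ⟨isHermitian_onRegister hM.1 ℓ, by rw [← onRegister_mul, hM.2, onRegister_one]⟩

/-- Otherwise the traceless `N₃` is alone on its register, the trace of the product factors and
vanishes, and the distance to a sign is at least one. -/
theorem register_eq_or_eq_of_triple {N₁ N₂ N₃ : Matrix TwoQubit TwoQubit ℂ} {ℓ₁ ℓ₂ ℓ₃ : Fin n}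
    (h₃ : N₃.trace = 0) {s : ℤˣ} {r : ℝ} (hr : r < 1)
    (h : normF (onRegister ℓ₁ N₁ * onRegister ℓ₂ N₂ * onRegister ℓ₃ N₃ - ((signVal s : ℝ) : ℂ) • 1) ≤ r) :
    ℓ₁ = ℓ₃ ∨ ℓ₂ = ℓ₃ := by
  by_contra! hne
  have h0 : ntr (onRegister ℓ₁ N₁ * onRegister ℓ₂ N₂ * onRegister ℓ₃ N₃) = 0 := by
    rw [ntr_mul_of_disjoint (S := {ℓ₁, ℓ₂}) (T := {ℓ₃})
      ((supportedOn_onRegister (by simp) N₁).mul (supportedOn_onRegister (by simp) N₂))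
      (supportedOn_onRegister (by simp) N₃) (by simp [hne.1.symm, hne.2.symm]), ntr_onRegister, ntr, ntr, h₃]
    simp
  have h1 := (norm_ntr_le _).trans h
  rw [ntr_sub, h0, ntr_smul, ntr_one, zero_sub, norm_neg, mul_one, Complex.norm_real] at h1
  have h2 : ‖signVal s‖ = 1 := by
    rcases Int.units_eq_one_or s with h | h <;> simp [signVal, h]
  linarith

/-- Three rounded observables of a POVM whose outcomes have product `s` live on the same register
and have product `s`. -/
theorem relations_of_parity (E : POVM (Fin 3 → ℤˣ) (Reg n)) {N : Fin 3 → Matrix TwoQubit TwoQubit ℂ}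
    {ℓ : Fin 3 → Fin n} (hN : ∀ k, IsBinaryObservable (N k)) (h0 : ∀ k, (N k).trace = 0)
    {s : ℤˣ} {e b : ℝ} (he : 0 ≤ e) (hb : 0 ≤ b) (hr : 3 * e + 2 * b < 1)
    (h : ∀ k, normF (povmOp E (fun a => signVal (a k)) - onRegister (ℓ k) (N k)) ^ 2 + 1 -
      normF (povmOp E fun a => signVal (a k)) ^ 2 ≤ e ^ 2)
    (hbad : (ntr (povmOp E fun a => if a 0 * a 1 * a 2 = s then 0 else 1)).re ≤ b ^ 2) :
    (ℓ 1 = ℓ 0 ∧ ℓ 2 = ℓ 0) ∧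
      normF (N 0 * N 1 - (signVal s : ℂ) • N 2) ≤ 3 * e + 2 * b ∧
      normF (N 1 * N 0 - (signVal s : ℂ) • N 2) ≤ 3 * e + 2 * b := by
  have hsv : ∀ u v w : ℤˣ, signVal u * signVal v * signVal w = signVal s ↔ u * v * w = s := by
    intro u v w
    rcases Int.units_eq_one_or u with hu | hu <;> rcases Int.units_eq_one_or v with hv | hv <;>
      rcases Int.units_eq_one_or w with hw | hw <;> rcases Int.units_eq_one_or s with hs | hs <;>
      simp [signVal, hu, hv, hw, hs] <;> first | decide | norm_num
  -- Answers commute even though the rounded observables need not, so the parity relation holds for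
  -- every order of the factors.
  have key : ∀ i j k : Fin 3, (∀ a : Fin 3 → ℤˣ, a i * a j * a k = a 0 * a 1 * a 2) →
      normF (onRegister (ℓ i) (N i) * onRegister (ℓ j) (N j) * onRegister (ℓ k) (N k) -
        (signVal s : ℂ) • 1) ≤ 3 * e + 2 * b := by
    intro i j k hijk
    refine normF_mul_mul_sub_le E (fun a => signVal_sq (a i)) (fun a => signVal_sq (a j))
      (fun a => signVal_sq (a k)) ((hN i).onRegister _) ((hN j).onRegister _) ((hN k).onRegister _)
      (signVal_sq s) he hb (h i) (h j) (h k) ?_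
    simpa only [hsv, hijk] using hbad
  have k012 := key 0 1 2 fun _ => rfl
  have k102 := key 1 0 2 fun a => by rw [mul_comm (a 1)]
  have k021 := key 0 2 1 fun a => mul_right_comm _ _ _
  have k120 := key 1 2 0 fun a => by rw [mul_comm, mul_assoc]
  have r1 := register_eq_or_eq_of_triple (h0 2) hr k012
  have r2 := register_eq_or_eq_of_triple (h0 1) hr k021
  have r3 := register_eq_or_eq_of_triple (h0 0) hr k120
  have hℓ : ℓ 1 = ℓ 0 ∧ ℓ 2 = ℓ 0 := by
    -- No register index is different from both others; among three this forces equality of all.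
    constructor <;> grind
  refine ⟨hℓ, ?_⟩
  rw [hℓ.1, hℓ.2, ← onRegister_one (ℓ 0), ← onRegister_smul, ← onRegister_mul, ← onRegister_mul,
    ← onRegister_sub, normF_onRegister] at k012 k102
  have fin : ∀ A : Matrix TwoQubit TwoQubit ℂ, normF (A * N 2 - (signVal s : ℂ) • 1) =
      normF (A - (signVal s : ℂ) • N 2) := by
    intro A
    rw [← normF_mul_unitary (hN 2).mul_conjTranspose_self (A - _), Matrix.sub_mul,
      Matrix.smul_mul, (hN 2).2]
  rw [fin] at k012 k102
  exact ⟨k012, k102⟩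

end Rounding

/-! ### Self-testing -/

section SelfTest
variable {n : ℕ} {S : QuantumStrategy Line Cell (Fin 3 → ℤˣ) ℤˣ (Reg n) (Reg n)}

/-- All observables of `S` are `η`-close to traceless binary observables on register `ℓ`, and, up
to a unitary on this register, `η`-close to the canonical table. -/
def RegisterSelfTest (S : QuantumStrategy Line Cell (Fin 3 → ℤˣ) ℤˣ (Reg n) (Reg n)) (ℓ : Fin n)
    (η : ℝ) : Prop :=
  (∃ P Q : Fin 3 → Fin 3 → Matrix TwoQubit TwoQubit ℂ, ∀ i j : Fin 3,
    (IsBinaryObservable (P i j) ∧ (P i j).trace = 0) ∧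
    (IsBinaryObservable (Q i j) ∧ (Q i j).trace = 0) ∧
    normF (rowObs S i j - onRegister ℓ (P i j)) ≤ η ∧
    normF (colObs S i j - onRegister ℓ (P i j)) ≤ η ∧
    normF (bobObs S i j - onRegister ℓ (Q i j)) ≤ η) ∧
  (∃ U ∈ Matrix.unitaryGroup TwoQubit ℂ, ∀ i j : Fin 3,
    normF (onRegister ℓ U * rowObs S i j * onRegister ℓ Uᴴ -
      onRegister ℓ (pauliTable i j)) ≤ η ∧
    normF (onRegister ℓ U * colObs S i j * onRegister ℓ Uᴴ -
      onRegister ℓ (pauliTable i j)) ≤ η ∧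
    normF (onRegister ℓ (U.map star) * bobObs S i j * onRegister ℓ Uᵀ -
      onRegister ℓ (pauliTable i j)ᵀ) ≤ η)

theorem IsBinaryObservable.transpose {H : Type} [Fintype H] [DecidableEq H] {M : Matrix H H ℂ}
    (hM : IsBinaryObservable M) : IsBinaryObservable Mᵀ :=
  ⟨hM.1.transpose, by rw [← Matrix.transpose_mul, hM.2, Matrix.transpose_one]⟩

theorem normF_conj_sub_le {U : Matrix TwoQubit TwoQubit ℂ} (hU : U ∈ Matrix.unitaryGroup TwoQubit ℂ)
    (ℓ : Fin n) (R : Matrix (Reg n) (Reg n) ℂ) (N T : Matrix TwoQubit TwoQubit ℂ) :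
    normF (onRegister ℓ U * R * onRegister ℓ Uᴴ - onRegister ℓ T) ≤
      normF (R - onRegister ℓ N) + normF (U * N * Uᴴ - T) := by
  have h1 : Uᴴ * U = 1 := Matrix.mem_unitaryGroup_iff'.1 hU
  have h := normF_triangle (onRegister ℓ U * R * onRegister ℓ Uᴴ)
    (onRegister ℓ U * onRegister ℓ N * onRegister ℓ Uᴴ) (onRegister ℓ T)
  have e1 : onRegister ℓ U * R * onRegister ℓ Uᴴ - onRegister ℓ U * onRegister ℓ N * onRegister ℓ Uᴴ =
      onRegister ℓ U * (R - onRegister ℓ N) * onRegister ℓ Uᴴ := by noncomm_ring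
  rw [e1, normF_mul_unitary (by
      rw [← onRegister_conjTranspose, ← onRegister_mul, Matrix.conjTranspose_conjTranspose, h1,
        onRegister_one]),
    normF_unitary_mul (by
      rw [← onRegister_conjTranspose, ← onRegister_mul, h1, onRegister_one]),
    ← onRegister_mul, ← onRegister_mul, ← onRegister_sub, normF_onRegister] at h
  exact h

/-- Transposition turns Bob's conjugation by the complex conjugate of `U` into Alice's conjugation
by `U`. -/
theorem normF_conj_transpose (U : Matrix TwoQubit TwoQubit ℂ) (ℓ : Fin n)
    (R : Matrix (Reg n) (Reg n) ℂ) (T : Matrix TwoQubit TwoQubit ℂ) :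
    normF (onRegister ℓ (U.map star) * R * onRegister ℓ Uᵀ - onRegister ℓ Tᵀ) =
      normF (onRegister ℓ U * Rᵀ * onRegister ℓ Uᴴ - onRegister ℓ T) := by
  rw [← normF_transpose, Matrix.transpose_sub, Matrix.transpose_mul, Matrix.transpose_mul,
    ← onRegister_transpose, ← onRegister_transpose, ← onRegister_transpose,
    Matrix.transpose_transpose, Matrix.transpose_transpose, ← Matrix.mul_assoc]
  rfl

theorem registerSelfTest_of_two_le (ℓ : Fin n) {η : ℝ} (hη : 2 ≤ η) : RegisterSelfTest S ℓ η := by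
  have hb : ∀ {R : Matrix (Reg n) (Reg n) ℂ} (_ : normF R ≤ 1) {T : Matrix TwoQubit TwoQubit ℂ}
      (_ : IsBinaryObservable T), normF (R - onRegister ℓ T) ≤ η := by
    intro R hR T hT
    have h1 := normF_sub_le R (onRegister ℓ T)
    have h2 : normF (onRegister ℓ T) = 1 := by
      rw [← Matrix.mul_one (onRegister ℓ T),
        normF_unitary_mul (hT.onRegister ℓ).conjTranspose_mul_self, normF_one]
    linarith
  have hr : ∀ i j, normF (rowObs S i j) ≤ 1 := fun i j => by
    rw [rowObs_eq]; exact normF_povmOp_le_one _ fun _ => abs_signVal _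
  have hc : ∀ i j, normF (colObs S i j) ≤ 1 := fun i j => by
    rw [colObs_eq]; exact normF_povmOp_le_one _ fun _ => abs_signVal _
  have hq : ∀ i j, normF (bobObs S i j) ≤ 1 := fun i j => by
    rw [bobObs_eq]; exact normF_povmOp_le_one _ fun _ => abs_signVal _
  have hT := pauliTable_isBinaryObservable
  refine ⟨⟨pauliTable, pauliTable, fun i j => ⟨⟨hT i j, trace_pauliTable i j⟩,
    ⟨hT i j, trace_pauliTable i j⟩, hb (hr i j) (hT i j), hb (hc i j) (hT i j),
    hb (hq i j) (hT i j)⟩⟩, 1, one_mem _, fun i j => ?_⟩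
  rw [normF_conj_transpose]
  simp only [Matrix.conjTranspose_one, onRegister_one, one_mul, mul_one]
  exact ⟨hb (hr i j) (hT i j), hb (hc i j) (hT i j),
    hb (by rw [normF_transpose]; exact hq i j) (hT i j)⟩

/-- Only the row observables are rounded; columns and transposed Bob observables inherit the same
matrices by closeness, so both parity relations of a cell speak of one matrix `P i j`. -/
theorem exists_registerSelfTest {κ : ℝ} (hκ0 : 0 ≤ κ) (hκ : κ ≤ 1 / 100000000)
    (hw : ∀ x k, 1 - normF (lineObs S x (lineCell x k)) ^ 2 ≤ κ ^ 2)
    (hL : ∀ i j, normF (rowObs S i j - ∑ k, onRegister k (linPart (rowObs S i j) k)) ≤ κ)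
    (hrc : ∀ i j, normF (rowObs S i j - colObs S i j) ≤ 3 * κ)
    (hrb : ∀ i j, normF (rowObs S i j - (bobObs S i j)ᵀ) ≤ 2 * κ)
    (hbad : ∀ x, (ntr (povmOp (S.alice x) fun a =>
      if a 0 * a 1 * a 2 = lineParity x then 0 else 1)).re ≤ κ ^ 2) :
    ∃ ℓ, RegisterSelfTest S ℓ (40000000 * κ) := by
  have hrow : ∀ i j, ∃ ℓ M, IsBinaryObservable M ∧ M.trace = 0 ∧
      normF (rowObs S i j - onRegister ℓ M) ≤ 200 * κ := by
    intro i j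
    refine exists_binaryObservable_onRegister ?_ ?_ hκ0 (by linarith) ?_ (hL i j)
    · rw [rowObs_eq]; exact povmOp_isHermitian _ _
    · rw [rowObs_eq]; exact one_sub_povmOp_sq_posSemidef _ fun _ => abs_signVal _
    · rw [rowObs_eq]; exact hw (Sum.inl i) j
  choose L P hP hP0 hrP using hrow
  have hcP : ∀ i j, normF (colObs S i j - onRegister (L i j) (P i j)) ≤ 203 * κ := by
    intro i j
    have := normF_triangle (colObs S i j) (rowObs S i j) (onRegister (L i j) (P i j))
    rw [normF_sub_comm (colObs S i j) (rowObs S i j)] at this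
    linarith [hrc i j, hrP i j]
  have hsq : ∀ {u : ℝ} (_ : 0 ≤ u) (_ : u ≤ 203 * κ) {w : ℝ} (_ : 1 - w ≤ κ ^ 2),
      u ^ 2 + 1 - w ≤ (204 * κ) ^ 2 := by
    intro u h0 h1 w h2
    nlinarith
  have hsmall : 3 * (204 * κ) + 2 * κ < 1 := by linarith
  have relRow := fun i => relations_of_parity (S.alice (Sum.inl i)) (N := fun k => P i k)
    (ℓ := fun k => L i k) (fun k => hP i k) (fun k => hP0 i k) (by positivity) hκ0 hsmall
    (fun k => by
      rw [← lineObs_lineCell]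
      refine hsq (normF_nonneg _) ?_ (hw (Sum.inl i) k)
      have := hrP i k
      rw [rowObs_eq] at this
      change normF (lineObs S (Sum.inl i) (i, k) - _) ≤ _
      linarith) (hbad (Sum.inl i))
  have relCol := fun j => relations_of_parity (S.alice (Sum.inr j)) (N := fun k => P k j)
    (ℓ := fun k => L k j) (fun k => hP k j) (fun k => hP0 k j) (by positivity) hκ0 hsmall
    (fun k => by
      rw [← lineObs_lineCell]
      refine hsq (normF_nonneg _) ?_ (hw (Sum.inr j) k)
      have := hcP k j
      rwa [colObs_eq] at this) (hbad (Sum.inr j))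
  -- Column 0 links the three rows, and each row links its own cells.
  have hreg : ∀ i j, L i j = L 0 0 := by
    have h1 : ∀ i, L i 0 = L 0 0 := by
      intro i
      fin_cases i
      · rfl
      · exact (relCol 0).1.1
      · exact (relCol 0).1.2
    intro i j
    rw [← h1 i]
    fin_cases j
    · rfl
    · exact (relRow i).1.1
    · exact (relRow i).1.2
  have hrowSign : ∀ i, (signVal (lineParity (Sum.inl i)) : ℂ) = 1 := fun i => by
    simp [lineParity, signVal]
  have hcolSign : ∀ j : Fin 3, (signVal (lineParity (Sum.inr j)) : ℂ) = if j = 2 then -1 else 1 := by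
    intro j
    by_cases h : j = 2 <;> simp [lineParity, signVal, h]
  -- `614 = 3 * 204 + 2` is the error of the parity relations, and `60000 * 614 + 203 < 40000000`.
  obtain ⟨U, hU, hUP⟩ := exists_unitary_of_magicSquare_relations (η := 614 * κ) hP
    (fun i j => by rw [ntr, hP0, zero_div]) (by linarith)
    (fun i => by
      have := (relRow i).2
      rw [hrowSign, one_smul] at this
      exact ⟨by linarith [this.1], by linarith [this.2]⟩)
    (fun j => by
      have := (relCol j).2
      rw [hcolSign] at this
      exact ⟨by linarith [this.1], by linarith [this.2]⟩)
  simp only [hreg] at hrP hcP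
  have hqP : ∀ i j, normF ((bobObs S i j)ᵀ - onRegister (L 0 0) (P i j)) ≤ 202 * κ := by
    intro i j
    have := normF_triangle (bobObs S i j)ᵀ (rowObs S i j) (onRegister (L 0 0) (P i j))
    rw [normF_sub_comm (bobObs S i j)ᵀ (rowObs S i j)] at this
    linarith [hrb i j, hrP i j]
  refine ⟨L 0 0, ⟨P, fun i j => (P i j)ᵀ, fun i j => ⟨⟨hP i j, hP0 i j⟩,
    ⟨(hP i j).transpose, by rw [Matrix.trace_transpose, hP0]⟩, by linarith [hrP i j],
    by linarith [hcP i j], ?_⟩⟩, U, hU, fun i j => ⟨?_, ?_, ?_⟩⟩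
  · have := hqP i j
    rw [← normF_transpose, Matrix.transpose_sub, Matrix.transpose_transpose,
      ← onRegister_transpose] at this
    linarith
  · linarith [normF_conj_sub_le hU (L 0 0) (rowObs S i j) (P i j) (pauliTable i j), hrP i j,
      hUP i j]
  · linarith [normF_conj_sub_le hU (L 0 0) (colObs S i j) (P i j) (pauliTable i j), hcP i j,
      hUP i j]
  · rw [normF_conj_transpose]
    linarith [normF_conj_sub_le hU (L 0 0) (bobObs S i j)ᵀ (P i j) (pauliTable i j), hqP i j,
      hUP i j]

end SelfTest
end NoisyMS

/-! ### The self-testing theorem: choice of constants. -/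

theorem mainTheorem3 (ρ₀ : ℝ) (hρ₀ : 0 < ρ₀) :
    ∃ C : ℝ, 0 < C ∧
      ∀ (ρ : ℝ), ρ₀ ≤ ρ → ρ < 1 →
      ∀ (n : ℕ), 0 < n →
      ∀ (S : QuantumStrategy Line Cell (Fin 3 → ℤˣ) ℤˣ (Reg n) (Reg n)),
        S.state = noisyState n ρ →
      ∀ (t : ℕ) (p δ εwin γ ε : ℝ), 0 < t → 0 < p → 0 ≤ εwin →
        δ = Real.sqrt (2 * Real.log (2 / p) / t) →
        p ≤ tracePassProb S t δ →
        (1 + ρ) / 2 - εwin ≤ winProb magicSquare S →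
        γ = 1 / (1 - ρ) →
        ε = εwin + 9 * δ ^ 2 →
        ∃ ℓ : Fin n,
          (∀ i j : Fin 3,
            normF (rowObs S i j - colObs S i j) ≤ C * Real.sqrt ε ∧
            normF (rowObs S i j - (bobObs S i j)ᵀ) ≤ C * Real.sqrt ε ∧
            normF (colObs S i j - (bobObs S i j)ᵀ) ≤ C * Real.sqrt ε) ∧
          (∃ P Q : Fin 3 → Fin 3 → Matrix TwoQubit TwoQubit ℂ, ∀ i j : Fin 3,
            (IsBinaryObservable (P i j) ∧ (P i j).trace = 0) ∧
            (IsBinaryObservable (Q i j) ∧ (Q i j).trace = 0) ∧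
            normF (rowObs S i j - onRegister ℓ (P i j)) ≤ C * (γ * Real.sqrt ε) ∧
            normF (colObs S i j - onRegister ℓ (P i j)) ≤ C * (γ * Real.sqrt ε) ∧
            normF (bobObs S i j - onRegister ℓ (Q i j)) ≤ C * (γ * Real.sqrt ε)) ∧
          (∃ U ∈ Matrix.unitaryGroup TwoQubit ℂ, ∀ i j : Fin 3,
            normF (onRegister ℓ U * rowObs S i j * onRegister ℓ Uᴴ -
              onRegister ℓ (pauliTable i j)) ≤ C * (γ * Real.sqrt ε) ∧
            normF (onRegister ℓ U * colObs S i j * onRegister ℓ Uᴴ -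
              onRegister ℓ (pauliTable i j)) ≤ C * (γ * Real.sqrt ε) ∧
            normF (onRegister ℓ (U.map star) * bobObs S i j * onRegister ℓ Uᵀ -
              onRegister ℓ (pauliTable i j)ᵀ) ≤ C * (γ * Real.sqrt ε)) := by
  refine ⟨10000000000 / ρ₀, by positivity, ?_⟩
  intro ρ hρ hρ1 n hn S hS t p δ εwin γ ε ht hp hεw hδ hpass hwin hγ hε
  have hρpos : 0 < ρ := hρ₀.trans_le hρ
  have hδ0 : 0 ≤ δ := hδ ▸ Real.sqrt_nonneg _
  have htr := abs_ntr_le_of_tracePassProb hS ht hp hδ hpass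
  have hA : ∀ x k, |(ntr (lineObs S x (lineCell x k))).re| ≤ 6 * δ := by
    rintro (i | j) k
    · have := (htr i k).1
      rwa [rowObs_eq] at this
    · have := (htr k j).2.1
      rwa [colObs_eq] at this
  have hB : ∀ y, |(ntr (povmOp (S.bob y) signVal)).re| ≤ 6 * δ := by
    rintro ⟨i, j⟩
    have := (htr i j).2.2
    rwa [bobObs_eq] at this
  have hε0 : 0 ≤ ε := by rw [hε]; positivity
  obtain ⟨s, hs⟩ : ∃ s, s = Real.sqrt ε := ⟨_, rfl⟩
  have hs0 : 0 ≤ s := hs ▸ Real.sqrt_nonneg _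
  have hs2 : s ^ 2 = ε := hs ▸ Real.sq_sqrt hε0
  rw [← hs]
  have hγ1 : 1 ≤ γ := by rw [hγ, le_div_iff₀ (by linarith)]; linarith
  have hγρ : 1 / (ρ * (1 - ρ)) = γ / ρ := by rw [hγ]; field_simp
  have hr1 : 1 ≤ 1 / ρ₀ := by rw [le_div_iff₀ hρ₀]; linarith
  obtain ⟨r, hr⟩ : ∃ r, r = 1 / ρ₀ := ⟨_, rfl⟩
  rw [← hr] at hr1
  have hρr : 1 / ρ ≤ r ^ 2 := by
    have h1 : 1 / ρ ≤ r := hr ▸ one_div_le_one_div_of_le hρ₀ hρ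
    nlinarith
  -- With `τ = 6 * δ`, `17 * τ ^ 2 + τ ^ 2 = 648 * δ ^ 2 = 72 * (9 * δ ^ 2)`, so the deficit is `K =
  -- 72 * ε`.
  have hcorr : ∀ x k, ρ - 72 * ε + (6 * δ) ^ 2 ≤
      noiseCorr ρ (lineObs S x (lineCell x k)) (povmOp (S.bob (lineCell x k)) signVal)ᵀ := by
    intro x k
    have := le_noiseCorr_lineObs hS hρpos.le hρ1.le hA hB hwin x k
    rw [hε]
    linarith
  have hHA : ∀ x k, (lineObs S x (lineCell x k)).IsHermitian := fun x k => povmOp_isHermitian _ _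
  have hHB : ∀ y, ((povmOp (S.bob y) signVal)ᵀ).IsHermitian := fun y =>
    (povmOp_isHermitian _ _).transpose
  have hA1 : ∀ x k, normF (lineObs S x (lineCell x k)) ≤ 1 := fun x k =>
    normF_povmOp_le_one _ fun _ => abs_signVal _
  have hB1 : ∀ y, normF (povmOp (S.bob y) signVal)ᵀ ≤ 1 := fun y => by
    rw [normF_transpose]; exact normF_povmOp_le_one _ fun _ => abs_signVal _
  have hBt : ∀ y, |(ntr (povmOp (S.bob y) signVal)ᵀ).re| ≤ 6 * δ := fun y => by
    rw [ntr_transpose]; exact hB y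
  -- `4 * 72 = 288 ≤ 17 ^ 2`.
  have hAB : ∀ x k, normF (lineObs S x (lineCell x k) - (povmOp (S.bob (lineCell x k)) signVal)ᵀ) ≤
      17 * (r * s) := by
    intro x k
    have h := normF_sub_sq_le_of_noiseCorr (hHA x k) (hHB _) (hA1 x k) (hB1 _) hρpos hρ1.le
      (hA x k) (hBt _) (hcorr x k)
    refine (abs_le_of_sq_le_sq' (h.trans ?_) (by positivity)).2
    have h1 := mul_le_mul_of_nonneg_left hρr hε0
    have h2 : 4 * (72 * ε) / ρ = 288 * (ε * (1 / ρ)) := by ring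
    have h3 : (17 * (r * s)) ^ 2 = 289 * (ε * r ^ 2) := by rw [← hs2]; ring
    have h4 : 0 ≤ ε * r ^ 2 := by positivity
    linarith
  have hwt := fun x k => weights_le_of_noiseCorr (hHA x k) (hHB _) (hA1 x k) (hB1 _) hρpos hρ1
    (hA x k) (hBt _) (hcorr x k)
  have hrb : ∀ i j, normF (rowObs S i j - (bobObs S i j)ᵀ) ≤ 17 * (r * s) := fun i j => by
    rw [rowObs_eq, bobObs_eq]; exact hAB (Sum.inl i) j
  have hcb : ∀ i j, normF (colObs S i j - (bobObs S i j)ᵀ) ≤ 17 * (r * s) := fun i j => by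
    rw [colObs_eq, bobObs_eq]; exact hAB (Sum.inr j) i
  have hrc : ∀ i j, normF (rowObs S i j - colObs S i j) ≤ 34 * (r * s) := fun i j => by
    have := normF_triangle (rowObs S i j) (bobObs S i j)ᵀ (colObs S i j)
    rw [normF_sub_comm (bobObs S i j)ᵀ (colObs S i j)] at this
    linarith [hrb i j, hcb i j]
  have hrs : 0 ≤ r * s := by positivity
  have hC : 10000000000 / ρ₀ = 10000000000 * r := by rw [hr]; ring
  rw [hC]
  -- `13 ^ 2 = 169` covers the `2 * 72 = 144` from the weights plus the 4 from the squared trace;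
  -- `γ` is needed only for the mass above weight one.
  obtain ⟨κ, hκ⟩ : ∃ κ, κ = 13 * (r * (γ * s)) := ⟨_, rfl⟩
  have hκrs : 13 * (r * s) ≤ κ := by
    have h := le_mul_of_one_le_left hrs hγ1
    rw [hκ]
    linarith
  have hκ0 : 0 ≤ κ := by linarith
  have key : ∃ ℓ, RegisterSelfTest S ℓ (200000000 * κ) := by
    -- For large `κ` the target `200000000 * κ` exceeds 2 and any register serves.
    rcases le_or_gt κ (1 / 100000000) with hsmall | hlarge
    · have hsκ : 13 * s ≤ κ := by
        have h := le_mul_of_one_le_left hs0 hr1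
        linarith
      have hsκ2 : 169 * ε ≤ κ ^ 2 := by rw [← hs2]; nlinarith
      have hrεκ : 169 * (ε * r ^ 2) ≤ κ ^ 2 := by rw [← hs2]; nlinarith
      have hδs : 3 * δ ≤ s := by
        refine (abs_le_of_sq_le_sq' ?_ hs0).2
        rw [hs2, hε]
        linarith
      obtain ⟨ℓ, hℓ⟩ := exists_registerSelfTest hκ0 hsmall
        (fun x k => (hwt x k).1.trans (by
          have h1 := mul_le_mul_of_nonneg_left hρr hε0
          have h2 : 2 * (72 * ε) / ρ = 144 * (ε * (1 / ρ)) := by ring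
          have h4 : 0 ≤ ε * r ^ 2 := by positivity
          linarith))
        (fun i j => by
          have h := (hwt (Sum.inl i) j).2
          rw [rowObs_eq]
          refine (abs_le_of_sq_le_sq' (h.trans ?_) hκ0).2
          have h2 : 2 * (72 * ε) / (ρ * (1 - ρ)) = 144 * (ε * γ * (1 / ρ)) := by
            rw [div_eq_mul_one_div, hγρ]; ring
          have h1 := mul_le_mul_of_nonneg_left hρr (a := ε * γ) (by positivity)
          have h3 : κ ^ 2 = 169 * (ε * γ * r ^ 2) * γ := by rw [hκ, ← hs2]; ring
          have h5 : 0 ≤ ε * γ * r ^ 2 := by positivity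
          have h6 : ε ≤ ε * γ * r ^ 2 := by
            rw [mul_assoc]
            exact le_mul_of_one_le_right hε0 (one_le_mul_of_one_le_of_one_le hγ1 (one_le_pow₀ hr1))
          have h7 := le_mul_of_one_le_right (a := 169 * (ε * γ * r ^ 2)) (by positivity) hγ1
          have h8 : 36 * δ ^ 2 ≤ 4 * ε := by rw [hε]; linarith
          linarith)
        (fun i j => (hrc i j).trans (by linarith))
        (fun i j => (hrb i j).trans (by linarith))
        (fun x => (ntr_bad_parity_le hS hρpos.le hρ1.le hA hB (by linarith) hwin x).trans (by
          have h : 72 * εwin + 36 * (6 * δ) ^ 2 = 144 * ε - 72 * εwin := by rw [hε]; ring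
          linarith))
      obtain ⟨⟨P, Q, hPQ⟩, U, hU, hUP⟩ := hℓ
      have hle : 40000000 * κ ≤ 200000000 * κ := by linarith
      refine ⟨ℓ, ⟨P, Q, fun i j => ?_⟩, U, hU, fun i j => ?_⟩
      · obtain ⟨h1, h2, h3, h4, h5⟩ := hPQ i j
        exact ⟨h1, h2, h3.trans hle, h4.trans hle, h5.trans hle⟩
      · obtain ⟨h1, h2, h3⟩ := hUP i j
        exact ⟨h1.trans hle, h2.trans hle, h3.trans hle⟩
    · exact ⟨⟨0, hn⟩, registerSelfTest_of_two_le _ (by linarith)⟩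
  obtain ⟨ℓ, ⟨P, Q, hPQ⟩, U, hU, hUP⟩ := key
  have hle : 200000000 * κ ≤ 10000000000 * r * (γ * s) := by
    have : 0 ≤ r * (γ * s) := by positivity
    rw [hκ]
    linarith
  refine ⟨ℓ, fun i j => ⟨?_, ?_, ?_⟩, ⟨P, Q, fun i j => ?_⟩, U, hU, fun i j => ?_⟩
  · linarith [hrc i j]
  · linarith [hrb i j]
  · linarith [hcb i j]
  · obtain ⟨h1, h2, h3, h4, h5⟩ := hPQ i j
    exact ⟨h1, h2, h3.trans hle, h4.trans hle, h5.trans hle⟩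
  · obtain ⟨h1, h2, h3⟩ := hUP i j
    exact ⟨h1.trans hle, h2.trans hle, h3.trans hle⟩
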